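/- Let $m>0$, let $f\in C^1(\mathbb{R},\mathbb{R})$ with $f(0)=0$, put $g=m-f$, and let $\omega\in\mathbb{R}$. Let $\sigma_1,\sigma_2,\sigma_3$ be the Pauli matrices, $\alpha^j=\begin{bmatrix}0&\sigma_j\\ \sigma_j&0\end{bmatrix}$, $\beta=\begin{bmatrix}I_2&0\\0&-I_2\end{bmatrix}$, $D_0=-\mathrm{i}\sum_j\alpha^j\partial_j$, $\varSigma=\sum_j\sigma_j\partial_j$, and, for $x\in\mathbb{R}^3\setminus\{0\}$, $r=|x|$, $\sigma_r=r^{-1}\sum_j x_j\sigma_j$; $e_1,e_2$ is the standard basis of $\mathbb{C}^2$. Let $v,u:(0,\infty)\to\mathbb{R}$ be bounded differentiable solutions of $$\omega v=u'+\tfrac2r u+g(v^2-u^2)v,\qquad \omega u=-v'-g(v^2-u^2)u,\qquad r>0,$$ and let $\phi(x)=\begin{bmatrix}v(r)e_1\\ \mathrm{i}\sigma_r u(r)e_1\end{bmatrix}$ be the amplitude of the solitary wave $\phi(x)e^{-\mathrm{i}\omega t}$ of the Soler model $\mathrm{i}\partial_t\psi=D_0\psi+g(\psi^*\beta\psi)\beta\psi$.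 Define on the domain $H^1(\mathbb{R}^3,\mathbb{C}^4)\subset L^2(\mathbb{R}^3,\mathbb{C}^4)$ the operators $$\mathcal{L}_0=D_0+g\beta-\omega,\qquad \mathcal{L}\rho=\mathcal{L}_0\rho+2g'\beta\phi\,\mathrm{Re}(\phi^*\beta\rho),$$ with $g,g'$ evaluated at $\phi^*\beta\phi=v^2-u^2$ (the operator $\mathcal{L}$ is only $\mathbb{R}$-linear). For $0\le k\le\ell$ let $$h_{\ell,k}(\theta,\varphi)=\sqrt{\tfrac{2\ell+1}{4\pi}\tfrac{(\ell-k)!}{(\ell+k)!}}\,e^{\mathrm{i}k\varphi}\,(1-w^2)^{k/2}\,\frac{d^kP_\ell}{dw^k}(w)\Big|_{w=\cos\theta},\qquad h_{\ell,-k}=\overline{h_{\ell,k}},$$ with $P_\ell$ the Legendre polynomials. For $\Psi=(A,P,B,Q):(0,\infty)\to\mathbb{C}^4$ write $$U_{\ell,k}\Psi=\begin{bmatrix}(A+B\sigma_r\varSigma)h_{\ell,k}e_1\\ \mathrm{i}\sigma_r(P+Q\sigma_r\varSigma)h_{\ell,k}e_1\end{bmatrix},$$ where $A,P,B,Q$ are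 evaluated at $r=|x|$ and multiply after $\varSigma$ has been applied. For $\ell\in\mathbb{N}_0$ and $1\le k\le\ell$ let $$\mathscr{X}_{\ell,0}=\{U_{\ell,0}\Psi\}\cap L^2,\quad \mathscr{X}_{\ell,k}=\{U_{\ell,k}\Psi_++U_{\ell,-k}\Psi_-\}\cap L^2,\quad \mathscr{Y}_\ell=\Big\{\begin{bmatrix}R\,h_{\ell,-\ell}e_2\\ \mathrm{i}\sigma_r S\,h_{\ell,-\ell}e_2\end{bmatrix}\Big\}\cap L^2,$$ where $L^2=L^2(\mathbb{R}^3,\mathbb{C}^4)$ and $\Psi,\Psi_\pm,R,S$ range over the measurable functions of $r$. Then: 1. The subspaces $\mathscr{X}_{\ell,0}$, $\mathscr{X}_{\ell,k}$ and $\mathscr{Y}_\ell$ are invariant under $\mathcal{L}$: $\mathcal{L}$ maps the intersection of each of them with $H^1$ into the same subspace. 2. The operator $\mathcal{L}_0$ is self-adjoint, and $\mathcal{L}\rho=\mathcal{L}_0\rho$ for all $\rho\in\mathscr{Y}_\ell\cap H^1$. Hence the restriction $\mathcal{L}|_{\mathscr{Y}_\ell}$, with domain $\mathscr{Y}_\ell\cap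 H^1$, is a $\mathbb{C}$-linear operator in $\mathscr{Y}_\ell$, and $\sigma(-\mathrm{i}\mathcal{L}|_{\mathscr{Y}_\ell})\subset\mathrm{i}\mathbb{R}$. 3. (Radial reduction.) With $\varkappa_\ell=\ell(\ell+1)$, $W=g'\begin{bmatrix}v^2&-uv\\-uv&u^2\end{bmatrix}$, and, acting on $(A,P,B,Q)$, $$L_0=\begin{bmatrix}g-\omega&\partial_r+\frac2r&0&-\frac{\varkappa_\ell}{r^2}\\-\partial_r&-g-\omega&-\frac{\varkappa_\ell}{r^2}&0\\0&-1&g-\omega&\partial_r\\-1&0&-\partial_r&-g-\omega\end{bmatrix},$$ put, for $0\le k\le\ell$, $$\mathbf{A}_{\ell,k}=-\mathrm{i}\left\{\begin{bmatrix}L_0&0\\0&-L_0\end{bmatrix}+\begin{bmatrix}W&-\frac kr W&W&\frac kr W\\0&0&0&0\\-W&\frac kr W&-W&-\frac kr W\\0&0&0&0\end{bmatrix}\right\}.$$ If $\rho=U_{\ell,0}\Psi\in H^1$ with $\Psi\in C^1((0,\infty),\mathbb{C}^4)$, then $-\mathrm{i}\mathcal{L}\rho=U_{\ell,0}\Phi$,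 where $(\Phi,\bar\Phi)=\mathbf{A}_{\ell,0}(\Psi,\bar\Psi)$. If $1\le k\le\ell$ and $\rho=U_{\ell,k}\Psi_++U_{\ell,-k}\Psi_-\in H^1$ with $\Psi_\pm\in C^1((0,\infty),\mathbb{C}^4)$, then $-\mathrm{i}\mathcal{L}\rho=U_{\ell,k}\Phi_++U_{\ell,-k}\Phi_-$, where $(\Phi_+,\overline{\Phi_-})=\mathbf{A}_{\ell,k}(\Psi_+,\overline{\Psi_-})$. -/

import Mathlib

open MeasureTheory Complex Set
open scoped ENNReal LineDeriv SchwartzMap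

noncomputable section

namespace Soler

/-! ### Spaces of spinors -/

/-- Physical space `ℝ³`. -/
abbrev Space := EuclideanSpace ℝ (Fin 3)

/-- Four-component spinors `ℂ⁴ = ℂ² ⊕ ℂ²` (upper and lower block). -/
abbrev Spinor := EuclideanSpace ℂ (Fin 2 ⊕ Fin 2)

/-- `L²(ℝ³, ℂ⁴)`. -/
abbrev L2 := Lp Spinor 2 (volume : Measure Space)

/-- The spinor with upper block `a` and lower block `b`. -/
def block (a b : Fin 2 → ℂ) : Spinor := WithLp.toLp 2 (Sum.elim a b)

/-- The Pauli matrices. -/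
def pauli : Fin 3 → Matrix (Fin 2) (Fin 2) ℂ :=
  ![!![0, 1; 1, 0], !![0, -I; I, 0], !![1, 0; 0, -1]]

/-- The Dirac matrices `αʲ`, acting on spinors. -/
def alpha (j : Fin 3) : Spinor →L[ℂ] Spinor :=
  Matrix.toEuclideanCLM (𝕜 := ℂ) (Matrix.fromBlocks 0 (pauli j) (pauli j) 0)

/-- The Dirac matrix `β`, acting on spinors. -/
def beta : Spinor →L[ℂ] Spinor :=
  Matrix.toEuclideanCLM (𝕜 := ℂ) (Matrix.fromBlocks 1 0 0 (-1))

/-- `n · σ` for a vector `n`. -/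
def sigmaDot (n : Space) : Matrix (Fin 2) (Fin 2) ℂ := ∑ j, (n j : ℂ) • pauli j

/-- `σ_r = r⁻¹ x · σ`. -/
def sigmaR (x : Space) : Matrix (Fin 2) (Fin 2) ℂ := sigmaDot (‖x‖⁻¹ • x)

/-- The standard basis vectors of `ℂ²` (`e 0` is `e₁`, `e 1` is `e₂`). -/
def e (k : Fin 2) : Fin 2 → ℂ := Pi.single k 1

/-- The operator `Σ = σ · ∇` (classical derivatives) on two-component functions. -/
def Sig (F : Space → Fin 2 → ℂ) (x : Space) : Fin 2 → ℂ :=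
  ∑ j, (pauli j).mulVec (fderiv ℝ F x (EuclideanSpace.single j 1))

/-! ### Sobolev space and the free Dirac operator -/

/-- `H¹(ℝ³, ℂ⁴)` as a subspace of `L²(ℝ³, ℂ⁴)`. -/
def H1 : Submodule ℂ L2 where
  carrier := {f | TemperedDistribution.MemSobolev 1 2 (f : 𝓢'(Space, Spinor))}
  zero_mem' := by
    have h := TemperedDistribution.memSobolev_fun_zero Space Spinor 1 2
    rw [← map_zero (Lp.toTemperedDistributionCLM Spinor (volume : Measure Space) 2)] at h
    exact h
  add_mem' := by
    intro f g hf hg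
    have h := TemperedDistribution.MemSobolev.add hf hg
    rw [← Lp.toTemperedDistributionCLM_apply, ← Lp.toTemperedDistributionCLM_apply,
      ← map_add] at h
    exact h
  smul_mem' := by
    intro c f hf
    have h := TemperedDistribution.MemSobolev.smul c hf
    rw [← Lp.toTemperedDistributionCLM_apply, ← map_smul] at h
    exact h

lemma exists_partial (j : Fin 3) (f : H1) :
    ∃ g : L2, ∂_{(EuclideanSpace.single j (1 : ℝ) : Space)} ((f : L2) : 𝓢'(Space, Spinor)) =
      (g : 𝓢'(Space, Spinor)) := by
  have h := TemperedDistribution.MemSobolev.lineDerivOp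
    (m := (EuclideanSpace.single j (1 : ℝ) : Space)) f.2
  rw [sub_self] at h
  exact TemperedDistribution.memSobolev_zero_iff.mp h

lemma toDistribution_injective :
    Function.Injective (Lp.toTemperedDistributionCLM Spinor (volume : Measure Space) 2) :=
  LinearMap.ker_eq_bot.mp Lp.ker_toTemperedDistributionCLM_eq_bot

/-- The weak partial derivative `∂_j : H¹ → L²`: the `L²` function representing the
distributional derivative. -/
def partialD (j : Fin 3) : H1 →ₗ[ℂ] L2 where
  toFun f := (exists_partial j f).choose
  map_add' f g := by
    apply toDistribution_injective
    rw [map_add]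
    simp only [Lp.toTemperedDistributionCLM_apply]
    rw [← (exists_partial j (f + g)).choose_spec, ← (exists_partial j f).choose_spec,
      ← (exists_partial j g).choose_spec, ← LineDeriv.lineDerivOp_add]
    simp only [← Lp.toTemperedDistributionCLM_apply, Submodule.coe_add, map_add]
  map_smul' c f := by
    apply toDistribution_injective
    rw [map_smul]
    simp only [Lp.toTemperedDistributionCLM_apply, RingHom.id_apply]
    rw [← (exists_partial j (c • f)).choose_spec, ← (exists_partial j f).choose_spec,
      ← LineDeriv.lineDerivOp_smul]
    simp only [← Lp.toTemperedDistributionCLM_apply, Submodule.coe_smul, map_smul]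

/-- The free Dirac operator `D₀ = -i α · ∇ : H¹ → L²`. -/
def D0 : H1 →ₗ[ℂ] L2 :=
  (-I) • ∑ j, ((alpha j).compLpL 2 (volume : Measure Space)).toLinearMap ∘ₗ partialD j

/-- Multiplication by a bounded measurable function `M` with values in the `𝕜`-linear maps of
`ℂ⁴` (here `𝕜` is `ℝ` or `ℂ`): `(mulOp M ρ)(x) = M(x) ρ(x)`. -/
def mulOp {𝕜 : Type} [RCLike 𝕜] [NormedSpace 𝕜 Spinor] (M : Space → Spinor →L[𝕜] Spinor)
    (hM : AEStronglyMeasurable M volume) (hb : ∃ C : ℝ, ∀ᵐ x, ‖M x‖ ≤ C) : L2 →ₗ[𝕜] L2 :=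
  have hmem : ∀ f : L2, MemLp (fun x => M x (f x)) 2 volume := fun f => by
    obtain ⟨C, hC⟩ := hb
    refine (Lp.memLp f).of_le_mul (c := C) ?_ ?_
    · have hc : Continuous fun p : (Spinor →L[𝕜] Spinor) × Spinor => p.1 p.2 := by fun_prop
      exact hc.comp_aestronglyMeasurable (hM.prodMk (Lp.aestronglyMeasurable f))
    · filter_upwards [hC] with x hx
      exact (M x).le_of_opNorm_le hx _
  { toFun := fun f => (hmem f).toLp
    map_add' := fun f g => by
      rw [← MemLp.toLp_add, MemLp.toLp_eq_toLp_iff]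
      filter_upwards [Lp.coeFn_add f g] with x hx
      rw [hx, Pi.add_apply, map_add, Pi.add_apply]
    map_smul' := fun c f => by
      rw [RingHom.id_apply, ← MemLp.toLp_const_smul, MemLp.toLp_eq_toLp_iff]
      filter_upwards [Lp.coeFn_smul c f] with x hx
      rw [hx, Pi.smul_apply, map_smul, Pi.smul_apply] }

/-! ### The Soler model, one-frequency solitary waves, linearization -/

/-- The data of the Soler model `i ∂ₜψ = -i α·∇ψ + (m - f(ψ*βψ)) βψ`. -/
structure Model where
  /-- the mass -/
  m : ℝ
  m_pos : 0 < m
  /-- the nonlinearity -/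
  f : ℝ → ℝ
  f_zero : f 0 = 0
  f_contDiff : ContDiff ℝ 1 f

/-- `g(τ) = m - f(τ)`. -/
def Model.g (S : Model) (τ : ℝ) : ℝ := S.m - S.f τ

/-- Profiles `v, u` of a one-frequency solitary wave `φ(x) e^{-iωt}`,
`φ = (v e₁, i σ_r u e₁)`: real-valued bounded solutions on `r > 0` of the radial system
`ω v = u' + (2/r) u + g(v² - u²) v`, `ω u = -v' - g(v² - u²) u`.
(Decay at infinity is not needed and not required.) -/
structure SolitaryWave (S : Model) (ω : ℝ) where
  v : ℝ → ℝ
  u : ℝ → ℝ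
  differentiableAt_v : ∀ r, 0 < r → DifferentiableAt ℝ v r
  differentiableAt_u : ∀ r, 0 < r → DifferentiableAt ℝ u r
  eq_v : ∀ r, 0 < r → ω * v r = deriv u r + 2 / r * u r + S.g (v r ^ 2 - u r ^ 2) * v r
  eq_u : ∀ r, 0 < r → ω * u r = -deriv v r - S.g (v r ^ 2 - u r ^ 2) * u r
  bounded : ∃ C : ℝ, ∀ r, 0 < r → |v r| ≤ C ∧ |u r| ≤ C

/-- The spinor `(v e₁, i u (n · σ) e₁)`. -/
def profile (v u : ℝ) (n : Space) : Spinor :=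
  block ((v : ℂ) • e 0) ((I * (u : ℂ)) • (sigmaDot n).mulVec (e 0))

lemma continuous_profile :
    Continuous fun p : ℝ × ℝ × Space => profile p.1 p.2.1 p.2.2 := by
  unfold profile block sigmaDot
  have hv : Continuous fun p : ℝ × ℝ × Space => (p.1 : ℂ) • e 0 := by fun_prop
  have hI : Continuous fun p : ℝ × ℝ × Space => I * (p.2.1 : ℂ) := by fun_prop
  have hs : Continuous fun p : ℝ × ℝ × Space => ∑ j, (p.2.2 j : ℂ) • pauli j := by fun_prop
  have hu := hI.smul (hs.matrix_mulVec (continuous_const (y := e 0)))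
  refine (PiLp.continuous_toLp 2 _).comp (continuous_pi ?_)
  rintro (i | i)
  · exact (continuous_apply i).comp hv
  · exact (continuous_apply i).comp hu

lemma Model.continuous_g (S : Model) : Continuous S.g :=
  continuous_const.sub S.f_contDiff.continuous

lemma Model.continuous_deriv_g (S : Model) : Continuous (deriv S.g) := by
  have h : ContDiff ℝ 1 S.g := contDiff_const.sub S.f_contDiff
  exact h.continuous_deriv le_rfl

namespace SolitaryWave

variable {S : Model} {ω : ℝ} (w : SolitaryWave S ω)

/-- The amplitude `φ(x) = (v(r) e₁, i σ_r u(r) e₁)`, `r = |x|`. -/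
def phi (x : Space) : Spinor := profile (w.v ‖x‖) (w.u ‖x‖) (‖x‖⁻¹ • x)

/-- `τ = φ*βφ = v² - u²` as a function of the radius. -/
def tau (r : ℝ) : ℝ := w.v r ^ 2 - w.u r ^ 2

/-- The multiplication `ρ ↦ g βρ`, `g = g(φ*βφ)`. -/
def potential (x : Space) : Spinor →L[ℂ] Spinor := ((S.g (w.tau ‖x‖) : ℝ) : ℂ) • beta

/-- The real-linear map `ρ ↦ 2 g' βφ Re(φ*βρ)`, `g' = g'(φ*βφ)`. -/
def rePotential (x : Space) : Spinor →L[ℝ] Spinor :=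
  ((2 * deriv S.g (w.tau ‖x‖)) •
    (reCLM ∘L ((innerSL ℂ (w.phi x)) ∘L beta).restrictScalars ℝ)).smulRight (beta (w.phi x))

lemma rePotential_apply (x : Space) (z : Spinor) :
    w.rePotential x z =
      (2 * deriv S.g (w.tau ‖x‖) * (inner ℂ (w.phi x) (beta z)).re) • beta (w.phi x) := by
  simp [rePotential]

lemma aux {X : Type*} [NormedAddCommGroup X] (K : ℝ × ℝ × Space → X) (hK : Continuous K) :
    AEStronglyMeasurable (fun x : Space => K (w.v ‖x‖, w.u ‖x‖, ‖x‖⁻¹ • x)) volume ∧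
      ∃ C : ℝ, ∀ᵐ x : Space, ‖K (w.v ‖x‖, w.u ‖x‖, ‖x‖⁻¹ • x)‖ ≤ C := by
  have hne : ∀ᵐ x : Space, x ≠ 0 := by
    simp [ae_iff]
  constructor
  · have hcont : ContinuousOn (fun x : Space => K (w.v ‖x‖, w.u ‖x‖, ‖x‖⁻¹ • x)) {0}ᶜ := by
      intro x hx
      have hx0 : 0 < ‖x‖ := norm_pos_iff.mpr hx
      have hv : ContinuousAt (fun y : Space => w.v ‖y‖) x :=
        ContinuousAt.comp (f := fun y : Space => ‖y‖)
          (w.differentiableAt_v _ hx0).continuousAt continuous_norm.continuousAt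
      have hu : ContinuousAt (fun y : Space => w.u ‖y‖) x :=
        ContinuousAt.comp (f := fun y : Space => ‖y‖)
          (w.differentiableAt_u _ hx0).continuousAt continuous_norm.continuousAt
      have hn : ContinuousAt (fun y : Space => ‖y‖⁻¹ • y) x :=
        (continuous_norm.continuousAt.inv₀ hx0.ne').smul continuousAt_id
      exact (hK.continuousAt.comp (hv.prodMk (hu.prodMk hn))).continuousWithinAt
    have h := hcont.aestronglyMeasurable (μ := volume) (measurableSet_singleton 0).compl
    rwa [Measure.restrict_eq_self_of_ae_mem (by simpa using hne)] at h
  · obtain ⟨C, hC⟩ := w.bounded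
    have hcomp : IsCompact (Icc (-C) C ×ˢ (Icc (-C) C ×ˢ Metric.closedBall (0 : Space) 1)) :=
      isCompact_Icc.prod (isCompact_Icc.prod (isCompact_closedBall _ _))
    obtain ⟨B, hB⟩ := hcomp.exists_bound_of_continuousOn hK.continuousOn
    refine ⟨B, ?_⟩
    filter_upwards [hne] with x hx
    have hx0 : 0 < ‖x‖ := norm_pos_iff.mpr hx
    refine hB _ ⟨abs_le.mp (hC _ hx0).1, abs_le.mp (hC _ hx0).2, ?_⟩
    simp [norm_smul, hx0.ne']

lemma potential_aux : AEStronglyMeasurable w.potential volume ∧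
    ∃ C : ℝ, ∀ᵐ x : Space, ‖w.potential x‖ ≤ C := by
  refine w.aux (fun p => ((S.g (p.1 ^ 2 - p.2.1 ^ 2) : ℝ) : ℂ) • beta) ?_
  have := S.continuous_g
  fun_prop

lemma rePotential_aux : AEStronglyMeasurable w.rePotential volume ∧
    ∃ C : ℝ, ∀ᵐ x : Space, ‖w.rePotential x‖ ≤ C := by
  refine w.aux (fun p => ((2 * deriv S.g (p.1 ^ 2 - p.2.1 ^ 2)) •
    (reCLM ∘L ((innerSL ℂ (profile p.1 p.2.1 p.2.2)) ∘L beta).restrictScalars ℝ)).smulRight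
      (beta (profile p.1 p.2.1 p.2.2))) ?_
  have h1 := S.continuous_deriv_g
  have h2 := continuous_profile
  have h3 : Continuous fun L : Spinor →L[ℂ] ℂ => L.restrictScalars ℝ :=
    (ContinuousLinearMap.restrictScalarsL ℂ Spinor ℂ ℝ ℝ).continuous
  have h4 : Continuous fun p : ℝ × ℝ × Space =>
      ((innerSL ℂ (profile p.1 p.2.1 p.2.2)) ∘L beta).restrictScalars ℝ :=
    h3.comp (((innerSL ℂ).continuous.comp h2).clm_comp continuous_const)
  have h5 : Continuous fun p : (Spinor →L[ℝ] ℝ) × Spinor => p.1.smulRight p.2 :=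
    (ContinuousLinearMap.smulRightL ℝ Spinor Spinor).continuous₂
  have h6 : Continuous fun p : ℝ × ℝ × Space => 2 * deriv S.g (p.1 ^ 2 - p.2.1 ^ 2) := by
    fun_prop
  exact h5.comp ((h6.smul (continuous_const.clm_comp h4)).prodMk (beta.continuous.comp h2))

/-- `D₀ + gβ - ω` as a linear map on `H¹`. -/
def linMap : H1 →ₗ[ℂ] L2 :=
  D0 + mulOp w.potential w.potential_aux.1 w.potential_aux.2 ∘ₗ H1.subtype - (ω : ℂ) • H1.subtype

/-- The operator `ℒ₀ = D₀ + gβ - ω` with domain `H¹`. -/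
def lin0 : L2 →ₗ.[ℂ] L2 where
  domain := H1
  toFun := w.linMap

/-- The linearization `ℒρ = D₀ρ + gβρ - ωρ + 2g' βφ Re(φ*βρ)` with domain `H¹`; it is only
`ℝ`-linear. -/
def lin : L2 →ₗ.[ℝ] L2 where
  domain := H1.restrictScalars ℝ
  toFun := (w.linMap.restrictScalars ℝ : H1 →ₗ[ℝ] L2) +
    (mulOp w.rePotential w.rePotential_aux.1 w.rePotential_aux.2 ∘ₗ
      (H1.subtype.restrictScalars ℝ) : H1 →ₗ[ℝ] L2)

end SolitaryWave

/-! ### Spherical harmonics -/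

/-- The Legendre polynomial `P_ℓ(w) = (2^ℓ ℓ!)⁻¹ (d/dw)^ℓ (w² - 1)^ℓ`. -/
def legendre (ℓ : ℕ) : Polynomial ℝ :=
  Polynomial.C ((2 ^ ℓ * (ℓ.factorial : ℝ))⁻¹) *
    Polynomial.derivative^[ℓ] ((Polynomial.X ^ 2 - 1) ^ ℓ)

/-- The spherical harmonic of degree `ℓ` and order `m ≥ 0`,
`h_{ℓ,m} = √((2ℓ+1)/(4π) · (ℓ-m)!/(ℓ+m)!) e^{imφ} (1 - w²)^{m/2} (d/dw)^m P_ℓ(w)`, `w = cos θ`,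
as a function on `ℝ³ ∖ {0}` homogeneous of degree zero: here `e^{imφ} (1 - w²)^{m/2} =
(e^{iφ} sin θ)^m = ((x₁ + i x₂)/r)^m` and `w = x₃/r`. -/
def harmonicNat (ℓ m : ℕ) (x : Space) : ℂ :=
  (√((2 * ℓ + 1) / (4 * Real.pi) * ((ℓ - m).factorial / (ℓ + m).factorial)) : ℝ) *
    (((x 0 : ℂ) + I * (x 1 : ℂ)) / (‖x‖ : ℂ)) ^ m *
    (((Polynomial.derivative^[m] (legendre ℓ)).eval (x 2 / ‖x‖) : ℝ) : ℂ)

/-- The spherical harmonics for all orders, with `h_{ℓ,-m} = conj h_{ℓ,m}`. -/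
def harmonic (ℓ : ℕ) (m : ℤ) (x : Space) : ℂ :=
  if 0 ≤ m then harmonicNat ℓ m.natAbs x else star (harmonicNat ℓ m.natAbs x)

/-- The two-component function `h_{ℓ,m} e_k` (with `e 0 = e₁`, `e 1 = e₂`). -/
def harmonicVec (ℓ : ℕ) (m : ℤ) (k : Fin 2) (x : Space) : Fin 2 → ℂ := harmonic ℓ m x • e k

/-! ### The subspaces -/

/-- The spinor field
`((A + B σ_r Σ) h_{ℓ,m} e₁, i σ_r (P + Q σ_r Σ) h_{ℓ,m} e₁)` with coefficients
`Ψ = (A, P, B, Q)` depending on `r = |x|`. -/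
def fieldX (ℓ : ℕ) (m : ℤ) (Ψ : ℝ → Fin 4 → ℂ) (x : Space) : Spinor :=
  let h := harmonicVec ℓ m 0 x
  let sh := (sigmaR x).mulVec (Sig (harmonicVec ℓ m 0) x)
  block (Ψ ‖x‖ 0 • h + Ψ ‖x‖ 2 • sh)
    (I • (sigmaR x).mulVec (Ψ ‖x‖ 1 • h + Ψ ‖x‖ 3 • sh))

/-- The spinor field `(R h_{ℓ,-ℓ} e₂, i σ_r S h_{ℓ,-ℓ} e₂)`, `(R, S) = Θ`. -/
def fieldY (ℓ : ℕ) (Θ : ℝ → Fin 2 → ℂ) (x : Space) : Spinor :=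
  block (Θ ‖x‖ 0 • harmonicVec ℓ (-ℓ) 1 x)
    (I • (sigmaR x).mulVec (Θ ‖x‖ 1 • harmonicVec ℓ (-ℓ) 1 x))

lemma block_add (a b a' b' : Fin 2 → ℂ) :
    block a b + block a' b' = block (a + a') (b + b') := by
  ext (i | i) <;> simp [block]

lemma smul_block (c : ℂ) (a b : Fin 2 → ℂ) : c • block a b = block (c • a) (c • b) := by
  ext (i | i) <;> simp [block]

lemma fieldX_add (ℓ : ℕ) (m : ℤ) (Ψ Φ : ℝ → Fin 4 → ℂ) (x : Space) :
    fieldX ℓ m (Ψ + Φ) x = fieldX ℓ m Ψ x + fieldX ℓ m Φ x := by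
  simp only [fieldX, block_add, Pi.add_apply, ← smul_add, ← Matrix.mulVec_add]
  congr 1
  · module
  · congr 2
    module

lemma fieldX_smul (ℓ : ℕ) (m : ℤ) (c : ℂ) (Ψ : ℝ → Fin 4 → ℂ) (x : Space) :
    fieldX ℓ m (c • Ψ) x = c • fieldX ℓ m Ψ x := by
  simp only [fieldX, smul_block, Pi.smul_apply, smul_eq_mul,
    ← Matrix.mulVec_smul, smul_add, smul_smul, mul_left_comm c I]

lemma fieldY_add (ℓ : ℕ) (Ψ Φ : ℝ → Fin 2 → ℂ) (x : Space) :
    fieldY ℓ (Ψ + Φ) x = fieldY ℓ Ψ x + fieldY ℓ Φ x := by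
  simp only [fieldY, block_add, Pi.add_apply, ← smul_add, ← Matrix.mulVec_add, add_smul]

lemma fieldY_smul (ℓ : ℕ) (c : ℂ) (Ψ : ℝ → Fin 2 → ℂ) (x : Space) :
    fieldY ℓ (c • Ψ) x = c • fieldY ℓ Ψ x := by
  simp only [fieldY, smul_block, Pi.smul_apply, smul_eq_mul,
    ← Matrix.mulVec_smul, smul_smul, mul_left_comm c I]

lemma fieldX_zero (ℓ : ℕ) (m : ℤ) (x : Space) : fieldX ℓ m 0 x = 0 := by
  simpa using fieldX_smul ℓ m 0 0 x

lemma fieldY_zero (ℓ : ℕ) (x : Space) : fieldY ℓ 0 x = 0 := by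
  simpa using fieldY_smul ℓ 0 0 x

/-- `𝒳_{ℓ,0}`: the elements of `L²(ℝ³, ℂ⁴)` of the form `fieldX ℓ 0 Ψ` with measurable
coefficients. -/
def X0 (ℓ : ℕ) : Submodule ℂ L2 where
  carrier := {ρ | ∃ Ψ : ℝ → Fin 4 → ℂ, Measurable Ψ ∧ ρ =ᵐ[volume] fieldX ℓ 0 Ψ}
  zero_mem' := ⟨0, measurable_const, by
    filter_upwards [Lp.coeFn_zero Spinor 2 (volume : Measure Space)] with x hx
    rw [hx, fieldX_zero, Pi.zero_apply]⟩
  add_mem' := by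
    rintro f g ⟨Ψ, hΨ, hf⟩ ⟨Φ, hΦ, hg⟩
    refine ⟨Ψ + Φ, hΨ.add hΦ, ?_⟩
    filter_upwards [Lp.coeFn_add f g, hf, hg] with x hx h1 h2
    rw [hx, Pi.add_apply, h1, h2, fieldX_add]
  smul_mem' := by
    rintro c f ⟨Ψ, hΨ, hf⟩
    refine ⟨c • Ψ, hΨ.const_smul c, ?_⟩
    filter_upwards [Lp.coeFn_smul c f, hf] with x hx h1
    rw [hx, Pi.smul_apply, h1, fieldX_smul]

/-- `𝒳_{ℓ,m}` (`1 ≤ m ≤ ℓ`): the elements of `L²(ℝ³, ℂ⁴)` of the form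
`fieldX ℓ m Ψ₊ + fieldX ℓ (-m) Ψ₋` with measurable coefficients. -/
def X (ℓ m : ℕ) : Submodule ℂ L2 where
  carrier := {ρ | ∃ Ψp Ψm : ℝ → Fin 4 → ℂ, Measurable Ψp ∧ Measurable Ψm ∧
    ρ =ᵐ[volume] fun x => fieldX ℓ m Ψp x + fieldX ℓ (-m) Ψm x}
  zero_mem' := ⟨0, 0, measurable_const, measurable_const, by
    filter_upwards [Lp.coeFn_zero Spinor 2 (volume : Measure Space)] with x hx
    rw [hx, fieldX_zero, fieldX_zero, Pi.zero_apply, add_zero]⟩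
  add_mem' := by
    rintro f g ⟨Ψp, Ψm, hp, hm, hf⟩ ⟨Φp, Φm, hp', hm', hg⟩
    refine ⟨Ψp + Φp, Ψm + Φm, hp.add hp', hm.add hm', ?_⟩
    filter_upwards [Lp.coeFn_add f g, hf, hg] with x hx h1 h2
    rw [hx, Pi.add_apply, h1, h2, fieldX_add, fieldX_add]
    abel
  smul_mem' := by
    rintro c f ⟨Ψp, Ψm, hp, hm, hf⟩
    refine ⟨c • Ψp, c • Ψm, hp.const_smul c, hm.const_smul c, ?_⟩
    filter_upwards [Lp.coeFn_smul c f, hf] with x hx h1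
    rw [hx, Pi.smul_apply, h1, fieldX_smul, fieldX_smul, smul_add]

/-- `𝒴_ℓ`: the elements of `L²(ℝ³, ℂ⁴)` of the form `fieldY ℓ Θ` with measurable
coefficients. -/
def Y (ℓ : ℕ) : Submodule ℂ L2 where
  carrier := {ρ | ∃ Θ : ℝ → Fin 2 → ℂ, Measurable Θ ∧ ρ =ᵐ[volume] fieldY ℓ Θ}
  zero_mem' := ⟨0, measurable_const, by
    filter_upwards [Lp.coeFn_zero Spinor 2 (volume : Measure Space)] with x hx
    rw [hx, fieldY_zero, Pi.zero_apply]⟩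
  add_mem' := by
    rintro f g ⟨Ψ, hΨ, hf⟩ ⟨Φ, hΦ, hg⟩
    refine ⟨Ψ + Φ, hΨ.add hΦ, ?_⟩
    filter_upwards [Lp.coeFn_add f g, hf, hg] with x hx h1 h2
    rw [hx, Pi.add_apply, h1, h2, fieldY_add]
  smul_mem' := by
    rintro c f ⟨Ψ, hΨ, hf⟩
    refine ⟨c • Ψ, hΨ.const_smul c, ?_⟩
    filter_upwards [Lp.coeFn_smul c f, hf] with x hx h1
    rw [hx, Pi.smul_apply, h1, fieldY_smul]

/-! ### Invariance, restriction, spectrum -/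

section Abstract

variable {H : Type*} [NormedAddCommGroup H] [NormedSpace ℂ H]

/-- The subspace `M` is invariant under the partially defined operator `A`. -/
def IsInvariant (A : H →ₗ.[ℝ] H) (M : Submodule ℂ H) : Prop :=
  ∀ ρ : A.domain, (ρ : H) ∈ M → A ρ ∈ M

/-- `T` is the restriction of `A` to the subspace `M`, with domain `D(A) ∩ M`. -/
def IsRestriction (A : H →ₗ.[ℝ] H) (M : Submodule ℂ H) (T : M →ₗ.[ℂ] M) : Prop :=
  (∀ y : M, y ∈ T.domain ↔ (y : H) ∈ A.domain) ∧
    ∀ (y : T.domain) (ρ : A.domain), (ρ : H) = ((y : M) : H) → ((T y : M) : H) = A ρ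

/-- The spectrum of a partially defined operator: all `z ∈ ℂ` for which `T - z` is not a bijection
of the domain onto the whole space with bounded inverse. -/
def spec (T : H →ₗ.[ℂ] H) : Set ℂ :=
  {z | ¬ ∃ R : H →L[ℂ] H,
    (∀ y : H, ∃ hy : R y ∈ T.domain, T ⟨R y, hy⟩ - z • R y = y) ∧
    ∀ x : T.domain, R (T x - z • (x : H)) = x}

end Abstract

/-! ### The radial operators -/

namespace SolitaryWave

variable {S : Model} {ω : ℝ} (w : SolitaryWave S ω)

/-- The radial operator `L₀(ω)` acting on `Ψ = (A, P, B, Q)`, with `ϰ = ℓ(ℓ+1)`. -/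
def radialL0 (ℓ : ℕ) (Ψ : ℝ → Fin 4 → ℂ) (r : ℝ) : Fin 4 → ℂ :=
  let g : ℂ := (S.g (w.tau r) : ℝ)
  let ϰ : ℂ := ℓ * (ℓ + 1)
  let d : Fin 4 → ℂ := fun k => deriv (fun s => Ψ s k) r
  ![(g - ω) * Ψ r 0 + (d 1 + 2 / r * Ψ r 1) - ϰ / r ^ 2 * Ψ r 3,
    -d 0 + (-g - ω) * Ψ r 1 - ϰ / r ^ 2 * Ψ r 2,
    -Ψ r 1 + (g - ω) * Ψ r 2 + d 3,
    -Ψ r 0 - d 2 + (-g - ω) * Ψ r 3]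

/-- The matrix `W = g' [[v², -uv], [-uv, u²]]`. -/
def radialW (r : ℝ) : Matrix (Fin 2) (Fin 2) ℂ :=
  ((deriv S.g (w.tau r) : ℝ) : ℂ) •
    !![(w.v r : ℂ) ^ 2, -(w.u r * w.v r : ℂ); -(w.u r * w.v r : ℂ), (w.u r : ℂ) ^ 2]

/-- The `4 × 4` block action `[[W, (c/r) W], [0, 0]]` on `Ψ = (A, P, B, Q)`. -/
def radialWBlock (c : ℝ) (Ψ : ℝ → Fin 4 → ℂ) (r : ℝ) : Fin 4 → ℂ :=
  let y := (w.radialW r).mulVec ![Ψ r 0, Ψ r 1] +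
    ((c / r : ℝ) : ℂ) • (w.radialW r).mulVec ![Ψ r 2, Ψ r 3]
  ![y 0, y 1, 0, 0]

/-- The radial operator `𝐀_{ℓ,m}` acting on pairs `(Ψ, Φ)` of functions of `r` with values
in `ℂ⁴`. -/
def radialA (ℓ m : ℕ) (p : (ℝ → Fin 4 → ℂ) × (ℝ → Fin 4 → ℂ)) :
    (ℝ → Fin 4 → ℂ) × (ℝ → Fin 4 → ℂ) :=
  (fun r => (-I) • (w.radialL0 ℓ p.1 r + w.radialWBlock (-m) p.1 r + w.radialWBlock m p.2 r),
   fun r => (-I) • (-w.radialL0 ℓ p.2 r - w.radialWBlock (-m) p.1 r - w.radialWBlock m p.2 r))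

end SolitaryWave

/-- The componentwise complex conjugate of a vector of functions. -/
def conjVec (Ψ : ℝ → Fin 4 → ℂ) : ℝ → Fin 4 → ℂ := fun r k => star (Ψ r k)

end Soler

end

/-! The analysis rests on one notion, `IsAngular`: a finite family of fields b_k, homogeneous of
degree zero, whose span is stable under α_r = -iα·x/|x| and, up to a factor 1/|x|, under the Dirac
operator. By the Leibniz rule D₀ sends ∑ c_k(|x|) b_k with differentiable c_k to a field of the same
form, and the coefficients undergo a first-order ordinary differential operator
(`diracOp_radialField`). For 𝒳 the family is, up to signs, F = (h e₁, 0), α_r F, |x| α_r D₀F and |x|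
D₀F. It closes because α_r² = -1, D₀² = -Δ, h is an eigenfunction of the angular Laplacian, and α_r
anticommutes with D₀ up to a radial derivative (`diracOp_alphaR`). For 𝒴 the lowest harmonic
satisfies Σ(h e₂) = -(ℓ/r) σ_r h e₂, so two fields suffice.

An element of H¹ lying in such a space has coefficients that are only known to be measurable, so the
Leibniz rule does not apply to it and invariance is proved by duality. The space is closed: after
orthonormalizing the family on the unit sphere it is the isometric image of an L² space of
coefficients. Its orthogonal projection P is a spherical average, which maps test functions
supported away from the origin to functions of the same kind. On them P commutes with D₀, by
symmetry of D₀ and stability of the family. Transposing gives PH¹ ⊆ H¹ and D₀P = PD₀ on H¹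
(`starProjection_mem_H1`), hence invariance (`D0_mem`). The transposition needs two regularity
facts: a weak solution of D₀f = g in L² lies in H¹ (`mem_H1_of_schwartz_weak_dirac`), and it is
enough to test away from the origin, because |x|⁻² is locally integrable in dimension three
(`WeakDirac.mem_H1`).

The multiplication gβ acts on the coefficients separately. The term 2g'βφ Re(φ*βρ) sees only first
components, σ_r being unitary. It therefore vanishes on 𝒴. On 𝒳 the first component of σ_rΣ(h e₁) is
-(k/r)h, and 2 Re z = z + conj z together with conj h_{ℓ,k} = h_{ℓ,-k} couples k with -k; this is
`rePotential_fieldX`, the source of the matrix W in the radial operator.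

The regularity facts also show that the symmetric operator ℒ₀ contains its adjoint, so it is
self-adjoint. Since P commutes with ℒ₀, the resolvent equation on 𝒴 off the real axis is solved by
projecting a solution in L²; multiplication by -i turns the real axis into the imaginary one
(`spec_restrictPMap`). -/

noncomputable section

namespace Soler

/-! ### Weak derivatives on H¹ and symmetry of the free Dirac operator -/

section

open TemperedDistribution FourierTransform

/-- The `j`-th standard basis vector of `ℝ³`. -/
abbrev basisVec (j : Fin 3) : Space := EuclideanSpace.single j (1 : ℝ)

lemma coe_compLpL_toDistribution_apply (T : Spinor →L[ℂ] Spinor) (f : L2) (φ : 𝓢(Space, ℂ)) :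
    ((T.compLpL 2 volume f : L2) : 𝓢'(Space, Spinor)) φ = T ((f : 𝓢'(Space, Spinor)) φ) := by
  have hint : Integrable (fun x => φ x • f x) := by
    have h1 : MemLp (φ : Space → ℂ) 2 volume := φ.memLp 2 volume
    exact memLp_one_iff_integrable.mp (MemLp.smul (p := 2) (q := 2) (r := 1) (Lp.memLp f) h1)
  rw [Lp.toTemperedDistribution_apply, Lp.toTemperedDistribution_apply,
    ← ContinuousLinearMap.integral_comp_comm _ hint]
  refine integral_congr_ae ?_
  filter_upwards [T.coeFn_compLpL f] with x hx
  rw [hx, map_smul]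

lemma partialD_spec (j : Fin 3) (f : H1) :
    ∂_{basisVec j} ((f : L2) : 𝓢'(Space, Spinor)) = (partialD j f : 𝓢'(Space, Spinor)) :=
  (exists_partial j f).choose_spec

/-- A constant matrix commutes with the Bessel potential, so if f' represents the potential of f,
then T f' represents that of T f. -/
lemma compLpL_mem_H1 (T : Spinor →L[ℂ] Spinor) (f : H1) : T.compLpL 2 volume (f : L2) ∈ H1 := by
  obtain ⟨f', hf'⟩ := f.2
  refine ⟨T.compLpL 2 volume f', ?_⟩
  ext1 φ
  rw [coe_compLpL_toDistribution_apply, ← hf', besselPotential, fourierMultiplierCLM_apply_apply,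
    fourierMultiplierCLM_apply_apply, coe_compLpL_toDistribution_apply]

lemma partialD_compLpL (T : Spinor →L[ℂ] Spinor) (j : Fin 3) (f : H1) :
    partialD j ⟨_, compLpL_mem_H1 T f⟩ = T.compLpL 2 volume (partialD j f) := by
  apply toDistribution_injective
  simp only [Lp.toTemperedDistributionCLM_apply]
  rw [← partialD_spec]
  ext1 φ
  rw [coe_compLpL_toDistribution_apply, ← partialD_spec, lineDerivOp_apply_apply,
    lineDerivOp_apply_apply, coe_compLpL_toDistribution_apply]

/-- Both sides are locally integrable and have the same integrals against real test functions. This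
turns the Fourier symbol of a derivative, known for distributions, into a pointwise factor. -/
lemma ae_eq_of_smulLeftCLM {m : Space → ℂ} (hm : m.HasTemperateGrowth) {f g : L2}
    (h : smulLeftCLM Spinor m (f : 𝓢'(Space, Spinor)) = (g : 𝓢'(Space, Spinor))) :
    (fun x => m x • f x) =ᵐ[volume] g := by
  have hf : LocallyIntegrable f volume := (Lp.memLp f).locallyIntegrable (by norm_num)
  refine ae_eq_of_integral_contDiff_smul_eq ?_
    ((Lp.memLp g).locallyIntegrable (by norm_num)) ?_
  · rw [← locallyIntegrableOn_univ]
    exact hf.locallyIntegrableOn _ |>.continuousOn_smul isOpen_univ.isLocallyClosed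
      hm.1.continuous.continuousOn
  · intro φ hφ hc
    have hg₁ : HasCompactSupport (Complex.ofRealCLM ∘ φ) := hc.comp_left rfl
    have hg₂ : ContDiff ℝ (⊤ : ℕ∞) (Complex.ofRealCLM ∘ φ) := Complex.ofRealCLM.contDiff.comp hφ
    have := congrArg (fun T : 𝓢'(Space, Spinor) => T (hg₁.toSchwartzMap hg₂)) h
    simp only [smulLeftCLM_apply_apply, Lp.toTemperedDistribution_apply] at this
    simp only [SchwartzMap.smulLeftCLM_apply_apply hm] at this
    refine (integral_congr_ae (.of_forall fun x => ?_)).trans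
      (this.trans (integral_congr_ae (.of_forall fun x => ?_)))
    · rw [← smul_assoc, smul_eq_mul, mul_comm]
      ext i
      simp [mul_assoc]
    · ext i
      simp

lemma fourier_partialD (j : Fin 3) (f : H1) :
    (𝓕 (partialD j f) : L2) =ᵐ[volume]
      fun x => (2 * Real.pi * I * (x j : ℂ)) • (𝓕 (f : L2) : L2) x := by
  have h := congrArg 𝓕 (partialD_spec j f)
  rw [fourier_lineDerivOp_eq, Lp.fourier_toTemperedDistribution_eq,
    Lp.fourier_toTemperedDistribution_eq] at h
  have hm : (fun x : Space => (2 * Real.pi * I) * ((inner ℝ x (basisVec j) : ℝ) : ℂ)).HasTemperateGrowth := by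
    fun_prop
  have h2 := ae_eq_of_smulLeftCLM hm (f := 𝓕 (f : L2)) (g := 𝓕 (partialD j f)) ?_
  · filter_upwards [h2] with x hx
    rw [← hx]
    simp [EuclideanSpace.inner_single_right]
  · rw [← h]
    exact congrFun (congrArg DFunLike.coe (smulLeftCLM_smul (F := Spinor) (g := fun x : Space => ((inner ℝ x (basisVec j) : ℝ) : ℂ)) (by fun_prop) (2 * Real.pi * I))) _

/-- By Plancherel: the symbol 2πi x_j is purely imaginary. -/
lemma inner_partialD (j : Fin 3) (f g : H1) :
    inner ℂ (partialD j f) (g : L2) = -inner ℂ (f : L2) (partialD j g) := by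
  rw [← Lp.inner_fourier_eq, ← Lp.inner_fourier_eq (f : L2), L2.inner_def, L2.inner_def,
    ← integral_neg]
  refine integral_congr_ae ?_
  filter_upwards [fourier_partialD j f, fourier_partialD j g] with x hf hg
  rw [hf, hg, inner_smul_left, inner_smul_right]
  have h2 : (starRingEnd ℂ) 2 = 2 := Complex.conj_ofNat 2
  simp [h2]

lemma alpha_isSelfAdjoint (j : Fin 3) (x y : Spinor) :
    inner ℂ (alpha j x) y = inner ℂ x (alpha j y) := by
  have h : (Matrix.fromBlocks 0 (pauli j) (pauli j) 0).IsHermitian := by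
    rw [Matrix.IsHermitian, Matrix.fromBlocks_conjTranspose]
    have : (pauli j).conjTranspose = pauli j := by
      fin_cases j <;> ext a b <;> fin_cases a <;> fin_cases b <;> simp [pauli]
    simp [this]
  rw [alpha, ← ContinuousLinearMap.adjoint_inner_right, ← ContinuousLinearMap.star_eq_adjoint, ← map_star,
    Matrix.star_eq_conjTranspose, h.eq]

lemma inner_compLpL_alpha (j : Fin 3) (f g : L2) :
    inner ℂ ((alpha j).compLpL 2 volume f : L2) g =
      inner ℂ f ((alpha j).compLpL 2 volume g : L2) := by
  rw [L2.inner_def, L2.inner_def]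
  refine integral_congr_ae ?_
  filter_upwards [(alpha j).coeFn_compLpL f, (alpha j).coeFn_compLpL g] with x hf hg
  rw [hf, hg, alpha_isSelfAdjoint]

lemma D0_apply (f : H1) :
    D0 f = (-I) • ∑ j, (alpha j).compLpL 2 (volume : Measure Space) (partialD j f) := by
  simp [D0]

/-- Each α_j is Hermitian and commutes with the skew-symmetric ∂_j, so α_j ∂_j is skew-symmetric;
the factor -i makes it symmetric. -/
theorem D0_symmetric (f g : H1) : inner ℂ (D0 f) (g : L2) = inner ℂ (f : L2) (D0 g) := by
  rw [D0_apply, D0_apply, inner_smul_left, inner_smul_right, sum_inner, inner_sum]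
  have : ∀ j, inner ℂ ((alpha j).compLpL 2 (volume : Measure Space) (partialD j f)) (g : L2) =
      -inner ℂ (f : L2) ((alpha j).compLpL 2 (volume : Measure Space) (partialD j g)) := by
    intro j
    rw [inner_compLpL_alpha, ← partialD_compLpL]
    exact inner_partialD j f ⟨_, compLpL_mem_H1 _ g⟩
  simp [this]

end

/-! ### Clifford relations and elliptic regularity of the Dirac operator -/

section

open TemperedDistribution FourierTransform Laplacian

lemma pauli_mul_add_mul (j k : Fin 3) :
    pauli j * pauli k + pauli k * pauli j = if j = k then 2 else 0 := by
  fin_cases j <;> fin_cases k <;> ext a b <;> fin_cases a <;> fin_cases b <;>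
    simp [pauli, Matrix.ofNat_apply] <;> norm_num

lemma alpha_comp_alpha (j k : Fin 3) (x : Spinor) :
    alpha j (alpha k x) + alpha k (alpha j x) = if j = k then (2 : ℂ) • x else 0 := by
  simp only [alpha]
  rw [← mul_apply_eq_comp, ← mul_apply_eq_comp, ← map_mul, ← map_mul,
    ← add_apply, ← map_add, Matrix.fromBlocks_multiply,
    Matrix.fromBlocks_multiply, Matrix.fromBlocks_add]
  simp only [zero_mul, mul_zero, zero_add, add_zero, pauli_mul_add_mul]
  split_ifs
  · have : Matrix.fromBlocks (2 : Matrix (Fin 2) (Fin 2) ℂ) 0 0 (2 : Matrix (Fin 2) (Fin 2) ℂ) =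
        (2 : ℂ) • 1 := by
      rw [← Matrix.fromBlocks_one, Matrix.fromBlocks_smul]
      congr 1 <;> ext a b <;> fin_cases a <;> fin_cases b <;> simp [Matrix.ofNat_apply]
    rw [this, map_smul, map_one]
    simp
  · simp [Matrix.fromBlocks_zero]

/-- Twice the double sum, symmetrized in the indices, is a sum of anticommutators α_jα_k + α_kα_j =
2δ_{jk}. This one identity yields D₀² = -Δ, taking second derivatives for S, and α_r² = -1, taking
products of coordinates. -/
lemma sum_alpha_alpha (S : Fin 3 → Fin 3 → Spinor) (hS : ∀ j k, S j k = S k j) :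
    ∑ k, alpha k (∑ j, alpha j (S j k)) = ∑ j, S j j := by
  have h : (2 : ℂ) • ∑ k, alpha k (∑ j, alpha j (S j k)) = (2 : ℂ) • ∑ j, S j j := by
    calc (2 : ℂ) • ∑ k, alpha k (∑ j, alpha j (S j k))
        = ∑ k, ∑ j, alpha k (alpha j (S j k)) + ∑ k, ∑ j, alpha k (alpha j (S j k)) := by
          simp [two_smul, map_sum]
      _ = ∑ k, ∑ j, alpha k (alpha j (S j k)) + ∑ k, ∑ j, alpha j (alpha k (S j k)) := by
          congr 1
          rw [Finset.sum_comm]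
          exact Finset.sum_congr rfl fun k _ => Finset.sum_congr rfl fun j _ => by rw [hS]
      _ = ∑ k, ∑ j, if k = j then (2 : ℂ) • S j k else 0 := by
          simp only [← Finset.sum_add_distrib, alpha_comp_alpha]
      _ = _ := by simp [Finset.smul_sum]
  exact smul_right_injective _ two_ne_zero h

/-- At order two the weight is the polynomial 1 + |ξ|². In the Fourier normalization with 2π in the
exponent, Δ has symbol -(2π|ξ|)², whence the constant. -/
lemma besselPotential_two_eq (f : 𝓢'(Space, Spinor)) :
    besselPotential Space Spinor 2 f = f - (((2 * Real.pi) ^ 2)⁻¹ : ℝ) • Δ f := by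
  have h1 : (fun x : Space => (((1 + ‖x‖ ^ 2) ^ ((2 : ℝ) / 2) : ℝ) : ℂ)) =
      (fun _ => (1 : ℂ)) + fun x => ((‖x‖ ^ 2 : ℝ) : ℂ) := by
    ext x
    simp
  have h2 : ((2 * Real.pi) ^ 2 : ℝ) ≠ 0 := by positivity
  have h3 : (fun x : Space => ((‖x‖ ^ 2 : ℝ) : ℂ)).HasTemperateGrowth := by fun_prop
  rw [laplacian_eq_fourierMultiplierCLM, besselPotential, h1]
  rw [fourierMultiplierCLM_apply, smulLeftCLM_add (by fun_prop) h3]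
  rw [neg_smul, smul_neg, smul_smul, inv_mul_cancel₀ h2, one_smul, sub_neg_eq_add,
    fourierMultiplierCLM_apply]
  simp

lemma fderiv_fderiv_comm {E F : Type*} [NormedAddCommGroup E] [NormedSpace ℝ E]
    [NormedAddCommGroup F] [NormedSpace ℝ F] {φ : E → F} {x : E}
    (hφ : ContDiffAt ℝ 2 φ x) (v w : E) :
    fderiv ℝ (fun y => fderiv ℝ φ y w) x v = fderiv ℝ (fun y => fderiv ℝ φ y v) x w := by
  have hd : DifferentiableAt ℝ (fderiv ℝ φ) x :=
    (hφ.fderiv_right (m := 1) (by norm_num)).differentiableAt one_ne_zero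
  rw [fderiv_clm_apply hd (by fun_prop), fderiv_clm_apply hd (by fun_prop)]
  simpa using hφ.isSymmSndFDerivAt (by simp) v w

lemma lineDerivOp_comm_schwartz (φ : 𝓢(Space, ℂ)) (v w : Space) :
    ∂_{v} (∂_{w} φ) = ∂_{w} (∂_{v} φ) := by
  ext x
  have h : ∀ m : Space, ⇑(∂_{m} φ : 𝓢(Space, ℂ)) = fun y => fderiv ℝ φ y m := fun m =>
    funext fun y => SchwartzMap.lineDerivOp_apply_eq_fderiv m φ y
  rw [SchwartzMap.lineDerivOp_apply_eq_fderiv, SchwartzMap.lineDerivOp_apply_eq_fderiv, h, h]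
  exact fderiv_fderiv_comm (φ.smooth 2).contDiffAt v w

/-- An `L²` field whose weak Dirac image is in `L²` belongs to `H¹`. -/
theorem mem_H1_of_schwartz_weak_dirac (f g : L2)
    (h : ∀ φ : 𝓢(Space, ℂ), (g : 𝓢'(Space, Spinor)) φ =
      I • ∑ j, alpha j ((f : 𝓢'(Space, Spinor)) (∂_{basisVec j} φ))) :
    ∃ hf : f ∈ H1, D0 ⟨f, hf⟩ = g := by
  -- Applying the Dirac operator once more to D₀f = g gives -Δf = D₀g in the sense of distributions.
  have hlap : Δ (f : 𝓢'(Space, Spinor)) = I • ∑ k, ∂_{basisVec k}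
      (((alpha k).compLpL 2 (volume : Measure Space) g : L2) : 𝓢'(Space, Spinor)) := by
    ext1 φ
    have h1 : ∀ k, (∂_{basisVec k} (((alpha k).compLpL 2 (volume : Measure Space) g : L2) :
        𝓢'(Space, Spinor))) φ = -(I • alpha k (∑ j, alpha j
          ((f : 𝓢'(Space, Spinor)) (∂_{basisVec j} (∂_{basisVec k} φ))))) := by
      intro k
      rw [lineDerivOp_apply_apply, map_neg, coe_compLpL_toDistribution_apply, h, map_smul]
    have h2 : (I • ∑ k, ∂_{basisVec k}
      (((alpha k).compLpL 2 (volume : Measure Space) g : L2) : 𝓢'(Space, Spinor))) φ =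
      I • ∑ k, (∂_{basisVec k} (((alpha k).compLpL 2 (volume : Measure Space) g : L2) :
        𝓢'(Space, Spinor))) φ := by
      simp
    rw [h2]
    simp only [h1]
    rw [laplacian_apply_apply, SchwartzMap.laplacian_eq_sum (EuclideanSpace.basisFun (Fin 3) ℝ),
      map_sum, Finset.sum_neg_distrib, ← Finset.smul_sum,
      sum_alpha_alpha (fun j k => (f : 𝓢'(Space, Spinor)) (∂_{basisVec j} (∂_{basisVec k} φ)))]
    · simp [smul_smul]
    · intro j k
      rw [lineDerivOp_comm_schwartz]
  have hL : ∀ u : L2, MemSobolev 0 2 (u : 𝓢'(Space, Spinor)) := fun u =>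
    memSobolev_zero_iff.mpr ⟨u, rfl⟩
  -- First derivatives of the L² functions α_k g lie in H⁻¹.
  have hneg : MemSobolev (-1) 2 (Δ (f : 𝓢'(Space, Spinor))) := by
    rw [hlap, Fin.sum_univ_three]
    have hk := fun k : Fin 3 => (hL ((alpha k).compLpL 2 (volume : Measure Space) g)).lineDerivOp
      (m := basisVec k)
    simp only [zero_sub] at hk
    exact (((hk 0).add (hk 1)).add (hk 2)).smul I
  -- The Bessel potential of order 2 of f, a combination of f and Δf, is in H⁻¹; hence f has
  -- regularity -1 + 2 = 1.
  have hf : f ∈ H1 := by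
    have h1 : MemSobolev (-1) 2 (besselPotential Space Spinor 2 (f : 𝓢'(Space, Spinor))) := by
      rw [besselPotential_two_eq]
      have := hneg.smul (((((2 * Real.pi) ^ 2)⁻¹ : ℝ)) : ℂ)
      exact ((hL f).mono (by norm_num)).sub this
    rw [memSobolev_besselPotential_iff] at h1
    norm_num at h1
    exact h1
  refine ⟨hf, ?_⟩
  apply toDistribution_injective
  simp only [Lp.toTemperedDistributionCLM_apply]
  ext1 φ
  rw [h, D0_apply, ← Lp.toTemperedDistributionCLM_apply, map_smul, map_sum]
  simp only [Lp.toTemperedDistributionCLM_apply]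
  have h2 : ((-I) • ∑ j, (((alpha j).compLpL 2 (volume : Measure Space) (partialD j ⟨f, hf⟩) : L2) :
      𝓢'(Space, Spinor))) φ = (-I) • ∑ j, (((alpha j).compLpL 2 (volume : Measure Space)
        (partialD j ⟨f, hf⟩) : L2) : 𝓢'(Space, Spinor)) φ := by
    simp
  rw [h2]
  simp only [coe_compLpL_toDistribution_apply, ← partialD_spec, lineDerivOp_apply_apply, map_neg,
    Finset.sum_neg_distrib, smul_neg, neg_smul, neg_neg]

end

/-! ### Removability of the origin for weak solutions -/

section

lemma integrable_schwartz_smul (φ : 𝓢(Space, ℂ)) (f : L2) : Integrable (fun x => φ x • f x) :=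
  memLp_one_iff_integrable.mp
    (MemLp.smul (p := 2) (q := 2) (r := 1) (Lp.memLp f) (φ.memLp 2 volume))

/-- In dimension three the Jacobian r² of polar coordinates cancels the singularity exactly. -/
lemma integrableOn_inv_norm_sq (R : ℝ) :
    IntegrableOn (fun x : Space => (‖x‖ ^ 2)⁻¹) (Metric.ball (0 : Space) R) := by
  refine (integrableOn_fun_norm_addHaar (volume : Measure Space)
    (f := fun r => (r ^ 2)⁻¹)).mpr ?_
  have : IntegrableOn (fun _ => (1 : ℝ)) (Ioo 0 R) := by simp
  refine this.congr_fun (fun r hr => ?_) measurableSet_Ioo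
  have hr : (r : ℝ) ≠ 0 := ne_of_gt hr.1
  simp [hr]

/-- Inside the unit ball φ is bounded and |x|⁻² is integrable; outside it |x|⁻² is at most 1. The
function enters the majorant for the terms in which the cutoff is differentiated. -/
lemma integrable_schwartz_div_norm_sq (φ : 𝓢(Space, ℂ)) :
    Integrable (fun x : Space => ‖φ x‖ ^ 2 * (‖x‖ ^ 2)⁻¹) := by
  have hφ : Integrable (fun x => ‖φ x‖ ^ 2) := (memLp_two_iff_integrable_sq_norm
    (φ.memLp 2 volume).1).mp (φ.memLp 2 volume)
  obtain ⟨C, hC⟩ : ∃ C, ∀ x, ‖φ x‖ ≤ C := ⟨_, φ.norm_le_seminorm ℝ⟩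
  have h1 := ((integrableOn_inv_norm_sq 1).integrable_indicator measurableSet_ball).const_mul (C ^ 2)
  refine (hφ.add h1).mono' ?_ (.of_forall fun x => ?_)
  · exact (hφ.1.mul (by fun_prop))
  · rw [Real.norm_of_nonneg (by positivity)]
    simp only [Pi.add_apply, indicator, Metric.mem_ball, dist_zero_right]
    have h2 : ‖φ x‖ ^ 2 ≤ C ^ 2 := by gcongr; exact hC x
    split_ifs with h
    · nlinarith [mul_le_mul_of_nonneg_right h2 (by positivity : 0 ≤ (‖x‖ ^ 2)⁻¹), sq_nonneg ‖φ x‖]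
    · rw [mul_zero, add_zero]
      have : (‖x‖ ^ 2)⁻¹ ≤ 1 := inv_le_one_of_one_le₀ (by nlinarith)
      nlinarith [sq_nonneg ‖φ x‖]

/-- A smooth bump equal to `1` on the unit ball. -/
def bump : ContDiffBump (0 : Space) := ⟨1, 2, one_pos, one_lt_two⟩

/-- Smooth cutoffs vanishing near the origin and near infinity. -/
def annularCutoff (n : ℕ) (x : Space) : ℝ :=
  bump ((n : ℝ)⁻¹ • x) - bump ((n : ℝ) • x)

lemma contDiff_bump : ContDiff ℝ (⊤ : ℕ∞) (bump : Space → ℝ) := bump.contDiff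

lemma contDiff_annularCutoff (n : ℕ) : ContDiff ℝ (⊤ : ℕ∞) (annularCutoff n) :=
  (contDiff_bump.comp (contDiff_const_smul _)).sub (contDiff_bump.comp (contDiff_const_smul _))

lemma abs_annularCutoff_le (n : ℕ) (x : Space) : |annularCutoff n x| ≤ 1 := by
  have h1 := bump.nonneg' ((n : ℝ)⁻¹ • x)
  have h2 := bump.nonneg' ((n : ℝ) • x)
  have h3 := bump.le_one (x := (n : ℝ)⁻¹ • x)
  have h4 := bump.le_one (x := (n : ℝ) • x)
  rw [annularCutoff, abs_le]
  constructor <;> linarith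

lemma bump_eq_one {x : Space} (h : ‖x‖ ≤ 1) : bump x = 1 :=
  bump.one_of_mem_closedBall (by simpa [bump] using h)

lemma bump_eq_zero {x : Space} (h : 2 ≤ ‖x‖) : bump x = 0 :=
  bump.zero_of_le_dist (by simpa [bump] using h)

lemma annularCutoff_eq_one {n : ℕ} {x : Space} (h1 : ‖x‖ ≤ n) (h2 : 2 ≤ n * ‖x‖) :
    annularCutoff n x = 1 := by
  rw [annularCutoff, bump_eq_one, bump_eq_zero, sub_zero]
  · rw [norm_smul]; simpa using h2
  · rw [norm_smul, norm_inv, Real.norm_natCast]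
    exact inv_mul_le_one_of_le₀ h1 (Nat.cast_nonneg n)

lemma annularCutoff_eq_zero_near {n : ℕ} (hn : 1 ≤ n) {x : Space} (h : n * ‖x‖ ≤ 1) :
    annularCutoff n x = 0 := by
  have hn' : (1 : ℝ) ≤ n := by exact_mod_cast hn
  have hx := norm_nonneg x
  rw [annularCutoff, bump_eq_one, bump_eq_one, sub_self]
  · rw [norm_smul]; simpa using h
  · rw [norm_smul, norm_inv, Real.norm_natCast]
    exact inv_mul_le_one_of_le₀ (by nlinarith) (Nat.cast_nonneg n)

lemma annularCutoff_eq_zero_far {n : ℕ} (hn : 1 ≤ n) {x : Space} (h : 2 * n ≤ ‖x‖) :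
    annularCutoff n x = 0 := by
  have hn' : (1 : ℝ) ≤ n := by exact_mod_cast hn
  rw [annularCutoff, bump_eq_zero, bump_eq_zero, sub_self]
  · rw [norm_smul, Real.norm_natCast]; nlinarith
  · rw [norm_smul, norm_inv, Real.norm_natCast, inv_mul_eq_div, le_div_iff₀ (by linarith)]
    exact h

lemma hasCompactSupport_annularCutoff {n : ℕ} (hn : 1 ≤ n) :
    HasCompactSupport (annularCutoff n) :=
  HasCompactSupport.intro (isCompact_closedBall 0 (2 * n)) fun x hx =>
    annularCutoff_eq_zero_far hn (by simpa using (not_le.mp (by simpa using hx)).le)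

lemma tsupport_annularCutoff {n : ℕ} (hn : 1 ≤ n) :
    tsupport (annularCutoff n) ⊆ {0}ᶜ := by
  have hn' : (0 : ℝ) < n := by exact_mod_cast hn
  rintro x hx rfl
  refine (notMem_tsupport_iff_eventuallyEq.mpr ?_) hx
  filter_upwards [Metric.ball_mem_nhds (0 : Space) (inv_pos.mpr hn')] with y hy
  refine annularCutoff_eq_zero_near hn ?_
  rw [Metric.mem_ball, dist_zero_right] at hy
  calc (n : ℝ) * ‖y‖ ≤ n * (n : ℝ)⁻¹ := by gcongr
    _ = 1 := mul_inv_cancel₀ hn'.ne'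

lemma fderiv_bump_smul (c : ℝ) (x : Space) :
    fderiv ℝ (fun y : Space => bump (c • y)) x = c • fderiv ℝ bump (c • x) := by
  exact fderiv_comp_smul c

/-- The quantity |∇θ(x)||x| is invariant under dilations, so the dilated bumps all obey the bound of
the fixed one, uniformly in n. -/
lemma exists_fderiv_annularCutoff_le :
    ∃ C : ℝ, ∀ n x, ‖fderiv ℝ (annularCutoff n) x‖ * ‖x‖ ≤ C := by
  have hc : Continuous fun x : Space => ‖fderiv ℝ bump x‖ * ‖x‖ :=
    (contDiff_bump.continuous_fderiv (by simp)).norm.mul continuous_norm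
  have hs : HasCompactSupport fun x : Space => ‖fderiv ℝ bump x‖ * ‖x‖ :=
    ((bump.hasCompactSupport.fderiv ℝ).norm).mul_right
  obtain ⟨C, hC⟩ := hs.exists_bound_of_continuous hc
  have key : ∀ (c : ℝ) (x : Space), ‖fderiv ℝ (fun y : Space => bump (c • y)) x‖ * ‖x‖ ≤ C := by
    intro c x
    have := hC (c • x)
    rw [fderiv_bump_smul, norm_smul]
    rw [Real.norm_of_nonneg (by positivity), norm_smul] at this
    linarith
  refine ⟨C + C, fun n x => ?_⟩
  have hd : ∀ c : ℝ, DifferentiableAt ℝ (fun y : Space => bump (c • y)) x := fun c =>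
    ((contDiff_bump.comp (contDiff_const_smul c)).differentiable (by simp)) x
  have : fderiv ℝ (annularCutoff n) x = fderiv ℝ (fun y : Space => bump ((n : ℝ)⁻¹ • y)) x -
      fderiv ℝ (fun y : Space => bump ((n : ℝ) • y)) x := fderiv_fun_sub (hd _) (hd _)
  rw [this]
  calc _ ≤ (‖fderiv ℝ (fun y : Space => bump ((n : ℝ)⁻¹ • y)) x‖ +
      ‖fderiv ℝ (fun y : Space => bump ((n : ℝ) • y)) x‖) * ‖x‖ := by
        gcongr
        exact norm_sub_le _ _
    _ ≤ _ := by rw [add_mul]; exact add_le_add (key _ _) (key _ _)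

/-- Equality is obtained on a neighbourhood, so that the derivative of the cutoff at x also vanishes
for large n. -/
lemma eventually_annularCutoff_eq_one {x : Space} (hx : x ≠ 0) :
    ∀ᶠ n : ℕ in Filter.atTop, annularCutoff n =ᶠ[nhds x] 1 := by
  have hx0 : 0 < ‖x‖ := norm_pos_iff.mpr hx
  have h1 : ∀ᶠ n : ℕ in Filter.atTop, 2 * ‖x‖ ≤ n :=
    tendsto_natCast_atTop_atTop.eventually_ge_atTop _
  -- The constant 4 gives n|y| ≥ 2 for all y with |y| > |x|/2.
  have h2 : ∀ᶠ n : ℕ in Filter.atTop, 4 / ‖x‖ ≤ n :=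
    tendsto_natCast_atTop_atTop.eventually_ge_atTop _
  filter_upwards [h1, h2] with n h1 h2
  have h3 : ∀ᶠ y : Space in nhds x, ‖y‖ < 2 * ‖x‖ :=
    continuous_norm.continuousAt.eventually_lt_const (by linarith)
  have h4 : ∀ᶠ y : Space in nhds x, ‖x‖ / 2 < ‖y‖ :=
    continuous_norm.continuousAt.eventually_const_lt (by linarith)
  filter_upwards [h3, h4] with y h3 h4
  refine annularCutoff_eq_one (h3.le.trans h1) ?_
  rw [div_le_iff₀ hx0] at h2
  nlinarith

/-- The weak equation `D₀ f = g` on `ℝ³ ∖ {0}`. -/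
def WeakDirac (f g : L2) : Prop :=
  ∀ φ : Space → ℂ, ContDiff ℝ (⊤ : ℕ∞) φ → HasCompactSupport φ → tsupport φ ⊆ {0}ᶜ →
    ∫ x, φ x • g x = I • ∑ j, alpha j (∫ x, fderiv ℝ φ x (basisVec j) • f x)

/-- A point is removable for the Dirac operator in `L²(ℝ³)`. -/
theorem WeakDirac.mem_H1 {f g : L2} (h : WeakDirac f g) : ∃ hf : f ∈ H1, D0 ⟨f, hf⟩ = g := by
  refine mem_H1_of_schwartz_weak_dirac f g fun φ => ?_
  have hne : ∀ᵐ x : Space, x ≠ 0 := by simp [ae_iff]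
  have hφ : ContDiff ℝ (⊤ : ℕ∞) (φ : Space → ℂ) := φ.smooth _
  have hcut : ∀ n x, ‖((annularCutoff n x : ℝ) : ℂ)‖ ≤ 1 := fun n x => by
    rw [Complex.norm_real]; exact abs_annularCutoff_le n x
  have hθ : ∀ n : ℕ, ContDiff ℝ (⊤ : ℕ∞) fun x => ((annularCutoff n x : ℝ) : ℂ) := fun n =>
    Complex.ofRealCLM.contDiff.comp (contDiff_annularCutoff n)
  -- limits of terms in which the cutoff is not differentiated
  have lim1 : ∀ (ψ : 𝓢(Space, ℂ)) (u : L2), Filter.Tendsto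
      (fun n : ℕ => ∫ x, (ψ x * (annularCutoff n x : ℂ)) • u x) Filter.atTop
      (nhds (∫ x, ψ x • u x)) := by
    intro ψ u
    refine tendsto_integral_of_dominated_convergence (fun x => ‖ψ x • u x‖) (fun n => ?_)
      (integrable_schwartz_smul ψ u).norm (fun n => .of_forall fun x => ?_) ?_
    · exact ((ψ.continuous.mul (hθ n).continuous).aestronglyMeasurable).smul
        (Lp.aestronglyMeasurable u)
    · rw [norm_smul, norm_smul, norm_mul]
      have := hcut n x
      nlinarith [norm_nonneg (ψ x), norm_nonneg (u x), mul_nonneg (norm_nonneg (ψ x)) (norm_nonneg (u x))]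
    · filter_upwards [hne] with x hx
      refine tendsto_const_nhds.congr' ?_
      filter_upwards [eventually_annularCutoff_eq_one hx] with n hn
      simp [hn.self_of_nhds]
  -- Here dimension three enters: the integrand is at most C|φ||x|⁻¹|f| ≤ C²|φ|²|x|⁻² + |f|², which
  -- is integrable, and away from the origin it is eventually zero at each point.
  have lim2 : ∀ j, Filter.Tendsto
      (fun n : ℕ => ∫ x, (φ x * ((fderiv ℝ (annularCutoff n) x (basisVec j) : ℝ) : ℂ)) • f x)
      Filter.atTop (nhds 0) := by
    intro j
    obtain ⟨C, hC⟩ := exists_fderiv_annularCutoff_le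
    have hf2 : Integrable fun x => ‖f x‖ ^ 2 :=
      (memLp_two_iff_integrable_sq_norm (Lp.memLp f).1).mp (Lp.memLp f)
    rw [← integral_zero Space Spinor (μ := volume)]
    refine tendsto_integral_of_dominated_convergence
      (fun x => C ^ 2 * (‖φ x‖ ^ 2 * (‖x‖ ^ 2)⁻¹) + ‖f x‖ ^ 2) (fun n => ?_)
      (((integrable_schwartz_div_norm_sq φ).const_mul _).add hf2) (fun n => ?_) ?_
    · have : Continuous fun x => ((fderiv ℝ (annularCutoff n) x (basisVec j) : ℝ) : ℂ) :=
        Complex.continuous_ofReal.comp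
          (((contDiff_annularCutoff n).continuous_fderiv (by simp)).clm_apply continuous_const)
      exact ((φ.continuous.mul this).aestronglyMeasurable).smul (Lp.aestronglyMeasurable f)
    · filter_upwards [hne] with x hx
      have hx0 : 0 < ‖x‖ := norm_pos_iff.mpr hx
      have h1 : ‖fderiv ℝ (annularCutoff n) x (basisVec j)‖ ≤ C * ‖x‖⁻¹ := by
        calc _ ≤ ‖fderiv ℝ (annularCutoff n) x‖ * ‖basisVec j‖ :=
              ContinuousLinearMap.le_opNorm _ _
          _ = ‖fderiv ℝ (annularCutoff n) x‖ := by simp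
          _ ≤ C * ‖x‖⁻¹ := by
            rw [← div_eq_mul_inv, le_div_iff₀ hx0]
            exact hC n x
      rw [norm_smul, norm_mul, Complex.norm_real]
      calc _ ≤ ‖φ x‖ * (C * ‖x‖⁻¹) * ‖f x‖ := by gcongr
        _ ≤ (‖φ x‖ * (C * ‖x‖⁻¹)) ^ 2 + ‖f x‖ ^ 2 := by
          nlinarith [sq_nonneg (‖φ x‖ * (C * ‖x‖⁻¹) - ‖f x‖), sq_nonneg (‖φ x‖ * (C * ‖x‖⁻¹)), sq_nonneg ‖f x‖]
        _ = _ := by rw [← inv_pow]; ring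
    · filter_upwards [hne] with x hx
      refine tendsto_const_nhds.congr' ?_
      filter_upwards [eventually_annularCutoff_eq_one hx] with n hn
      rw [hn.fderiv_eq]
      simp
  have hd : ∀ n x j, fderiv ℝ (fun x => φ x * (annularCutoff n x : ℂ)) x (basisVec j) =
      (∂_{basisVec j} φ) x * (annularCutoff n x : ℂ) +
        φ x * ((fderiv ℝ (annularCutoff n) x (basisVec j) : ℝ) : ℂ) := by
    intro n x j
    have h1 : HasFDerivAt (fun x => ((annularCutoff n x : ℝ) : ℂ))
        (Complex.ofRealCLM ∘L fderiv ℝ (annularCutoff n) x) x :=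
      Complex.ofRealCLM.hasFDerivAt.comp x
        ((contDiff_annularCutoff n).differentiable (by simp) x).hasFDerivAt
    have h2 := ((hφ.differentiable (by simp) x).hasFDerivAt.mul h1).fderiv
    rw [SchwartzMap.lineDerivOp_apply_eq_fderiv]
    have h3 : fderiv ℝ (fun x => φ x * (annularCutoff n x : ℂ)) x =
        φ x • (ofRealCLM ∘L fderiv ℝ (annularCutoff n) x) +
          (annularCutoff n x : ℂ) • fderiv ℝ φ x := h2
    rw [h3]
    simp
    ring
  -- The weak equation off the origin is tested with φ times the cutoff, and the product rule
  -- separates the two kinds of terms.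
  have heq : ∀ᶠ n : ℕ in Filter.atTop, I • ∑ j, alpha j
      ((∫ x, ((∂_{basisVec j} φ) x * (annularCutoff n x : ℂ)) • f x) +
        ∫ x, (φ x * ((fderiv ℝ (annularCutoff n) x (basisVec j) : ℝ) : ℂ)) • f x) =
      ∫ x, (φ x * (annularCutoff n x : ℂ)) • g x := by
    filter_upwards [Filter.eventually_ge_atTop 1] with n hn
    have hcs : HasCompactSupport fun x => ((annularCutoff n x : ℝ) : ℂ) :=
      (hasCompactSupport_annularCutoff hn).comp_left (g := Complex.ofReal) rfl
    have hts : tsupport (fun x => φ x * (annularCutoff n x : ℂ)) ⊆ {0}ᶜ := by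
      refine subset_trans ?_ (tsupport_annularCutoff hn)
      refine closure_mono fun x hx => ?_
      simp only [Function.mem_support, ne_eq, mul_eq_zero, not_or] at hx ⊢
      exact_mod_cast hx.2
    rw [h _ (hφ.mul (hθ n)) hcs.mul_left hts]
    congr 1
    refine Finset.sum_congr rfl fun j _ => ?_
    congr 1
    simp only [hd, add_smul]
    rw [integral_add]
    · have h1 : MemLp (fun x => (∂_{basisVec j} φ) x * (annularCutoff n x : ℂ)) 2 volume :=
        (((∂_{basisVec j} φ).continuous.mul (hθ n).continuous).memLp_of_hasCompactSupport
          hcs.mul_left)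
      exact memLp_one_iff_integrable.mp (MemLp.smul (p := 2) (q := 2) (r := 1) (Lp.memLp f) h1)
    · have : Continuous fun x => ((fderiv ℝ (annularCutoff n) x (basisVec j) : ℝ) : ℂ) :=
        Complex.continuous_ofReal.comp
          (((contDiff_annularCutoff n).continuous_fderiv (by simp)).clm_apply continuous_const)
      have hs : HasCompactSupport fun x =>
          ((fderiv ℝ (annularCutoff n) x (basisVec j) : ℝ) : ℂ) :=
        ((hasCompactSupport_annularCutoff hn).fderiv_apply ℝ (basisVec j)).comp_left
          (g := Complex.ofReal) rfl
      have h1 : MemLp (fun x => φ x * ((fderiv ℝ (annularCutoff n) x (basisVec j) : ℝ) : ℂ)) 2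
          volume := (φ.continuous.mul this).memLp_of_hasCompactSupport hs.mul_left
      exact memLp_one_iff_integrable.mp (MemLp.smul (p := 2) (q := 2) (r := 1) (Lp.memLp f) h1)
  have hR : Filter.Tendsto (fun n : ℕ => I • ∑ j, alpha j
      ((∫ x, ((∂_{basisVec j} φ) x * (annularCutoff n x : ℂ)) • f x) +
        ∫ x, (φ x * ((fderiv ℝ (annularCutoff n) x (basisVec j) : ℝ) : ℂ)) • f x)) Filter.atTop
      (nhds (I • ∑ j, alpha j ((∫ x, (∂_{basisVec j} φ) x • f x) + 0))) := by
    refine (tendsto_finsetSum _ fun j _ => ?_).const_smul I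
    exact ((alpha j).continuous.tendsto _).comp ((lim1 _ f).add (lim2 j))
  have := tendsto_nhds_unique ((lim1 φ g).congr' (heq.mono fun n hn => hn.symm)) hR
  simpa [Lp.toTemperedDistribution_apply] using this

end

/-! ### Classical and weak derivatives; test functions supported away from the origin -/

section

open TemperedDistribution

section Calculus

variable {E : Type*} [NormedAddCommGroup E] [NormedSpace ℝ E]

lemma contDiff_of_contDiffOn_compl_zero {n : WithTop ℕ∞} {G : Space → E}
    (h : ContDiffOn ℝ n G {0}ᶜ) (h0 : G =ᶠ[nhds 0] 0) : ContDiff ℝ n G := by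
  rw [contDiff_iff_contDiffAt]
  intro x
  by_cases hx : x = 0
  · subst hx
    exact contDiffAt_const.congr_of_eventuallyEq h0
  · exact h.contDiffAt (isOpen_compl_singleton.mem_nhds hx)

end Calculus

/-- For `f ∈ H¹` which is `C¹` away from the origin, weak derivatives are classical. -/
lemma partialD_ae_eq (j : Fin 3) (f : H1) {F : Space → Spinor} (hF : ContDiffOn ℝ 1 F {0}ᶜ)
    (hf : (f : L2) =ᵐ[volume] F) :
    partialD j f =ᵐ[volume] fun x => fderiv ℝ F x (basisVec j) := by
  have hne : ∀ᵐ x : Space, x ≠ 0 := by simp [ae_iff]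
  have hcont : ContinuousOn (fun x => fderiv ℝ F x (basisVec j)) {0}ᶜ :=
    (hF.continuousOn_fderiv_of_isOpen isOpen_compl_singleton le_rfl).clm_apply continuousOn_const
  have hloc1 : LocallyIntegrableOn (partialD j f : Space → Spinor) {0}ᶜ volume :=
    ((Lp.memLp (partialD j f)).locallyIntegrable (by norm_num)).locallyIntegrableOn _
  have hloc2 : LocallyIntegrableOn (fun x => fderiv ℝ F x (basisVec j)) {0}ᶜ volume :=
    hcont.locallyIntegrableOn (measurableSet_singleton 0).compl
  have key := isOpen_compl_singleton.ae_eq_zero_of_integral_contDiff_smul_eq_zero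
    (hloc1.sub hloc2) ?_
  · filter_upwards [key, hne] with x hx h0
    exact sub_eq_zero.mp (hx h0)
  intro φ hφ hc hs
  -- Since φ vanishes near the origin, φF is C¹ on the whole space whatever F does at 0, and can be
  -- integrated by parts.
  have h0 : φ =ᶠ[nhds 0] 0 := notMem_tsupport_iff_eventuallyEq.mp fun h => hs h rfl
  have hφF : ContDiff ℝ 1 fun x => φ x • F x := by
    refine contDiff_of_contDiffOn_compl_zero ?_ ?_
    · exact (hφ.of_le (by exact_mod_cast le_top)).contDiffOn.smul hF
    · filter_upwards [h0] with x hx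
      simp [hx]
  have hd : ∀ x, fderiv ℝ (fun x => φ x • F x) x (basisVec j) =
      φ x • fderiv ℝ F x (basisVec j) + fderiv ℝ φ x (basisVec j) • F x := by
    intro x
    by_cases hx : x = 0
    · subst hx
      have h1 : (fun x => φ x • F x) =ᶠ[nhds 0] fun _ => 0 := by
        filter_upwards [h0] with x hx
        simp [hx]
      rw [h1.fderiv_eq, h0.fderiv_eq, h0.self_of_nhds]
      simp
    · rw [fderiv_fun_smul (hφ.differentiable (by simp) x)
        ((hF.contDiffAt (isOpen_compl_singleton.mem_nhds hx)).differentiableAt one_ne_zero)]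
      simp
  have hφ' : HasCompactSupport fun x => fderiv ℝ φ x (basisVec j) := hc.fderiv_apply ℝ _
  have hφc : Continuous fun x => fderiv ℝ φ x (basisVec j) :=
    (hφ.continuous_fderiv (by simp)).clm_apply continuous_const
  have smulInt : ∀ (ψ : Space → ℝ) (u : L2), Continuous ψ → HasCompactSupport ψ →
      Integrable fun x => ψ x • u x := fun ψ u h1 h2 =>
    memLp_one_iff_integrable.mp (MemLp.smul (p := 2) (q := 2) (r := 1) (Lp.memLp u)
      (h1.memLp_of_hasCompactSupport h2))
  have i1 : Integrable fun x => fderiv ℝ φ x (basisVec j) • F x :=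
    (smulInt _ (f : L2) hφc hφ').congr (by filter_upwards [hf] with x hx; rw [hx])
  have i3 : Integrable fun x => fderiv ℝ (fun x => φ x • F x) x (basisVec j) :=
    ((hφF.continuous_fderiv one_ne_zero).clm_apply continuous_const).integrable_of_hasCompactSupport
      ((hc.smul_right (f' := F)).fderiv_apply ℝ _)
  have i2 : Integrable fun x => φ x • fderiv ℝ F x (basisVec j) := by
    refine (i3.sub i1).congr (.of_forall fun x => ?_)
    simp [hd]
  have h3 : ∫ x, φ x • fderiv ℝ F x (basisVec j) = -∫ x, fderiv ℝ φ x (basisVec j) • F x :=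
    integral_smul_fderiv_eq_neg_fderiv_smul_of_integrable i1 i2
      (hφF.continuous.integrable_of_hasCompactSupport hc.smul_right)
      (fun x _ => hφ.differentiable (by simp) x) fun x hx =>
        (hF.contDiffAt (isOpen_compl_singleton.mem_nhds (hs hx))).differentiableAt one_ne_zero
  have hg₁ : HasCompactSupport (Complex.ofRealCLM ∘ φ) := hc.comp_left rfl
  have hg₂ : ContDiff ℝ (⊤ : ℕ∞) (Complex.ofRealCLM ∘ φ) := Complex.ofRealCLM.contDiff.comp hφ
  have h4 := congrArg (fun T : 𝓢'(Space, Spinor) => T (hg₁.toSchwartzMap hg₂)) (partialD_spec j f)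
  simp only [lineDerivOp_apply_apply, map_neg, Lp.toTemperedDistribution_apply] at h4
  have h5 : ∫ x, φ x • partialD j f x = -∫ x, fderiv ℝ φ x (basisVec j) • F x := by
    refine Eq.trans ?_ (h4.symm.trans ?_)
    · refine integral_congr_ae (.of_forall fun x => ?_)
      ext i
      simp
    · congr 1
      refine integral_congr_ae ?_
      filter_upwards [hf] with x hx
      rw [hx, SchwartzMap.lineDerivOp_apply_eq_fderiv]
      have : fderiv ℝ (⇑ofRealCLM ∘ φ) x = ofRealCLM ∘L fderiv ℝ φ x :=
        (ofRealCLM.hasFDerivAt.comp x (hφ.differentiable (by simp) x).hasFDerivAt).fderiv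
      have h6 : fderiv ℝ (hg₁.toSchwartzMap hg₂) x = ofRealCLM ∘L fderiv ℝ φ x := this
      rw [h6]
      ext i
      simp
  simp only [Pi.sub_apply, smul_sub]
  rw [integral_sub (smulInt _ _ hφ.continuous hc) i2, h5, h3, sub_self]

/-- The classical Dirac operator `-i α · ∇`. -/
def diracOp (F : Space → Spinor) (x : Space) : Spinor :=
  (-I) • ∑ j, alpha j (fderiv ℝ F x (basisVec j))

lemma coeFn_D0_ae_eq (f : H1) : D0 f =ᵐ[volume] fun x => (-I) • ∑ j, alpha j (partialD j f x) := by
  rw [D0_apply]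
  have h1 := Lp.coeFn_smul (-I) (∑ j, (alpha j).compLpL 2 (volume : Measure Space) (partialD j f))
  rw [Fin.sum_univ_three] at h1 ⊢
  have h2 := Lp.coeFn_add ((alpha 0).compLpL 2 (volume : Measure Space) (partialD 0 f) +
    (alpha 1).compLpL 2 (volume : Measure Space) (partialD 1 f))
    ((alpha 2).compLpL 2 (volume : Measure Space) (partialD 2 f))
  have h3 := Lp.coeFn_add ((alpha 0).compLpL 2 (volume : Measure Space) (partialD 0 f))
    ((alpha 1).compLpL 2 (volume : Measure Space) (partialD 1 f))
  filter_upwards [h1, h2, h3, (alpha 0).coeFn_compLpL (partialD 0 f),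
    (alpha 1).coeFn_compLpL (partialD 1 f), (alpha 2).coeFn_compLpL (partialD 2 f)]
    with x h1 h2 h3 h4 h5 h6
  rw [h1, Pi.smul_apply, h2, Pi.add_apply, h3, Pi.add_apply, h4, h5, h6, Fin.sum_univ_three]

theorem D0_ae_eq_diracOp (f : H1) {F : Space → Spinor} (hF : ContDiffOn ℝ 1 F {0}ᶜ)
    (hf : (f : L2) =ᵐ[volume] F) : D0 f =ᵐ[volume] diracOp F := by
  filter_upwards [coeFn_D0_ae_eq f, partialD_ae_eq 0 f hF hf, partialD_ae_eq 1 f hF hf,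
    partialD_ae_eq 2 f hF hf] with x h h0 h1 h2
  rw [h, diracOp, Fin.sum_univ_three, Fin.sum_univ_three, h0, h1, h2]

/-- Smooth functions compactly supported in `ℝ³ ∖ {0}`. -/
structure IsTest {E : Type*} [NormedAddCommGroup E] [NormedSpace ℝ E] (η : Space → E) : Prop where
  smooth : ContDiff ℝ (⊤ : ℕ∞) η
  compact : HasCompactSupport η
  zero_notMem : (0 : Space) ∉ tsupport η

namespace IsTest

variable {η : Space → Spinor}

lemma eventuallyEq_zero {E : Type*} [NormedAddCommGroup E] [NormedSpace ℝ E] {η : Space → E}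
    (hη : IsTest η) : η =ᶠ[nhds 0] 0 :=
  notMem_tsupport_iff_eventuallyEq.mp hη.zero_notMem

/-- A test function as an element of `H¹`. -/
def toH1 (hη : IsTest η) : H1 :=
  ⟨(hη.compact.toSchwartzMap hη.smooth).toLp 2 volume, by
    change MemSobolev 1 2 _
    rw [Lp.toTemperedDistribution_toLp_eq]
    exact SchwartzMap.memSobolev _⟩

lemma coeFn_toH1 (hη : IsTest η) : (hη.toH1 : L2) =ᵐ[volume] η :=
  (hη.compact.toSchwartzMap hη.smooth).coeFn_toLp 2 volume

lemma fderiv_apply {E : Type*} [NormedAddCommGroup E] [NormedSpace ℝ E] {η : Space → E}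
    (hη : IsTest η) (v : Space) : IsTest fun x => fderiv ℝ η x v where
  smooth := (hη.smooth.fderiv_right (m := (⊤ : ℕ∞)) (by simp)).clm_apply contDiff_const
  compact := hη.compact.fderiv_apply ℝ v
  zero_notMem := fun h => hη.zero_notMem (tsupport_fderiv_apply_subset ℝ v h)

lemma diracOp (hη : IsTest η) : IsTest (diracOp η) where
  smooth := by
    refine ContDiff.const_smul (-I) (ContDiff.sum fun j _ => ?_)
    exact ((alpha j).restrictScalars ℝ).contDiff.comp (hη.fderiv_apply (basisVec j)).smooth
  compact := by
    refine HasCompactSupport.intro hη.compact fun x hx => ?_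
    rw [Soler.diracOp]
    have : ∀ v, fderiv ℝ η x v = 0 := fun v =>
      image_eq_zero_of_notMem_tsupport (f := fun x => fderiv ℝ η x v) fun h => hx (tsupport_fderiv_apply_subset ℝ (f := η) v h)
    simp [this]
  zero_notMem := by
    rw [notMem_tsupport_iff_eventuallyEq]
    have h := fun j : Fin 3 => (hη.fderiv_apply (basisVec j)).eventuallyEq_zero
    filter_upwards [h 0, h 1, h 2] with x h0 h1 h2
    simp only [Pi.zero_apply] at h0 h1 h2 ⊢
    rw [Soler.diracOp, Fin.sum_univ_three, h0, h1, h2]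
    simp

lemma D0_toH1_ae_eq (hη : IsTest η) : D0 hη.toH1 =ᵐ[volume] Soler.diracOp η :=
  D0_ae_eq_diracOp _ (hη.smooth.of_le (by exact_mod_cast le_top)).contDiffOn hη.coeFn_toH1

/-- Test functions are stable under D₀, so everything proved for them can be applied again to their
Dirac images. -/
lemma D0_toH1 (hη : IsTest η) : D0 hη.toH1 = hη.diracOp.toH1 :=
  Lp.ext (hη.D0_toH1_ae_eq.trans hη.diracOp.coeFn_toH1.symm)

lemma sub {η' : Space → Spinor} (hη : IsTest η) (hη' : IsTest η') :
    IsTest fun x => η x - η' x where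
  smooth := hη.smooth.sub hη'.smooth
  compact := hη.compact.sub hη'.compact
  zero_notMem := by
    rw [notMem_tsupport_iff_eventuallyEq]
    filter_upwards [hη.eventuallyEq_zero, hη'.eventuallyEq_zero] with x h1 h2
    simp [h1, h2]

end IsTest

/-- If `f` and `g` satisfy `⟨D₀ η, f⟩ = ⟨η, g⟩` for all test functions then `D₀ f = g`. -/
theorem mem_H1_of_inner_test {f g : L2}
    (h : ∀ (η : Space → Spinor) (hη : IsTest η),
      inner ℂ (D0 hη.toH1) f = inner ℂ (hη.toH1 : L2) g) :
    ∃ hf : f ∈ H1, D0 ⟨f, hf⟩ = g := by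
  refine WeakDirac.mem_H1 fun φ hφ hc hs => ?_
  have h2 : ∀ (ψ : Space → ℂ) (u : L2), Continuous ψ → HasCompactSupport ψ →
      Integrable fun x => ψ x • u x := fun ψ u h1 h2 =>
    memLp_one_iff_integrable.mp (MemLp.smul (p := 2) (q := 2) (r := 1) (Lp.memLp u)
      (h1.memLp_of_hasCompactSupport h2))
  have hd : ∀ j : Fin 3, Integrable fun x => fderiv ℝ φ x (basisVec j) • f x := fun j =>
    h2 _ f ((hφ.continuous_fderiv (by simp)).clm_apply continuous_const) (hc.fderiv_apply ℝ _)
  -- The vector identity is checked against each constant spinor c. The inner product is antilinear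
  -- on the left, so the matching test field is conj(φ) c.
  refine ext_inner_left ℂ fun c => ?_
  have hη : IsTest fun x => (starRingEnd ℂ) (φ x) • c := by
    refine ⟨?_, ?_, ?_⟩
    · exact (Complex.conjCLE.contDiff.comp hφ).smul contDiff_const
    · exact (hc.comp_left (g := starRingEnd ℂ) (by simp)).smul_right
    · rw [notMem_tsupport_iff_eventuallyEq]
      have h0 : φ =ᶠ[nhds 0] 0 := notMem_tsupport_iff_eventuallyEq.mp fun h => hs h rfl
      filter_upwards [h0] with x hx
      simp [hx]
  have key := h _ hη
  rw [L2.inner_def, L2.inner_def] at key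
  rw [← integral_inner (h2 φ g hφ.continuous hc)]
  have e1 : ∫ x, inner ℂ c (φ x • g x) = ∫ x, inner ℂ ((hη.toH1 : L2) x) (g x) := by
    refine integral_congr_ae ?_
    filter_upwards [hη.coeFn_toH1] with x hx
    rw [hx, inner_smul_left, inner_smul_right]
    simp
  rw [e1, ← key]
  have e2 : I • ∑ j, alpha j (∫ x, fderiv ℝ φ x (basisVec j) • f x) =
      ∫ x, I • ∑ j, alpha j (fderiv ℝ φ x (basisVec j) • f x) := by
    rw [integral_smul, integral_finsetSum _ fun j _ => (alpha j).integrable_comp (hd j)]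
    congr 1
    exact Finset.sum_congr rfl fun j _ => ((alpha j).integral_comp_comm (hd j)).symm
  rw [e2, ← integral_inner]
  · refine integral_congr_ae ?_
    filter_upwards [hη.D0_toH1_ae_eq] with x hx
    rw [hx, diracOp]
    have h3 : ∀ j : Fin 3, fderiv ℝ (fun x => (starRingEnd ℂ) (φ x) • c) x (basisVec j) =
        (starRingEnd ℂ) (fderiv ℝ φ x (basisVec j)) • c := by
      intro j
      have h4 : HasFDerivAt (fun x => (starRingEnd ℂ) (φ x))
          ((Complex.conjCLE : ℂ →L[ℝ] ℂ) ∘L fderiv ℝ φ x) x :=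
        Complex.conjCLE.hasFDerivAt.comp x (hφ.differentiable (by simp) x).hasFDerivAt
      rw [(h4.smul_const c).fderiv]
      simp
    simp only [h3, inner_smul_left, sum_inner, inner_smul_right, inner_sum, map_smul,
      alpha_isSelfAdjoint]
    simp
  · exact (integrable_finsetSum _ fun j _ => (alpha j).integrable_comp (hd j)).smul I

lemma dense_H1 : Dense (H1 : Set L2) := by
  refine (SchwartzMap.denseRange_toLpCLM (E := Space) (F := Spinor) (μ := volume) (p := 2)
    ENNReal.ofNat_ne_top).mono ?_
  rintro _ ⟨φ, rfl⟩
  change MemSobolev 1 2 ((φ.toLp 2 volume : L2) : 𝓢'(Space, Spinor))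
  rw [Lp.toTemperedDistribution_toLp_eq]
  exact SchwartzMap.memSobolev _

end

/-! ### Polar coordinates and averages over spheres -/

section

/-- The unit sphere of `ℝ³`. -/
abbrev Sphere : Type := Metric.sphere (0 : Space) 1

/-- The rotation invariant probability measure on the unit sphere. -/
def sphereMeasure : Measure Sphere :=
  ((volume : Measure Space).toSphere univ)⁻¹ • (volume : Measure Space).toSphere

lemma toSphere_univ_ne_zero : (volume : Measure Space).toSphere univ ≠ 0 := by
  rw [Measure.measure_univ_ne_zero]
  exact Measure.toSphere_ne_zero _

instance : IsProbabilityMeasure sphereMeasure :=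
  ⟨by
    rw [sphereMeasure, Measure.smul_apply, smul_eq_mul]
    exact ENNReal.inv_mul_cancel toSphere_univ_ne_zero (measure_ne_top _ _)⟩

lemma ae_sphereMeasure_iff {p : Sphere → Prop} :
    (∀ᵐ n ∂sphereMeasure, p n) ↔ ∀ᵐ n ∂(volume : Measure Space).toSphere, p n :=
  Measure.ae_ennreal_smul_measure_iff (ENNReal.inv_ne_zero.mpr (measure_ne_top _ _))

/-- Positivity on open sets lets almost everywhere identities between continuous fields on the
sphere hold at every point. -/
instance : sphereMeasure.IsOpenPosMeasure :=
  ⟨fun U hU hne h0 => by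
    have h1 : sphereMeasure Uᶜᶜ = 0 := by rwa [compl_compl]
    have h2 : ∀ᵐ n ∂sphereMeasure, n ∈ Uᶜ := h1
    rw [ae_sphereMeasure_iff] at h2
    have h3 : (volume : Measure Space).toSphere Uᶜᶜ = 0 := h2
    rw [compl_compl] at h3
    exact hU.measure_ne_zero _ hne h3⟩

lemma norm_smul_sphere {r : ℝ} (hr : 0 < r) (n : Sphere) : ‖r • (n : Space)‖ = r := by
  rw [norm_smul, norm_eq_of_mem_sphere, mul_one, Real.norm_of_nonneg hr.le]

lemma sphere_ne_zero (n : Sphere) : (n : Space) ≠ 0 := ne_zero_of_mem_unit_sphere n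

lemma toSphere_eq_smul : (volume : Measure Space).toSphere =
    (volume : Measure Space).toSphere univ • sphereMeasure := by
  rw [sphereMeasure, smul_smul, ENNReal.mul_inv_cancel toSphere_univ_ne_zero (measure_ne_top _ _),
    one_smul]

lemma smul_homeomorphUnitSphereProd (x : ({0}ᶜ : Set Space)) :
    ((homeomorphUnitSphereProd Space x).2 : ℝ) •
      ((homeomorphUnitSphereProd Space x).1 : Space) = x := by
  have := congrArg Subtype.val ((homeomorphUnitSphereProd Space).symm_apply_apply x)
  exact this

lemma lintegral_eq_lintegral_prod (F : Space → ℝ≥0∞) :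
    ∫⁻ x, F x = ∫⁻ p : Sphere × Ioi (0 : ℝ), F ((p.2 : ℝ) • (p.1 : Space))
      ∂(volume : Measure Space).toSphere.prod (.volumeIoiPow (Module.finrank ℝ Space - 1)) := by
  have h := (volume : Measure Space).measurePreserving_homeomorphUnitSphereProd
  rw [← h.lintegral_comp_emb (Homeomorph.measurableEmbedding _)]
  simp only [smul_homeomorphUnitSphereProd]
  rw [lintegral_subtype_comap (measurableSet_singleton _).compl F, restrict_compl_singleton]

/-- Integration in polar coordinates, averaging over spheres. -/
lemma lintegral_sphere_average {F : Space → ℝ≥0∞} (hF : Measurable F) :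
    ∫⁻ x, F x = ∫⁻ x : Space, ∫⁻ n : Sphere, F (‖x‖ • (n : Space)) ∂sphereMeasure := by
  have hm : Measurable fun p : Sphere × ℝ => F (p.2 • (p.1 : Space)) := hF.comp (by fun_prop)
  have hm' : Measurable fun r : ℝ => ∫⁻ n : Sphere, F (r • (n : Space)) ∂sphereMeasure :=
    Measurable.lintegral_prod_left' hm
  have hmn : Measurable fun x : Space => ∫⁻ n : Sphere, F (‖x‖ • (n : Space)) ∂sphereMeasure :=
    hm'.comp measurable_norm
  have hm'' : Measurable fun p : Sphere × Ioi (0 : ℝ) => F ((p.2 : ℝ) • (p.1 : Space)) :=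
    hF.comp (by fun_prop)
  rw [lintegral_eq_lintegral_prod, lintegral_eq_lintegral_prod,
    lintegral_prod_symm _ hm''.aemeasurable, lintegral_prod_symm]
  · refine lintegral_congr fun r => ?_
    -- On the right the integrand depends on the radius alone, so the outer spherical integral only
    -- produces the total mass by which `sphereMeasure` was divided.
    have hr : ∀ n : Sphere, ‖(r : ℝ) • (n : Space)‖ = r := norm_smul_sphere r.2
    simp only [hr, lintegral_const]
    conv_lhs => rw [toSphere_eq_smul]
    rw [lintegral_smul_measure, smul_eq_mul, mul_comm]
  · exact (hmn.comp (by fun_prop)).aemeasurable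

lemma integral_eq_integral_prod (F : Space → ℂ) :
    ∫ x, F x = ∫ p : Sphere × Ioi (0 : ℝ), F ((p.2 : ℝ) • (p.1 : Space))
      ∂(volume : Measure Space).toSphere.prod (.volumeIoiPow (Module.finrank ℝ Space - 1)) := by
  have h := (volume : Measure Space).measurePreserving_homeomorphUnitSphereProd
  rw [← h.integral_comp (Homeomorph.measurableEmbedding _)]
  simp only [smul_homeomorphUnitSphereProd]
  rw [integral_subtype_comap (measurableSet_singleton _).compl F, restrict_compl_singleton]

lemma integral_sphere_average {F : Space → ℂ} (hF : Integrable F) :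
    ∫ x, F x = ∫ x : Space, ∫ n : Sphere, F (‖x‖ • (n : Space)) ∂sphereMeasure := by
  have h := (volume : Measure Space).measurePreserving_homeomorphUnitSphereProd
  have hi : Integrable (fun p : Sphere × Ioi (0 : ℝ) => F ((p.2 : ℝ) • (p.1 : Space)))
      ((volume : Measure Space).toSphere.prod (.volumeIoiPow (Module.finrank ℝ Space - 1))) := by
    rw [← h.integrable_comp_emb (Homeomorph.measurableEmbedding _)]
    simp only [Function.comp_def, smul_homeomorphUnitSphereProd]
    have := hF.integrableOn (s := {0}ᶜ)
    rwa [integrableOn_iff_comap_subtypeVal (measurableSet_singleton _).compl] at this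
  rw [integral_eq_integral_prod, integral_eq_integral_prod]
  have hr : ∀ p : Sphere × Ioi (0 : ℝ), ‖(p.2 : ℝ) • (p.1 : Space)‖ = p.2 := fun p =>
    norm_smul_sphere p.2.2 p.1
  simp only [hr]
  rw [integral_prod_symm _ hi, integral_fun_snd
    (fun r : Ioi (0 : ℝ) => ∫ n : Sphere, F ((r : ℝ) • (n : Space)) ∂sphereMeasure),
    ← integral_smul]
  refine integral_congr_ae (.of_forall fun r => ?_)
  simp only
  conv_lhs => rw [toSphere_eq_smul]
  rw [integral_smul_measure]
  rfl

/-- Smooth dependence of spherical averages on the radius. -/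
lemma contDiff_sphere_average (m : ℕ) : ∀ (E : Type) [NormedAddCommGroup E] [NormedSpace ℝ E]
    (k : Sphere → E →L[ℝ] ℂ) (η : Space → E), Continuous k → ContDiff ℝ (⊤ : ℕ∞) η →
    ContDiff ℝ m fun r : ℝ => ∫ n : Sphere, k n (η (r • (n : Space))) ∂sphereMeasure := by
  have hc : ∀ (E : Type) [NormedAddCommGroup E] [NormedSpace ℝ E]
      (k : Sphere → E →L[ℝ] ℂ) (η : Space → E), Continuous k → ContDiff ℝ (⊤ : ℕ∞) η →
      Continuous fun p : ℝ × Sphere => k p.2 (η (p.1 • (p.2 : Space))) := by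
    intro E _ _ k η hk hη
    have := hη.continuous
    fun_prop
  -- A derivative in r falls on η and yields an average of the same shape with values in `Space
  -- →L[ℝ] E`; hence the induction ranges over all target spaces.
  induction m with
  | zero =>
    intro E _ _ k η hk hη
    rw [Nat.cast_zero, contDiff_zero]
    exact continuous_parametric_integral_of_continuous (hc E k η hk hη) isCompact_univ |> fun h => by
      simpa using h
  | succ m ih =>
    intro E _ _ k η hk hη
    have hη' : ContDiff ℝ (⊤ : ℕ∞) (fderiv ℝ η) := hη.fderiv_right (by simp)
    -- The r-derivative of η(rn) is Dη(rn) applied to n; that evaluation is absorbed into the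
    -- kernel.
    let k' : Sphere → (Space →L[ℝ] E) →L[ℝ] ℂ := fun n =>
      k n ∘L ContinuousLinearMap.apply ℝ E (n : Space)
    have hk' : Continuous k' := by
      refine hk.clm_comp ?_
      exact (ContinuousLinearMap.apply ℝ E).continuous.comp continuous_subtype_val
    have hd : ∀ r : ℝ, HasDerivAt
        (fun r : ℝ => ∫ n : Sphere, k n (η (r • (n : Space))) ∂sphereMeasure)
        (∫ n : Sphere, k' n (fderiv ℝ η (r • (n : Space))) ∂sphereMeasure) r := by
      intro r
      have hcont := hc _ k' (fderiv ℝ η) hk' hη'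
      obtain ⟨C, hC⟩ := ((isCompact_closedBall r 1).prod
        (isCompact_univ (X := Sphere))).exists_bound_of_continuousOn hcont.continuousOn
      refine (hasDerivAt_integral_of_dominated_loc_of_deriv_le (μ := sphereMeasure)
        (F := fun (r : ℝ) (n : Sphere) => k n (η (r • (n : Space))))
        (F' := fun (r : ℝ) (n : Sphere) => k' n (fderiv ℝ η (r • (n : Space))))
        (bound := fun _ => C) (s := Metric.ball r 1) (Metric.ball_mem_nhds r one_pos) ?_ ?_ ?_ ?_
        (integrable_const C) ?_).2
      · refine .of_forall fun s => ?_
        exact ((hc E k η hk hη).comp (Continuous.prodMk_right s)).aestronglyMeasurable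
      · exact ((hc E k η hk hη).comp (Continuous.prodMk_right r)).integrable_of_hasCompactSupport
          (HasCompactSupport.of_compactSpace _)
      · exact (hcont.comp (Continuous.prodMk_right r)).aestronglyMeasurable
      · exact .of_forall fun n s hs => hC (s, n) ⟨Metric.ball_subset_closedBall hs, mem_univ _⟩
      · refine .of_forall fun n s _ => ?_
        have h1 : HasDerivAt (fun s : ℝ => s • (n : Space)) (n : Space) s := by
          simpa using (hasDerivAt_id s).smul_const (n : Space)
        have h2 := (hη.differentiable (by simp) (s • (n : Space))).hasFDerivAt.comp_hasDerivAt s h1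
        exact (k n).hasFDerivAt.comp_hasDerivAt s h2
    rw [Nat.cast_succ, contDiff_succ_iff_deriv]
    refine ⟨fun r => (hd r).differentiableAt, by simp, ?_⟩
    rw [show deriv _ = _ from funext fun r => (hd r).deriv]
    exact ih _ k' _ hk' hη'

end

/-! ### Angular spaces; orthonormal families give isometries -/

section

variable {κ : Type} [Fintype κ]

/-- The field `∑ c_k(|x|) b_k(x)`. -/
def radialField (b : κ → Space → Spinor) (c : ℝ → κ → ℂ) (x : Space) : Spinor :=
  ∑ k, c ‖x‖ k • b k x

/-- The square integrable fields `∑ c_k(|x|) b_k(x)` with measurable coefficients. -/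
def angularSpace (b : κ → Space → Spinor) : Submodule ℂ L2 where
  carrier := {f | ∃ c : ℝ → κ → ℂ, Measurable c ∧ f =ᵐ[volume] radialField b c}
  zero_mem' := ⟨0, measurable_const, by
    filter_upwards [Lp.coeFn_zero Spinor 2 (volume : Measure Space)] with x hx
    simp [radialField]⟩
  add_mem' := by
    rintro f g ⟨c, hc, hf⟩ ⟨d, hd, hg⟩
    refine ⟨c + d, hc.add hd, ?_⟩
    filter_upwards [Lp.coeFn_add f g, hf, hg] with x hx h1 h2
    rw [hx, Pi.add_apply, h1, h2]
    simp [radialField, add_smul, Finset.sum_add_distrib]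
  smul_mem' := by
    rintro a f ⟨c, hc, hf⟩
    refine ⟨a • c, hc.const_smul a, ?_⟩
    filter_upwards [Lp.coeFn_smul a f, hf] with x hx h1
    rw [hx, Pi.smul_apply, h1]
    simp [radialField, Finset.smul_sum, smul_smul]

/-- The operator `-i α · x / |x|`. -/
def alphaR (x : Space) (z : Spinor) : Spinor :=
  (-I) • ∑ j, ((x j / ‖x‖ : ℝ) : ℂ) • alpha j z

/-- Families of functions homogeneous of degree zero whose span is stable under the radial and the
tangential parts of the Dirac operator. -/
structure IsAngular (b : κ → Space → Spinor) : Prop where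
  smooth : ∀ k, ContDiffOn ℝ (⊤ : ℕ∞) (b k) {0}ᶜ
  homog : ∀ k x (r : ℝ), 0 < r → b k (r • x) = b k x
  radial : ∀ k, ∃ a : κ → ℂ, ∀ x ≠ 0, alphaR x (b k x) = ∑ j, a j • b j x
  tangential : ∀ k, ∃ a : κ → ℂ, ∀ x ≠ 0, diracOp (b k) x = (‖x‖⁻¹ : ℂ) • ∑ j, a j • b j x

/-- Orthonormality on the unit sphere. -/
def SphereOrthonormal [DecidableEq κ] (w : κ → Space → Spinor) : Prop :=
  ∀ k l, ∫ n : Sphere, inner ℂ (w k n) (w l n) ∂sphereMeasure = if k = l then 1 else 0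

namespace IsAngular

variable {w : κ → Space → Spinor}

lemma continuousOn (hw : IsAngular w) (k : κ) : ContinuousOn (w k) {0}ᶜ := (hw.smooth k).continuousOn

lemma measurable (hw : IsAngular w) (k : κ) : Measurable (w k) :=
  measurable_of_continuousOn_compl_singleton 0 (hw.continuousOn k)

lemma continuous_sphere (hw : IsAngular w) (k : κ) : Continuous fun n : Sphere => w k n :=
  (hw.continuousOn k).comp_continuous continuous_subtype_val fun n => sphere_ne_zero n

lemma measurable_radialField (hw : IsAngular w) {c : ℝ → κ → ℂ} (hc : Measurable c) :
    Measurable (radialField w c) := by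
  refine Finset.measurable_sum _ fun k _ => ?_
  exact ((measurable_pi_apply k).comp (hc.comp measurable_norm)).smul (hw.measurable k)

lemma radialField_smul (hw : IsAngular w) (c : ℝ → κ → ℂ) {r : ℝ} (hr : 0 < r) (n : Sphere) :
    radialField w c (r • (n : Space)) = ∑ k, c r k • w k n := by
  simp only [radialField, norm_smul_sphere hr, hw.homog _ _ _ hr]

/-- The image of Lebesgue measure under the norm is the measure whose null sets of radii have null
preimages in space, so it is the right one for classes of coefficients. -/
lemma _root_.Soler.radialField_congr {c d : ℝ → κ → ℂ}
    (h : c =ᵐ[Measure.map norm (volume : Measure Space)] d) :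
    radialField w c =ᵐ[volume] radialField w d := by
  filter_upwards [ae_of_ae_map measurable_norm.aemeasurable h] with x hx
  simp only [radialField, hx]

variable [DecidableEq κ]

lemma integral_inner_sum (hw : IsAngular w) (hon : SphereOrthonormal w) (a b : κ → ℂ) :
    ∫ n : Sphere, inner ℂ (∑ k, a k • w k n) (∑ k, b k • w k n) ∂sphereMeasure =
      ∑ k, (starRingEnd ℂ) (a k) * b k := by
  have hi : ∀ k l, Integrable (fun n : Sphere => inner ℂ (w k n) (w l n)) sphereMeasure :=
    fun k l => ((hw.continuous_sphere k).inner (hw.continuous_sphere l)).integrable_of_hasCompactSupport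
      (HasCompactSupport.of_compactSpace _)
  have hexp : ∀ n : Sphere, inner ℂ (∑ k, a k • w k n) (∑ k, b k • w k n) =
      ∑ k, ∑ l, b k * ((starRingEnd ℂ) (a l) * inner ℂ (w l n) (w k n)) := fun n => by
    simp only [sum_inner, inner_sum, inner_smul_left, inner_smul_right, Finset.mul_sum]
  simp only [hexp]
  rw [integral_finsetSum _ fun k _ => integrable_finsetSum _ fun l _ =>
    ((hi l k).const_mul _).const_mul _]
  rw [Finset.sum_congr rfl fun k _ => integral_finsetSum _ fun l _ =>
    ((hi l k).const_mul _).const_mul _]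
  simp only [integral_const_mul, hon _ _]
  simp [mul_comm]

/-- Parseval on each sphere |x| = r: by homogeneity the field there is a combination of the
orthonormal restrictions with the constant coefficients c_k(r). -/
lemma lintegral_enorm_sq_radialField (hw : IsAngular w) (hon : SphereOrthonormal w) {c : ℝ → κ → ℂ}
    (hc : Measurable c) :
    ∫⁻ x, ‖radialField w c x‖ₑ ^ (2 : ℝ) =
      ∫⁻ x : Space, ‖(WithLp.toLp 2 (c ‖x‖) : EuclideanSpace ℂ κ)‖ₑ ^ (2 : ℝ) := by
  rw [lintegral_sphere_average ((hw.measurable_radialField hc).enorm.pow_const _)]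
  have hne : ∀ᵐ x : Space, x ≠ 0 := by simp [ae_iff]
  refine lintegral_congr_ae ?_
  filter_upwards [hne] with x hx
  have hx0 : 0 < ‖x‖ := norm_pos_iff.mpr hx
  simp only [hw.radialField_smul c hx0]
  have hcont : Continuous fun n : Sphere => ∑ k, c ‖x‖ k • w k n :=
    continuous_finsetSum _ fun k _ => (hw.continuous_sphere k).const_smul (c ‖x‖ k)
  have h1 : ∀ n : Sphere, ‖∑ k, c ‖x‖ k • w k n‖ₑ ^ (2 : ℝ) =
      ENNReal.ofReal (‖∑ k, c ‖x‖ k • w k n‖ ^ 2) := fun n => by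
    rw [← ofReal_norm, ENNReal.ofReal_rpow_of_nonneg (norm_nonneg _) (by norm_num)]
    norm_num
  simp only [h1]
  have hint : Integrable (fun n : Sphere => ‖∑ k, c ‖x‖ k • w k n‖ ^ 2) sphereMeasure :=
    (hcont.norm.pow 2).integrable_of_hasCompactSupport (HasCompactSupport.of_compactSpace _)
  rw [← ofReal_integral_eq_lintegral_ofReal hint (.of_forall fun n => by positivity), ← ofReal_norm,
    ENNReal.ofReal_rpow_of_nonneg (norm_nonneg _) (by norm_num)]
  congr 1
  have h2 := hw.integral_inner_sum hon (c ‖x‖) (c ‖x‖)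
  simp only [inner_self_eq_norm_sq_to_K] at h2
  have h3 : ((∫ n : Sphere, ‖∑ k, c ‖x‖ k • w k n‖ ^ 2 ∂sphereMeasure : ℝ) : ℂ) =
      ((‖(WithLp.toLp 2 (c ‖x‖) : EuclideanSpace ℂ κ)‖ ^ 2 : ℝ) : ℂ) := by
    rw [EuclideanSpace.norm_sq_eq, ← integral_complex_ofReal]
    push_cast
    refine h2.trans (Finset.sum_congr rfl fun k _ => ?_)
    rw [← Complex.normSq_eq_conj_mul_self, Complex.normSq_eq_norm_sq]
    push_cast
    rfl
  rw [Complex.ofReal_injective h3]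
  norm_num

lemma eLpNorm_radialField (hw : IsAngular w) (hon : SphereOrthonormal w) {c : ℝ → κ → ℂ} (hc : Measurable c) :
    eLpNorm (radialField w c) 2 volume =
      eLpNorm (fun r => (WithLp.toLp 2 (c r) : EuclideanSpace ℂ κ)) 2
        (Measure.map norm (volume : Measure Space)) := by
  have hm : Measurable fun r => (WithLp.toLp 2 (c r) : EuclideanSpace ℂ κ) :=
    (PiLp.continuous_toLp 2 _).measurable.comp hc
  rw [eLpNorm_map_measure hm.aestronglyMeasurable measurable_norm.aemeasurable,
    eLpNorm_eq_lintegral_rpow_enorm_toReal (by norm_num) (by norm_num),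
    eLpNorm_eq_lintegral_rpow_enorm_toReal (by norm_num) (by norm_num)]
  simp only [ENNReal.toReal_ofNat]
  rw [hw.lintegral_enorm_sq_radialField hon hc]
  rfl

lemma memLp_radialField (hw : IsAngular w) (hon : SphereOrthonormal w)
    (c : Lp (EuclideanSpace ℂ κ) 2 (Measure.map norm (volume : Measure Space))) :
    MemLp (radialField w fun r => (c r).ofLp) 2 volume ∧
      eLpNorm (radialField w fun r => (c r).ofLp) 2 volume =
        eLpNorm c 2 (Measure.map norm (volume : Measure Space)) := by
  have hm := (Lp.aestronglyMeasurable c).stronglyMeasurable_mk.measurable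
  have hae := (Lp.aestronglyMeasurable c).ae_eq_mk
  set c' := (Lp.aestronglyMeasurable c).mk c
  have hc' : Measurable fun r => (c' r).ofLp := (PiLp.continuous_ofLp 2 _).measurable.comp hm
  have h1 : radialField w (fun r => (c r).ofLp) =ᵐ[volume] radialField w fun r => (c' r).ofLp :=
    radialField_congr (by filter_upwards [hae] with r hr; rw [hr])
  have h2 : eLpNorm (radialField w fun r => (c r).ofLp) 2 volume =
        eLpNorm c 2 (Measure.map norm (volume : Measure Space)) := by
    rw [eLpNorm_congr_ae h1, hw.eLpNorm_radialField hon hc', eLpNorm_congr_ae hae]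
  refine ⟨⟨?_, ?_⟩, h2⟩
  · exact (hw.measurable_radialField hc').aestronglyMeasurable.congr h1.symm
  · rw [h2]
    exact (Lp.memLp c).2

/-- The isometry sending radial coefficients to the corresponding field. -/
def synthesis (hw : IsAngular w) (hon : SphereOrthonormal w) :
    Lp (EuclideanSpace ℂ κ) 2 (Measure.map norm (volume : Measure Space)) →ₗᵢ[ℂ] L2 where
  toFun c := (hw.memLp_radialField hon c).1.toLp
  map_add' c d := by
    rw [← MemLp.toLp_add, MemLp.toLp_eq_toLp_iff]
    refine (radialField_congr (d := fun r => (c r + d r).ofLp) ?_).trans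
      (.of_forall fun x => ?_)
    · filter_upwards [Lp.coeFn_add c d] with r hr
      rw [hr, Pi.add_apply]
    · simp [radialField, add_smul, Finset.sum_add_distrib]
  map_smul' a c := by
    rw [RingHom.id_apply, ← MemLp.toLp_const_smul, MemLp.toLp_eq_toLp_iff]
    refine (radialField_congr (d := fun r => (a • c r).ofLp) ?_).trans
      (.of_forall fun x => ?_)
    · filter_upwards [Lp.coeFn_smul a c] with r hr
      rw [hr, Pi.smul_apply]
    · simp [radialField, Finset.smul_sum, smul_smul]
  norm_map' c := by
    change ‖(hw.memLp_radialField hon c).1.toLp‖ = ‖c‖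
    rw [Lp.norm_toLp, (hw.memLp_radialField hon c).2, Lp.norm_def]

/-- By Parseval, square integrability of the field forces square integrability of the coefficients,
so no element of the angular space is missed. -/
lemma range_synthesis (hw : IsAngular w) (hon : SphereOrthonormal w) :
    Set.range (hw.synthesis hon) = (angularSpace w : Set L2) := by
  ext f
  constructor
  · rintro ⟨c, rfl⟩
    have hm := (Lp.aestronglyMeasurable c).stronglyMeasurable_mk.measurable
    have hae := (Lp.aestronglyMeasurable c).ae_eq_mk
    refine ⟨fun r => ((Lp.aestronglyMeasurable c).mk c r).ofLp,
      (PiLp.continuous_ofLp 2 _).measurable.comp hm, ?_⟩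
    exact (MemLp.coeFn_toLp (hw.memLp_radialField hon c).1).trans
      (radialField_congr (by filter_upwards [hae] with r hr; rw [hr]))
  · rintro ⟨c, hc, hf⟩
    have hm : Measurable fun r => (WithLp.toLp 2 (c r) : EuclideanSpace ℂ κ) :=
      (PiLp.continuous_toLp 2 _).measurable.comp hc
    have hL : MemLp (fun r => (WithLp.toLp 2 (c r) : EuclideanSpace ℂ κ)) 2
        (Measure.map norm (volume : Measure Space)) := by
      refine ⟨hm.aestronglyMeasurable, ?_⟩
      rw [← hw.eLpNorm_radialField hon hc, ← eLpNorm_congr_ae hf]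
      exact (Lp.memLp f).2
    refine ⟨hL.toLp, Lp.ext ?_⟩
    refine (MemLp.coeFn_toLp (hw.memLp_radialField hon hL.toLp).1).trans ?_
    refine (radialField_congr ?_).trans hf.symm
    filter_upwards [hL.coeFn_toLp] with r hr
    rw [hr]

/-- The range of an isometry defined on a complete space is closed. -/
lemma isClosed_of_orthonormal (hw : IsAngular w) (hon : SphereOrthonormal w) :
    IsClosed (angularSpace w : Set L2) := by
  rw [← hw.range_synthesis hon]
  exact (hw.synthesis hon).isometry.isClosedEmbedding.isClosed_range

end IsAngular

end

/-! ### The projection onto an orthonormal angular space commutes with D₀ -/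

section

variable {κ : Type} [Fintype κ]

lemma norm_contDiffOn : ContDiffOn ℝ (⊤ : ℕ∞) (fun x : Space => ‖x‖) {0}ᶜ := fun _ hx =>
  (contDiffAt_norm ℝ hx).contDiffWithinAt

lemma hasFDerivAt_norm_space {x : Space} (hx : x ≠ 0) :
    HasFDerivAt (fun x : Space => ‖x‖) (‖x‖⁻¹ • innerSL ℝ x) x := by
  have h := (hasStrictFDerivAt_norm_sq x).hasFDerivAt.sqrt (by simpa using hx)
  have h2 : (fun y : Space => √(‖y‖ ^ 2)) = fun y => ‖y‖ :=
    funext fun y => Real.sqrt_sq (norm_nonneg y)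
  rw [h2, Real.sqrt_sq (norm_nonneg x)] at h
  have h3 : (‖x‖⁻¹ • innerSL ℝ x : Space →L[ℝ] ℝ) = (1 / (2 * ‖x‖)) • 2 • innerSL ℝ x := by
    have hx0 : ‖x‖ ≠ 0 := norm_ne_zero_iff.mpr hx
    ext y
    simp
    field_simp
  rw [h3]
  exact h

lemma fderiv_radial_smul {E : Type*} [NormedAddCommGroup E] [NormedSpace ℝ E] [NormedSpace ℂ E]
    [IsScalarTower ℝ ℂ E] {χ : ℝ → ℂ} {F : Space → E} {x : Space} (hx : x ≠ 0)
    (hχ : DifferentiableAt ℝ χ ‖x‖) (hF : DifferentiableAt ℝ F x) (j : Fin 3) :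
    fderiv ℝ (fun x => χ ‖x‖ • F x) x (basisVec j) =
      χ ‖x‖ • fderiv ℝ F x (basisVec j) + ((x j / ‖x‖ : ℝ) * deriv χ ‖x‖) • F x := by
  have h1 : HasFDerivAt (fun x : Space => χ ‖x‖)
      ((ContinuousLinearMap.toSpanSingleton ℝ (deriv χ ‖x‖)) ∘L (‖x‖⁻¹ • innerSL ℝ x)) x :=
    hχ.hasDerivAt.hasFDerivAt.comp x (hasFDerivAt_norm_space hx)
  have h2 : HasFDerivAt (fun x => χ ‖x‖ • F x) _ x := h1.smul hF.hasFDerivAt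
  rw [h2.fderiv]
  simp [EuclideanSpace.inner_single_right, div_eq_mul_inv, mul_comm]
  congr 1
  ring

/-- The gradient of χ(|x|) is χ'(|x|) x/|x|, and contracting it with -iα gives χ'α_r. -/
lemma diracOp_radial_smul {χ : ℝ → ℂ} {F : Space → Spinor} {x : Space} (hx : x ≠ 0)
    (hχ : DifferentiableAt ℝ χ ‖x‖) (hF : DifferentiableAt ℝ F x) :
    diracOp (fun x => χ ‖x‖ • F x) x = χ ‖x‖ • diracOp F x + deriv χ ‖x‖ • alphaR x (F x) := by
  simp only [diracOp, fderiv_radial_smul hx hχ hF, alphaR, map_add, map_smul,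
    Finset.sum_add_distrib, smul_add, Finset.smul_sum, smul_smul]
  congr 1 <;> refine Finset.sum_congr rfl fun j _ => ?_
  · rw [mul_comm]
  · congr 1
    ring

/-- Coefficients of spherical averages against a family. -/
def sphereCoeff (w : κ → Space → Spinor) (η : Space → Spinor) (r : ℝ) (k : κ) : ℂ :=
  ∫ n : Sphere, inner ℂ (w k n) (η (r • (n : Space))) ∂sphereMeasure

namespace IsAngular

variable {w : κ → Space → Spinor}

lemma contDiff_sphereCoeff (hw : IsAngular w) {η : Space → Spinor}
    (hη : ContDiff ℝ (⊤ : ℕ∞) η) (k : κ) :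
    ContDiff ℝ (⊤ : ℕ∞) fun r => sphereCoeff w η r k := by
  rw [contDiff_infty]
  intro m
  have h3 : Continuous fun L : Spinor →L[ℂ] ℂ => L.restrictScalars ℝ :=
    (ContinuousLinearMap.restrictScalarsL ℂ Spinor ℂ ℝ ℝ).continuous
  exact contDiff_sphere_average m Spinor (fun n => (innerSL ℂ (w k n)).restrictScalars ℝ) η
    (h3.comp ((innerSL ℂ).continuous.comp (hw.continuous_sphere k))) hη

/-- A spherical average vanishes at every radius whose whole sphere misses the support of η, so the
averaged field is again supported in an annulus. There the w_k are smooth; at the origin they need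
not even be continuous, which is why test functions avoid it. -/
lemma isTest_radialField_sphereCoeff (hw : IsAngular w) {η : Space → Spinor} (hη : IsTest η) :
    IsTest (radialField w (sphereCoeff w η)) := by
  have hz : ∀ x : Space, (∀ y : Space, ‖y‖ = ‖x‖ → η y = 0) →
      radialField w (sphereCoeff w η) x = 0 := by
    intro x hx
    refine Finset.sum_eq_zero fun k _ => ?_
    have : sphereCoeff w η ‖x‖ k = 0 := by
      rw [sphereCoeff, ← integral_zero Sphere ℂ (μ := sphereMeasure)]
      congr 1
      ext n
      rw [hx _ (by simp [norm_smul]), inner_zero_right]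
    rw [this, zero_smul]
  have h0 : radialField w (sphereCoeff w η) =ᶠ[nhds 0] 0 := by
    obtain ⟨ε, hε, h⟩ := Metric.eventually_nhds_iff_ball.mp hη.eventuallyEq_zero
    filter_upwards [Metric.ball_mem_nhds 0 hε] with x hx
    exact hz x fun y hy => h y (by simpa [hy] using hx)
  refine ⟨contDiff_of_contDiffOn_compl_zero ?_ h0, ?_, notMem_tsupport_iff_eventuallyEq.mpr h0⟩
  · refine ContDiffOn.sum fun k _ => ?_
    have h := (hw.contDiff_sphereCoeff hη.smooth k).comp_contDiffOn norm_contDiffOn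
    exact h.smul (hw.smooth k)
  · obtain ⟨R, hR⟩ := hη.compact.isCompact.isBounded.subset_closedBall 0
    refine HasCompactSupport.intro (isCompact_closedBall 0 R) fun x hx => hz x fun y hy => ?_
    refine image_eq_zero_of_notMem_tsupport fun h => hx ?_
    simpa [hy] using hR h

lemma sphereCoeff_measurable (hw : IsAngular w) {η : Space → Spinor} (hη : IsTest η) :
    Measurable (sphereCoeff w η) :=
  measurable_pi_lambda _ fun k => (hw.contDiff_sphereCoeff hη.smooth k).continuous.measurable

lemma toH1_mem_angularSpace (hw : IsAngular w) {η : Space → Spinor} (hη : IsTest η) :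
    ((hw.isTest_radialField_sphereCoeff hη).toH1 : L2) ∈ angularSpace w :=
  ⟨_, hw.sphereCoeff_measurable hη, (hw.isTest_radialField_sphereCoeff hη).coeFn_toH1⟩

/-- The Leibniz rule splits the action: c_k meets the tangential matrix d/r, and c_k' meets the
radial matrix a. The matrices are given explicitly so that the same computation serves the radial
reduction. -/
lemma diracOp_radialField (hw : IsAngular w) {c : ℝ → κ → ℂ} {a d : κ → κ → ℂ}
    (ha : ∀ k, ∀ x ≠ 0, alphaR x (w k x) = ∑ j, a k j • w j x)
    (hd : ∀ k, ∀ x ≠ 0, diracOp (w k) x = (‖x‖⁻¹ : ℂ) • ∑ j, d k j • w j x)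
    {x : Space} (hx : x ≠ 0) (hc : ∀ k, DifferentiableAt ℝ (fun r => c r k) ‖x‖) :
    diracOp (radialField w c) x = radialField w (fun r j =>
      ∑ k, (c r k * (r⁻¹ : ℂ) * d k j + deriv (fun r => c r k) r * a k j)) x := by
  have hwd : ∀ k, DifferentiableAt ℝ (w k) x := fun k =>
    ((hw.smooth k).contDiffAt (isOpen_compl_singleton.mem_nhds hx)).differentiableAt (by simp)
  have hcw : ∀ k, DifferentiableAt ℝ (fun x : Space => c ‖x‖ k • w k x) x := fun k =>
    ((hc k).comp x (hasFDerivAt_norm_space hx).differentiableAt).smul (hwd k)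
  have h1 : diracOp (radialField w c) x = ∑ k, diracOp (fun x => c ‖x‖ k • w k x) x := by
    simp only [diracOp]
    rw [← Finset.smul_sum, Finset.sum_comm]
    congr 1
    refine Finset.sum_congr rfl fun j _ => ?_
    rw [← map_sum]
    congr 1
    have : fderiv ℝ (radialField w c) x = ∑ k, fderiv ℝ (fun x : Space => c ‖x‖ k • w k x) x :=
      fderiv_fun_sum fun k _ => hcw k
    rw [this]
    simp
  rw [h1]
  simp only [diracOp_radial_smul hx (hc _) (hwd _), ha _ x hx, hd _ x hx, radialField,
    Finset.sum_smul, Finset.smul_sum, smul_smul, add_smul, Finset.sum_add_distrib]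
  congr 1
  · rw [Finset.sum_comm]
    simp only [mul_assoc]
  · rw [Finset.sum_comm]

lemma D0_toH1_mem_angularSpace (hw : IsAngular w) {η : Space → Spinor} (hη : IsTest η) :
    D0 (hw.isTest_radialField_sphereCoeff hη).toH1 ∈ angularSpace w := by
  choose a ha using hw.radial
  choose d hd using hw.tangential
  have hne : ∀ᵐ x : Space, x ≠ 0 := by simp [ae_iff]
  refine ⟨fun r j => ∑ k, (sphereCoeff w η r k * (r⁻¹ : ℂ) * d k j +
    deriv (fun r => sphereCoeff w η r k) r * a k j), ?_,
    ((hw.isTest_radialField_sphereCoeff hη).D0_toH1_ae_eq).trans ?_⟩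
  rotate_left
  · filter_upwards [hne] with x hx
    exact hw.diracOp_radialField ha hd hx fun k =>
      (hw.contDiff_sphereCoeff hη.smooth k).differentiable (by simp) _
  · refine measurable_pi_lambda _ fun j => Finset.measurable_sum _ fun k _ => ?_
    have h1 : Measurable fun r => sphereCoeff w η r k :=
      (hw.contDiff_sphereCoeff hη.smooth k).continuous.measurable
    have h2 : Measurable fun r : ℝ => ((r : ℂ)⁻¹) := by fun_prop
    exact ((h1.mul h2).mul_const _).add ((measurable_deriv _).mul_const _)

variable [DecidableEq κ]

/-- Paired with a field of the angular space, a test function enters only through its spherical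
coefficients, and by orthonormality the resynthesized field has the same ones. -/
lemma inner_sphereCoeff (hw : IsAngular w) (hon : SphereOrthonormal w) {η : Space → Spinor}
    (hη : IsTest η) {f : L2} (hf : f ∈ angularSpace w) :
    inner ℂ f (hη.toH1 : L2) =
      inner ℂ f ((hw.isTest_radialField_sphereCoeff hη).toH1 : L2) := by
  obtain ⟨c, hc, hf⟩ := hf
  have hne : ∀ᵐ x : Space, x ≠ 0 := by simp [ae_iff]
  have key : ∀ (ξ : Space → Spinor) (hξ : IsTest ξ), inner ℂ f (hξ.toH1 : L2) =
      ∫ x : Space, ∑ k, (starRingEnd ℂ) (c ‖x‖ k) * sphereCoeff w ξ ‖x‖ k := by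
    intro ξ hξ
    have h1 : (fun x => inner ℂ (f x) ((hξ.toH1 : L2) x)) =ᵐ[volume]
        fun x => inner ℂ (radialField w c x) (ξ x) := by
      filter_upwards [hf, hξ.coeFn_toH1] with x h1 h2
      rw [h1, h2]
    rw [L2.inner_def, integral_congr_ae h1,
      integral_sphere_average ((L2.integrable_inner f (hξ.toH1 : L2)).congr h1)]
    refine integral_congr_ae ?_
    filter_upwards [hne] with x hx
    have hx0 : 0 < ‖x‖ := norm_pos_iff.mpr hx
    simp only [hw.radialField_smul c hx0, sum_inner, inner_smul_left]
    rw [integral_finsetSum]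
    · simp only [integral_const_mul, sphereCoeff]
    · intro k _
      refine Integrable.const_mul ?_ _
      refine Continuous.integrable_of_hasCompactSupport ?_ (HasCompactSupport.of_compactSpace _)
      exact (hw.continuous_sphere k).inner
        (hξ.smooth.continuous.comp (continuous_subtype_val.const_smul ‖x‖))
  rw [key η hη, key _ (hw.isTest_radialField_sphereCoeff hη)]
  refine integral_congr_ae ?_
  filter_upwards [hne] with x hx
  have hx0 : 0 < ‖x‖ := norm_pos_iff.mpr hx
  refine Finset.sum_congr rfl fun k _ => ?_
  congr 1
  -- With the left vector equal to the k-th unit vector, Parseval reads off the k-th coefficient.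
  have h2 := hw.integral_inner_sum hon (Pi.single k 1) (sphereCoeff w η ‖x‖)
  conv_rhs => rw [sphereCoeff]
  simp only [hw.radialField_smul _ hx0]
  simpa [Pi.single_apply, ite_smul] using h2.symm

lemma starProjection_toH1 (hw : IsAngular w) (hon : SphereOrthonormal w)
    [(angularSpace w).HasOrthogonalProjection] {η : Space → Spinor} (hη : IsTest η) :
    (angularSpace w).starProjection (hη.toH1 : L2) =
      ((hw.isTest_radialField_sphereCoeff hη).toH1 : L2) := by
  refine Submodule.eq_starProjection_of_mem_of_inner_eq_zero
    (hw.toH1_mem_angularSpace hη) fun f hf => ?_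
  rw [← inner_conj_symm, inner_sub_right, hw.inner_sphereCoeff hon hη hf, sub_self, map_zero]

/-- On test functions, the projection onto an angular space commutes with the Dirac operator. -/
lemma starProjection_D0_toH1 (hw : IsAngular w) (hon : SphereOrthonormal w)
    [(angularSpace w).HasOrthogonalProjection] {η : Space → Spinor} (hη : IsTest η) :
    (angularSpace w).starProjection (D0 hη.toH1) =
      D0 (hw.isTest_radialField_sphereCoeff hη).toH1 := by
  set P := (angularSpace w).starProjection with hP
  set u := (hw.isTest_radialField_sphereCoeff hη).toH1 with hu
  have hξ := hη.sub (hw.isTest_radialField_sphereCoeff hη)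
  have hsub : hξ.toH1 = hη.toH1 - u := by
    apply Subtype.ext
    refine Lp.ext ?_
    refine hξ.coeFn_toH1.trans ?_
    rw [Submodule.coe_sub]
    filter_upwards [Lp.coeFn_sub (hη.toH1 : L2) (u : L2), hη.coeFn_toH1,
      (hw.isTest_radialField_sphereCoeff hη).coeFn_toH1] with x h1 h2 h3
    rw [h1, Pi.sub_apply, h2, h3]
  -- Here ξ = η - Pη is orthogonal to the angular space. As D₀ξ is a test function, so is ζ = P D₀ξ,
  -- and symmetry gives ‖P D₀ξ‖² = ⟨ζ, D₀ξ⟩ = ⟨D₀ζ, ξ⟩ = 0, because D₀ζ lies in the angular space.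
  have h0 : P (D0 hξ.toH1) = 0 := by
    rw [← inner_self_eq_zero (𝕜 := ℂ)]
    have hζ := hw.isTest_radialField_sphereCoeff hξ.diracOp
    have e1 : P (D0 hξ.toH1) = hζ.toH1 := by
      rw [hξ.D0_toH1, hP, hw.starProjection_toH1 hon]
    have hmem : P (D0 hξ.toH1) ∈ angularSpace w := Submodule.starProjection_apply_mem _ _
    calc inner ℂ (P (D0 hξ.toH1)) (P (D0 hξ.toH1))
        = inner ℂ (P (D0 hξ.toH1)) (D0 hξ.toH1) := by
          conv_lhs => rw [hP, ← Submodule.inner_starProjection_left_eq_right]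
          rw [Submodule.starProjection_eq_self_iff.mpr hmem]
      _ = inner ℂ (hζ.toH1 : L2) (D0 hξ.toH1) := by rw [e1]
      _ = inner ℂ (D0 hζ.toH1) (hξ.toH1 : L2) := (D0_symmetric _ _).symm
      _ = 0 := by
        rw [hsub, Submodule.coe_sub, inner_sub_right,
          hw.inner_sphereCoeff hon hη (hw.D0_toH1_mem_angularSpace hξ.diracOp), sub_self]
  rw [hsub, map_sub, map_sub, sub_eq_zero] at h0
  rw [h0]
  exact Submodule.starProjection_eq_self_iff.mpr (hw.D0_toH1_mem_angularSpace hη)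

/-- By duality, ⟨D₀η, Pf⟩ = ⟨P D₀η, f⟩ = ⟨D₀Pη, f⟩ = ⟨Pη, D₀f⟩ = ⟨η, P D₀f⟩ for every test function
η. So Pf solves the weak equation with right-hand side P D₀f, and regularity puts it in H¹. -/
theorem starProjection_mem_H1_of_orthonormal (hw : IsAngular w) (hon : SphereOrthonormal w)
    [(angularSpace w).HasOrthogonalProjection] (f : H1) :
    ∃ h : (angularSpace w).starProjection (f : L2) ∈ H1,
      D0 ⟨_, h⟩ = (angularSpace w).starProjection (D0 f) := by
  refine mem_H1_of_inner_test fun η hη => ?_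
  rw [← Submodule.inner_starProjection_left_eq_right, ← Submodule.inner_starProjection_left_eq_right,
    hw.starProjection_D0_toH1 hon, hw.starProjection_toH1 hon, D0_symmetric]

end IsAngular

end

/-! ### Orthonormalization and the projection for general angular families -/

section

variable {κ ι : Type} [Fintype κ] [Fintype ι]

lemma angularSpace_le {b : κ → Space → Spinor} {w : ι → Space → Spinor} (s : κ → ι → ℂ)
    (h : ∀ k, ∀ x ≠ 0, b k x = ∑ i, s k i • w i x) : angularSpace b ≤ angularSpace w := by
  rintro f ⟨c, hc, hf⟩
  refine ⟨fun r i => ∑ k, c r k * s k i, ?_, ?_⟩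
  · exact measurable_pi_lambda _ fun i => Finset.measurable_sum _ fun k _ =>
      ((measurable_pi_apply k).comp hc).mul_const _
  · have hne : ∀ᵐ x : Space, x ≠ 0 := by simp [ae_iff]
    filter_upwards [hf, hne] with x hx h0
    rw [hx]
    simp only [radialField, h _ x h0, Finset.sum_smul, Finset.smul_sum, smul_smul]
    rw [Finset.sum_comm]

lemma alphaR_sum (x : Space) (a : κ → ℂ) (z : κ → Spinor) :
    alphaR x (∑ k, a k • z k) = ∑ k, a k • alphaR x (z k) := by
  simp only [alphaR, map_sum, map_smul, Finset.smul_sum, smul_smul]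
  rw [Finset.sum_comm]
  exact Finset.sum_congr rfl fun k _ => Finset.sum_congr rfl fun j _ => by
    congr 1
    ring

namespace IsAngular

/-- Constant combinations keep smoothness and homogeneity; stability survives because the images,
computed in terms of b, can be rewritten through s in the new family. -/
lemma of_equivalent {b : κ → Space → Spinor} (hb : IsAngular b) (t : ι → κ → ℂ) (s : κ → ι → ℂ)
    (hs : ∀ k, ∀ x ≠ 0, b k x = ∑ i, s k i • radialField b (fun _ => t i) x) :
    IsAngular fun i => radialField b fun _ => t i := by
  have hex : ∀ (a : κ → ℂ), ∀ x ≠ 0, ∑ k, a k • b k x =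
      ∑ i, (∑ k, a k * s k i) • radialField b (fun _ => t i) x := by
    intro a x hx
    rw [Finset.sum_congr rfl fun k _ => by rw [hs k x hx]]
    simp only [Finset.sum_smul, Finset.smul_sum, smul_smul]
    rw [Finset.sum_comm]
  choose a ha using hb.radial
  choose d hd using hb.tangential
  refine ⟨fun i => ?_, fun i x r hr => ?_, fun i => ?_, fun i => ?_⟩
  · exact ContDiffOn.sum fun k _ => (hb.smooth k).const_smul (t i k)
  · simp only [radialField, hb.homog _ x r hr]
  · refine ⟨fun l => ∑ k, (∑ j, t i j * a j k) * s k l, fun x hx => ?_⟩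
    rw [← hex _ x hx, radialField, alphaR_sum]
    simp only [ha _ x hx, Finset.sum_smul, Finset.smul_sum, smul_smul]
    rw [Finset.sum_comm]
  · refine ⟨fun l => ∑ k, (∑ j, t i j * d j k) * s k l, fun x hx => ?_⟩
    rw [← hex _ x hx, hb.diracOp_radialField ha hd hx fun k => by fun_prop]
    simp only [radialField, deriv_const, zero_mul, add_zero, Finset.smul_sum, smul_smul,
      Finset.mul_sum]
    refine Finset.sum_congr rfl fun j _ => ?_
    congr 1
    refine Finset.sum_congr rfl fun k _ => ?_
    ring

/-- An orthonormal basis is chosen in the span of the restrictions inside L² of the sphere. The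
family may be linearly dependent (for ℓ = 0 the field Σh vanishes), so the new one can be shorter.
-/
theorem exists_orthonormal {b : κ → Space → Spinor} (hb : IsAngular b) :
    ∃ (n : ℕ) (w : Fin n → Space → Spinor), IsAngular w ∧ SphereOrthonormal w ∧
      angularSpace w = angularSpace b := by
  have hmem : ∀ k, MemLp (fun n : Sphere => b k n) 2 sphereMeasure := fun k =>
    (hb.continuous_sphere k).memLp_of_hasCompactSupport (HasCompactSupport.of_compactSpace _)
  let β : κ → Lp Spinor 2 sphereMeasure := fun k => (hmem k).toLp
  let V : Submodule ℂ (Lp Spinor 2 sphereMeasure) := Submodule.span ℂ (Set.range β)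
  have hfin : FiniteDimensional ℂ V := FiniteDimensional.span_of_finite ℂ (Set.finite_range β)
  let o := stdOrthonormalBasis ℂ V
  have hβV : ∀ k, β k ∈ V := fun k => Submodule.subset_span ⟨k, rfl⟩
  have hex : ∀ i, ∃ t : κ → ℂ, ∑ k, t k • β k = (o i : Lp Spinor 2 sphereMeasure) := fun i =>
    (Submodule.mem_span_range_iff_exists_fun ℂ).mp (o i).2
  choose t ht using hex
  let w : Fin (Module.finrank ℂ V) → Space → Spinor := fun i => radialField b fun _ => t i
  have coeFn_sum : ∀ (a : κ → ℂ), (∑ k, a k • β k : Lp Spinor 2 sphereMeasure) =ᵐ[sphereMeasure]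
      fun n => radialField b (fun _ => a) n := by
    intro a
    have h : ∀ F : Finset κ, (∑ k ∈ F, a k • β k : Lp Spinor 2 sphereMeasure) =ᵐ[sphereMeasure]
        fun n => ∑ k ∈ F, a k • b k n := by
      classical
      intro F
      induction F using Finset.induction_on with
      | empty =>
        filter_upwards with n
        simp
      | insert k F hk ih =>
        rw [Finset.sum_insert hk]
        filter_upwards [Lp.coeFn_add (a k • β k) (∑ k ∈ F, a k • β k), Lp.coeFn_smul (a k) (β k),
          (hmem k).coeFn_toLp, ih] with n h1 h2 h3 h4
        rw [h1, Pi.add_apply, h2, Pi.smul_apply, h3, h4, Finset.sum_insert hk]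
    exact h Finset.univ
  have hwo : ∀ i, (o i : Lp Spinor 2 sphereMeasure) =ᵐ[sphereMeasure] fun n => w i n := fun i => by
    rw [← ht i]
    exact coeFn_sum (t i)
  let s : κ → Fin (Module.finrank ℂ V) → ℂ := fun k i => o.repr ⟨β k, hβV k⟩ i
  have hwcont : ∀ i, Continuous fun n : Sphere => w i n := fun i =>
    continuous_finsetSum _ fun k _ => (hb.continuous_sphere k).const_smul (t i k)
  have hs0 : ∀ k, (fun n : Sphere => b k n) = fun n : Sphere => ∑ i, s k i • w i n := by
    intro k
    have hc : Continuous fun n : Sphere => ∑ i, s k i • w i n :=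
      continuous_finsetSum _ fun i _ => (hwcont i).const_smul (s k i)
    -- The expansion holds in L² of the sphere; continuity makes it pointwise.
    refine (Continuous.ae_eq_iff_eq sphereMeasure (hb.continuous_sphere k) hc).mp ?_
    have h1 : β k = ∑ i, s k i • (o i : Lp Spinor 2 sphereMeasure) := by
      have := congrArg Subtype.val (o.sum_repr ⟨β k, hβV k⟩)
      simpa using this.symm
    have h2 : β k = ∑ l, (∑ i, s k i * t i l) • β l := by
      rw [h1]
      simp only [← ht, Finset.smul_sum, Finset.sum_smul, smul_smul]
      rw [Finset.sum_comm]
    have h3 := coeFn_sum fun l => ∑ i, s k i * t i l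
    rw [← h2] at h3
    filter_upwards [(hmem k).coeFn_toLp, h3] with n h4 h5
    rw [← h4, show (MemLp.toLp _ (hmem k)) = β k from rfl, h5]
    simp only [w, radialField, Finset.smul_sum, Finset.sum_smul, smul_smul]
    rw [Finset.sum_comm]
  have hs : ∀ k, ∀ x ≠ 0, b k x = ∑ i, s k i • w i x := by
    intro k x hx
    have hx0 : 0 < ‖x‖ := norm_pos_iff.mpr hx
    -- Homogeneity of degree zero carries the identity from the sphere to all x ≠ 0.
    let n : Sphere := ⟨‖x‖⁻¹ • x, by simp [norm_smul, hx0.ne']⟩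
    have hn : b k n = ∑ i, s k i • w i n := congrFun (hs0 k) n
    have hb' : ∀ l, b l (n : Space) = b l x := fun l => hb.homog l x _ (inv_pos.mpr hx0)
    rw [← hb' k, hn]
    simp only [w, radialField, hb']
  refine ⟨_, w, hb.of_equivalent t s hs, fun i j => ?_, le_antisymm (angularSpace_le t fun i x _ => rfl)
    (angularSpace_le s hs)⟩
  have h1 := orthonormal_iff_ite.mp o.orthonormal i j
  rw [← h1, Submodule.coe_inner, L2.inner_def]
  refine integral_congr_ae ?_
  filter_upwards [hwo i, hwo j] with n h1 h2
  rw [h1, h2]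

theorem isClosed {b : κ → Space → Spinor} (hb : IsAngular b) :
    IsClosed (angularSpace b : Set L2) := by
  obtain ⟨n, w, hw, hon, heq⟩ := hb.exists_orthonormal
  rw [← heq]
  exact hw.isClosed_of_orthonormal hon

lemma hasOrthogonalProjection {b : κ → Space → Spinor} (hb : IsAngular b) :
    (angularSpace b).HasOrthogonalProjection :=
  have := hb.isClosed.completeSpace_coe
  inferInstance

/-- The projection onto an angular space commutes with the Dirac operator. -/
theorem starProjection_mem_H1 {b : κ → Space → Spinor} (hb : IsAngular b)
    [inst : (angularSpace b).HasOrthogonalProjection] (f : H1) :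
    ∃ h : (angularSpace b).starProjection (f : L2) ∈ H1,
      D0 ⟨_, h⟩ = (angularSpace b).starProjection (D0 f) := by
  obtain ⟨n, w, hw, hon, heq⟩ := hb.exists_orthonormal
  revert inst
  rw [← heq]
  intro inst
  exact hw.starProjection_mem_H1_of_orthonormal hon f

/-- For f = Pf the commutation relation reads D₀f = P D₀f, and no regularity of the coefficients is
needed. -/
theorem D0_mem {b : κ → Space → Spinor} (hb : IsAngular b) (f : H1)
    (hf : (f : L2) ∈ angularSpace b) : D0 f ∈ angularSpace b := by
  have := hb.hasOrthogonalProjection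
  obtain ⟨h, h'⟩ := hb.starProjection_mem_H1 f
  have h1 : (⟨_, h⟩ : H1) = f := Subtype.ext (Submodule.starProjection_eq_self_iff.mpr hf)
  rw [h1] at h'
  rw [h']
  exact Submodule.starProjection_apply_mem _ _

end IsAngular

end

/-! ### Legendre equation and spherical harmonics as functions on space -/

section

open Polynomial in
-- The function y = (w² - 1)^ℓ satisfies the first-order equation (w² - 1)y' = 2ℓwy; the relation is
-- its (n+1)-st derivative.
lemma legendre_ode_aux (ℓ n : ℕ) :
    (Polynomial.X ^ 2 - 1 : ℝ[X]) * derivative^[n + 2] ((Polynomial.X ^ 2 - 1) ^ ℓ) +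
      C (2 * ((n : ℝ) + 1 - ℓ)) * Polynomial.X * derivative^[n + 1] ((Polynomial.X ^ 2 - 1) ^ ℓ) +
      C (((n : ℝ) + 1) * (n - 2 * ℓ)) * derivative^[n] ((Polynomial.X ^ 2 - 1) ^ ℓ) = 0 := by
  have hs : ∀ (k : ℕ) (p : ℝ[X]), derivative (derivative^[k] p) = derivative^[k + 1] p :=
    fun k p => (Function.iterate_succ_apply' _ _ _).symm
  have h2' : (C 2 : ℝ[X]) = 2 := map_ofNat C 2
  induction n with
  | zero =>
    have h1 : (Polynomial.X ^ 2 - 1 : ℝ[X]) * derivative ((Polynomial.X ^ 2 - 1 : ℝ[X]) ^ ℓ) =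
        C (2 * (ℓ : ℝ)) * Polynomial.X * (Polynomial.X ^ 2 - 1) ^ ℓ := by
      rcases ℓ with _ | ℓ
      · simp
      · rw [derivative_pow]
        simp [h2']
        ring
    have h2 := congrArg derivative h1
    simp only [derivative_mul, derivative_sub, derivative_X_pow, derivative_one, derivative_C,
      derivative_X] at h2
    simp only [Function.iterate_succ_apply', Function.iterate_zero_apply, zero_add,
      Nat.cast_zero]
    simp only [map_mul, map_sub, C_1, C_ofNat, zero_sub, Nat.cast_ofNat] at h2 ⊢
    simp [h2'] at h2 ⊢
    linear_combination h2
  | succ n ih =>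
    have h2 := congrArg derivative ih
    simp only [derivative_mul, derivative_sub, derivative_X_pow, derivative_one, derivative_C,
      derivative_X, derivative_add, hs, derivative_zero] at h2
    simp only [map_mul, map_sub, map_add, C_1, C_ofNat, Nat.cast_ofNat, map_natCast] at h2 ⊢
    simp at h2 ⊢
    linear_combination h2

open Polynomial in
/-- The associated Legendre equation for `Q = (d/dw)^m P_ℓ`. -/
lemma legendre_ode (ℓ m : ℕ) (t : ℝ) :
    (1 - t ^ 2) * (derivative (derivative (derivative^[m] (legendre ℓ)))).eval t -
      2 * (m + 1) * t * (derivative (derivative^[m] (legendre ℓ))).eval t -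
      m * (m + 1) * (derivative^[m] (legendre ℓ)).eval t =
    -(ℓ * (ℓ + 1)) * (derivative^[m] (legendre ℓ)).eval t := by
  -- With n = ℓ + m, by Rodrigues, the coefficients become 2(m+1) and (ℓ+m+1)(m-ℓ) = m(m+1) -
  -- ℓ(ℓ+1).
  have h := congrArg (Polynomial.eval t) (legendre_ode_aux ℓ (ℓ + m))
  have hq : ∀ k, derivative^[k] (legendre ℓ) =
      C ((2 ^ ℓ * (ℓ.factorial : ℝ))⁻¹) * derivative^[ℓ + k] ((Polynomial.X ^ 2 - 1) ^ ℓ) := by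
    intro k
    rw [legendre, iterate_derivative_C_mul, ← Function.iterate_add_apply, add_comm]
  rw [← Function.iterate_succ_apply' derivative, ← Function.iterate_succ_apply' derivative, hq, hq,
    hq]
  simp only [eval_add, eval_mul, eval_sub, eval_pow, eval_X, eval_one, eval_C, eval_zero] at h ⊢
  push_cast at h
  simp only [Nat.succ_eq_add_one, ← add_assoc] at h ⊢
  linear_combination (-((2 ^ ℓ * (ℓ.factorial : ℝ))⁻¹)) * h

lemma derivative_iterate_legendre_self (ℓ : ℕ) :
    Polynomial.derivative (Polynomial.derivative^[ℓ] (legendre ℓ)) = 0 := by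
  rw [← Function.iterate_succ_apply' Polynomial.derivative]
  refine Polynomial.iterate_derivative_eq_zero ?_
  refine Nat.lt_succ_of_le ?_
  rw [legendre]
  refine (Polynomial.natDegree_C_mul_le _ _).trans
    ((Polynomial.natDegree_iterate_derivative _ _).trans ?_)
  have h : ((Polynomial.X ^ 2 - 1 : Polynomial ℝ) ^ ℓ).natDegree ≤ ℓ * 2 :=
    Polynomial.natDegree_pow_le.trans (Nat.mul_le_mul_left _ (by compute_degree))
  omega

/-- The functions `(x₁ + iεx₂)^a |x|^{-n} p(x₃ / |x|)`. -/
def axial (ε : ℝ) (a n : ℕ) (p : Polynomial ℝ) (x : Space) : ℂ :=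
  ((x 0 : ℂ) + ε * I * (x 1 : ℂ)) ^ a * ((‖x‖⁻¹ : ℝ) : ℂ) ^ n * ((p.eval (x 2 * ‖x‖⁻¹) : ℝ) : ℂ)

lemma contDiff_coord (i : Fin 3) : ContDiff ℝ (⊤ : ℕ∞) fun x : Space => x i :=
  (EuclideanSpace.proj (𝕜 := ℝ) i).contDiff

lemma contDiffOn_inv_norm : ContDiffOn ℝ (⊤ : ℕ∞) (fun x : Space => ‖x‖⁻¹) {0}ᶜ :=
  norm_contDiffOn.inv fun _ hx => norm_ne_zero_iff.mpr hx

lemma contDiffOn_axial (ε : ℝ) (a n : ℕ) (p : Polynomial ℝ) :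
    ContDiffOn ℝ (⊤ : ℕ∞) (axial ε a n p) {0}ᶜ := by
  have hc : ∀ i : Fin 3, ContDiffOn ℝ (⊤ : ℕ∞) (fun x : Space => (x i : ℂ)) {0}ᶜ := fun i =>
    (Complex.ofRealCLM.contDiff.comp (contDiff_coord i)).contDiffOn
  have hp : ContDiff ℝ (⊤ : ℕ∞) fun t : ℝ => ((p.eval t : ℝ) : ℂ) :=
    Complex.ofRealCLM.contDiff.comp (by simpa using p.contDiff_aeval (𝕜 := ℝ) (⊤ : ℕ∞))
  refine (((hc 0).add (contDiffOn_const.mul (hc 1))).pow a).mul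
    ((Complex.ofRealCLM.contDiff.comp_contDiffOn contDiffOn_inv_norm).pow n) |>.mul
    (hp.comp_contDiffOn ((contDiff_coord 2).contDiffOn.mul contDiffOn_inv_norm))

lemma differentiableAt_axial (ε : ℝ) (a n : ℕ) (p : Polynomial ℝ) {x : Space} (hx : x ≠ 0) :
    DifferentiableAt ℝ (axial ε a n p) x :=
  ((contDiffOn_axial ε a n p).contDiffAt (isOpen_compl_singleton.mem_nhds hx)).differentiableAt
    (by simp)

/-- Partial derivatives become one-variable derivatives along a line, where product and chain rules
are computed directly. -/
lemma hasDerivAt_line {E : Type*} [NormedAddCommGroup E] [NormedSpace ℝ E] {F : Space → E}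
    {x : Space} (hF : DifferentiableAt ℝ F x) (v : Space) :
    HasDerivAt (fun s : ℝ => F (x + s • v)) (fderiv ℝ F x v) 0 := by
  have h1 : HasDerivAt (fun s : ℝ => x + s • v) v 0 := by
    simpa using ((hasDerivAt_id (0 : ℝ)).smul_const v).const_add x
  have h2 : HasFDerivAt F (fderiv ℝ F x) (x + (0 : ℝ) • v) := by simpa using hF.hasFDerivAt
  exact h2.comp_hasDerivAt (0 : ℝ) h1

/-- The vector `(1, iε, 0)`. -/
def axialDir (ε : ℝ) : Fin 3 → ℂ := ![1, ε * I, 0]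

/-- The three terms come from x₃, from the power of x₁ + iεx₂, and from |x|, which occurs both as a
power and inside p. The class of functions `axial` is thus stable under differentiation up to
coordinate factors. At a = 0 the truncated exponent a - 1 is harmless, being multiplied by a. -/
lemma fderiv_axial (ε : ℝ) (a n : ℕ) (p : Polynomial ℝ) {x : Space} (hx : x ≠ 0) (j : Fin 3) :
    fderiv ℝ (axial ε a n p) x (basisVec j) =
      (if j = 2 then 1 else 0) * axial ε a (n + 1) (Polynomial.derivative p) x +
      axialDir ε j * (a * axial ε (a - 1) n p x) -
      x j * axial ε a (n + 2) (Polynomial.X * Polynomial.derivative p + Polynomial.C (n : ℝ) * p)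
        x := by
  have hx0 : ‖x‖ ≠ 0 := norm_ne_zero_iff.mpr hx
  refine (hasDerivAt_line (differentiableAt_axial ε a n p hx) (basisVec j)).unique ?_
  have hcoord : ∀ i : Fin 3, HasDerivAt (fun s : ℝ => (x + s • basisVec j) i)
      (if j = i then 1 else 0) 0 := by
    intro i
    refine (hasDerivAt_line (F := fun x : Space => x i) (x := x)
      ((contDiff_coord i).differentiable (by simp) x) (basisVec j)).congr_deriv ?_
    have h2 : fderiv ℝ (fun x : Space => x i) x = EuclideanSpace.proj (𝕜 := ℝ) i :=
      (EuclideanSpace.proj (𝕜 := ℝ) i).fderiv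
    rw [h2]
    simp [eq_comm]
  have hnorm : HasDerivAt (fun s : ℝ => ‖x + s • basisVec j‖⁻¹) (-(x j * ‖x‖⁻¹ ^ 3)) 0 := by
    have h1 := hasDerivAt_line (hasFDerivAt_norm_space hx).differentiableAt (basisVec j)
    refine (h1.inv (by simpa using hx0)).congr_deriv ?_
    rw [(hasFDerivAt_norm_space hx).fderiv]
    simp [EuclideanSpace.inner_single_right]
    field_simp
  have hz : HasDerivAt (fun s : ℝ => (((x + s • basisVec j) 0 : ℝ) : ℂ) +
      ε * I * (((x + s • basisVec j) 1 : ℝ) : ℂ)) (axialDir ε j) 0 := by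
    refine ((hcoord 0).ofReal_comp.add
      ((hcoord 1).ofReal_comp.const_mul (ε * I))).congr_deriv ?_
    fin_cases j <;> simp [axialDir]
  have ht : HasDerivAt (fun s : ℝ => (x + s • basisVec j) 2 * ‖x + s • basisVec j‖⁻¹) _ 0 :=
    (hcoord 2).mul hnorm
  have hp : HasDerivAt (fun s : ℝ => ((p.eval ((x + s • basisVec j) 2 * ‖x + s • basisVec j‖⁻¹) :
      ℝ) : ℂ)) _ 0 := ((p.hasDerivAt _).comp (0 : ℝ) ht).ofReal_comp
  have hn : HasDerivAt (fun s : ℝ => ((‖x + s • basisVec j‖⁻¹ : ℝ) : ℂ) ^ n) _ 0 :=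
    hnorm.ofReal_comp.pow n
  have h : HasDerivAt (fun s : ℝ => axial ε a n p (x + s • basisVec j)) _ 0 :=
    ((hz.pow a).mul hn).mul hp
  refine h.congr_deriv ?_
  simp only [axial]
  simp only [zero_smul, add_zero, Polynomial.eval_add, Polynomial.eval_mul, Polynomial.eval_X,
    Polynomial.eval_C]
  rcases n with _ | n
  · simp
    split_ifs <;> simp <;> ring
  · simp
    split_ifs <;> simp <;> ring


lemma sum_coord_mul_axialDir (ε : ℝ) (x : Space) :
    ∑ j, (x j : ℂ) * axialDir ε j = (x 0 : ℂ) + ε * I * (x 1 : ℂ) := by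
  simp [Fin.sum_univ_three, axialDir]
  ring

lemma sum_coord_sq (x : Space) : ∑ j, (x j : ℂ) * x j = (‖x‖ : ℂ) ^ 2 := by
  have h := EuclideanSpace.norm_sq_eq x
  rw [← Complex.ofReal_pow, h]
  simp only [Real.norm_eq_abs, sq_abs]
  push_cast
  simp [sq]

lemma axial_succ_mul (ε : ℝ) (a n : ℕ) (p : Polynomial ℝ) (x : Space) :
    a * (((x 0 : ℂ) + ε * I * (x 1 : ℂ)) * axial ε (a - 1) n p x) = a * axial ε a n p x := by
  rcases a with _ | a
  · simp
  · simp only [axial, Nat.add_sub_cancel]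
    ring

/-- Euler's identity: the function is homogeneous of degree a - n. -/
lemma axial_euler (ε : ℝ) (a n : ℕ) (p : Polynomial ℝ) {x : Space} (hx : x ≠ 0) :
    ∑ j, (x j : ℂ) * fderiv ℝ (axial ε a n p) x (basisVec j) = (a - n) * axial ε a n p x := by
  have hx0 : (‖x‖ : ℂ) ≠ 0 := by exact_mod_cast norm_ne_zero_iff.mpr hx
  simp only [fderiv_axial ε a n p hx, mul_sub, mul_add, Finset.sum_sub_distrib,
    Finset.sum_add_distrib, ← mul_assoc, ← Finset.sum_mul, sum_coord_mul_axialDir, sum_coord_sq]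
  have h1 := axial_succ_mul ε a n p x
  have h2 : ∑ j, (x j : ℂ) * (if j = 2 then 1 else 0) = x 2 := by simp
  rw [h2]
  have h3 : (‖x‖ : ℂ) ^ 2 * axial ε a (n + 2) (Polynomial.X * Polynomial.derivative p +
      Polynomial.C (n : ℝ) * p) x =
      x 2 * axial ε a (n + 1) (Polynomial.derivative p) x + n * axial ε a n p x := by
    simp [axial]
    field_simp
    ring
  rw [h3]
  linear_combination h1

/-- For ε = ±1 the vector (1, iε, 0) is null; this is why powers of x₁ + iεx₂ are harmonic. -/
lemma axialDir_isotropic {ε : ℝ} (hε : ε ^ 2 = 1) : ∑ j, axialDir ε j * axialDir ε j = 0 := by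
  have h : (ε : ℂ) ^ 2 = 1 := by exact_mod_cast hε
  simp [Fin.sum_univ_three, axialDir]
  linear_combination (-1 : ℂ) * h + (ε : ℂ) ^ 2 * I_sq

/-- The null direction annihilates x₃ and the power of x₁ + iεx₂, so only the dependence on |x|
contributes. -/
lemma axialDir_derivative {ε : ℝ} (hε : ε ^ 2 = 1) (a n : ℕ) (p : Polynomial ℝ) {x : Space}
    (hx : x ≠ 0) :
    ∑ j, axialDir ε j * fderiv ℝ (axial ε a n p) x (basisVec j) =
      -axial ε (a + 1) (n + 2) (Polynomial.X * Polynomial.derivative p +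
        Polynomial.C (n : ℝ) * p) x := by
  simp only [fderiv_axial ε a n p hx, mul_sub, mul_add, Finset.sum_sub_distrib,
    Finset.sum_add_distrib, ← mul_assoc, ← Finset.sum_mul, axialDir_isotropic hε]
  have h2 : ∑ j, axialDir ε j * (if j = 2 then 1 else 0) = 0 := by simp [axialDir]
  simp only [mul_comm (axialDir ε _) (x.ofLp _ : ℂ), sum_coord_mul_axialDir, h2]
  simp [axial]
  ring

/-- The functions `axial ε m m Q` with `Q = (d/dw)^m P_ℓ` are eigenfunctions of the angular
Laplacian. -/
lemma laplacian_axial {ε : ℝ} (hε : ε ^ 2 = 1) (ℓ m : ℕ) {x : Space} (hx : x ≠ 0) :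
    ∑ j, fderiv ℝ (fun y => fderiv ℝ (axial ε m m (Polynomial.derivative^[m] (legendre ℓ))) y
      (basisVec j)) x (basisVec j) =
    -(ℓ * (ℓ + 1) : ℂ) * ((‖x‖⁻¹ : ℝ) : ℂ) ^ 2 *
      axial ε m m (Polynomial.derivative^[m] (legendre ℓ)) x := by
  -- A, C and B are the functions in the three terms of the gradient given by `fderiv_axial`; the
  -- second derivatives are then handled by the third coordinate, by isotropy and by Euler's
  -- identity respectively.
  set Q := Polynomial.derivative^[m] (legendre ℓ) with hQ
  set A := axial ε m (m + 1) (Polynomial.derivative Q)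
  set C := axial ε (m - 1) m Q
  set B := axial ε m (m + 2) (Polynomial.X * Polynomial.derivative Q + Polynomial.C (m : ℝ) * Q)
    with hB
  have hA' : DifferentiableAt ℝ A x := differentiableAt_axial _ _ _ _ hx
  have hC' : DifferentiableAt ℝ C x := differentiableAt_axial _ _ _ _ hx
  have hB' : DifferentiableAt ℝ B x := differentiableAt_axial _ _ _ _ hx
  have hj : ∀ j, fderiv ℝ (fun y => fderiv ℝ (axial ε m m Q) y (basisVec j)) x (basisVec j) =
      (if j = 2 then 1 else 0) * fderiv ℝ A x (basisVec j) +
      m * (axialDir ε j * fderiv ℝ C x (basisVec j)) -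
      (B x + x j * fderiv ℝ B x (basisVec j)) := by
    intro j
    have heq : (fun y => fderiv ℝ (axial ε m m Q) y (basisVec j)) =ᶠ[nhds x] fun y =>
        (if j = 2 then 1 else 0) * A y + axialDir ε j * (m * C y) - y j * B y := by
      filter_upwards [isOpen_compl_singleton.mem_nhds hx] with y hy
      exact fderiv_axial ε m m Q hy j
    rw [heq.fderiv_eq]
    have hcoord : HasDerivAt (fun s : ℝ => (((x + s • basisVec j) j : ℝ) : ℂ)) ((1 : ℝ) : ℂ) 0 := by
      refine HasDerivAt.ofReal_comp ?_
      simpa using (hasDerivAt_id (0 : ℝ)).const_add (x j)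
    have hdx : DifferentiableAt ℝ (fun y : Space => (y j : ℂ)) x :=
      (Complex.ofRealCLM.contDiff.comp (contDiff_coord j)).differentiable
        (n := ((⊤ : ℕ∞) : WithTop ℕ∞)) (by simp) x
    have hF : DifferentiableAt ℝ (fun y => (if j = 2 then 1 else 0) * A y +
        axialDir ε j * (m * C y) - y j * B y) x :=
      ((hA'.const_mul _).add ((hC'.const_mul _).const_mul _)).sub (hdx.mul hB')
    refine (hasDerivAt_line hF (basisVec j)).unique ?_
    have h : HasDerivAt (fun s : ℝ => (if j = 2 then 1 else 0) * A (x + s • basisVec j) +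
        axialDir ε j * (m * C (x + s • basisVec j)) -
        (((x + s • basisVec j) j : ℝ) : ℂ) * B (x + s • basisVec j)) _ 0 :=
      (((hasDerivAt_line hA' (basisVec j)).const_mul _).add
        (((hasDerivAt_line hC' (basisVec j)).const_mul _).const_mul _)).sub
        (hcoord.mul (hasDerivAt_line hB' (basisVec j)))
    refine h.congr_deriv ?_
    simp
    ring
  simp only [hj, Finset.sum_sub_distrib, Finset.sum_add_distrib, ← Finset.mul_sum]
  have e1 : ∑ j, axialDir ε j * fderiv ℝ C x (basisVec j) = _ :=
    axialDir_derivative hε (m - 1) m Q hx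
  have e2 : ∑ j, (x j : ℂ) * fderiv ℝ B x (basisVec j) = _ := axial_euler ε m (m + 2) _ hx
  have e3 : ∑ j, (if j = 2 then 1 else 0) * fderiv ℝ A x (basisVec j) =
    fderiv ℝ A x (basisVec 2) := by simp
  have e4 : fderiv ℝ A x (basisVec 2) = _ := fderiv_axial ε m (m + 1) _ hx 2
  have e5 : (m : ℂ) * axial ε (m - 1 + 1) (m + 2)
      (Polynomial.X * Polynomial.derivative Q + Polynomial.C (m : ℝ) * Q) x = m * B x := by
    rcases m with _ | m
    · simp
    · simp [hB]
  rw [e1, e2, e3, e4, mul_neg, e5]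
  -- What remains is the associated Legendre equation at w = x₃/|x|, times a common factor.
  have hode := congrArg (fun t : ℝ => (t : ℂ)) (legendre_ode ℓ m (x 2 * ‖x‖⁻¹))
  rw [← hQ] at hode
  simp [hB, axial, axialDir] at hode ⊢
  linear_combination ((x 0 : ℂ) + ε * I * x 1) ^ m * (‖x‖ : ℂ)⁻¹ ^ (m + 2) * hode

/-- Rotations about the third axis act only on (x₁ + iεx₂)^a. -/
lemma axial_rotation {ε : ℝ} (hε : ε ^ 2 = 1) (a n : ℕ) (p : Polynomial ℝ) {x : Space}
    (hx : x ≠ 0) :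
    (x 0 : ℂ) * fderiv ℝ (axial ε a n p) x (basisVec 1) -
      x 1 * fderiv ℝ (axial ε a n p) x (basisVec 0) = I * (ε * a) * axial ε a n p x := by
  have h := axial_succ_mul ε a n p x
  have h1 : (ε : ℂ) ^ 2 = 1 := by exact_mod_cast hε
  rw [fderiv_axial ε a n p hx, fderiv_axial ε a n p hx]
  simp [axialDir]
  linear_combination (I * ε) * h - (x 1 * (a * axial ε (a - 1) n p x)) * (ε ^ 2 * I_sq - h1)

lemma axial_smul (ε : ℝ) (a : ℕ) (p : Polynomial ℝ) (x : Space) {r : ℝ} (hr : 0 < r) :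
    axial ε a a p (r • x) = axial ε a a p x := by
  have hr' : (r : ℂ) ≠ 0 := by exact_mod_cast hr.ne'
  have h2 : r * x 2 * (‖x‖⁻¹ * r⁻¹) = x 2 * ‖x‖⁻¹ := by field_simp
  simp only [axial, norm_smul, Real.norm_eq_abs, abs_of_pos hr, PiLp.smul_apply, smul_eq_mul,
    mul_inv_rev, h2, ← mul_pow]
  congr 2
  push_cast
  field_simp

lemma exists_harmonic_nat (ℓ m : ℕ) : ∃ c : ℂ, harmonic ℓ m =
    fun x => c * axial 1 m m (Polynomial.derivative^[m] (legendre ℓ)) x := by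
  refine ⟨((√((2 * ℓ + 1) / (4 * Real.pi) * ((ℓ - m).factorial / (ℓ + m).factorial)) : ℝ) : ℂ),
    funext fun x => ?_⟩
  simp only [harmonic, harmonicNat, axial, Int.natCast_nonneg, if_true, Int.natAbs_natCast]
  simp [div_eq_mul_inv, mul_pow, mul_assoc]

lemma exists_harmonic_neg (ℓ m : ℕ) : ∃ c : ℂ, harmonic ℓ (-m) =
    fun x => c * axial (-1) m m (Polynomial.derivative^[m] (legendre ℓ)) x := by
  rcases m with _ | m
  · obtain ⟨c, hc⟩ := exists_harmonic_nat ℓ 0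
    refine ⟨c, ?_⟩
    simpa [axial] using hc
  · refine ⟨((√((2 * ℓ + 1) / (4 * Real.pi) *
      ((ℓ - (m + 1)).factorial / (ℓ + (m + 1)).factorial)) : ℝ) : ℂ), funext fun x => ?_⟩
    have h : ¬ (0 : ℤ) ≤ -((m + 1 : ℕ) : ℤ) := by omega
    simp only [harmonic, harmonicNat, axial, if_neg h, Int.natAbs_neg, Int.natAbs_natCast]
    simp [div_eq_mul_inv, mul_pow, mul_assoc]

/-- The sign of the order is stored in ε, so both signs of k are treated by the same computations on
`axial`. -/
lemma exists_harmonic (ℓ : ℕ) (k : ℤ) : ∃ (c : ℂ) (ε : ℝ) (m : ℕ), ε ^ 2 = 1 ∧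
    (ε * m : ℂ) = k ∧ harmonic ℓ k =
      fun x => c * axial ε m m (Polynomial.derivative^[m] (legendre ℓ)) x := by
  obtain ⟨m, rfl | rfl⟩ := k.eq_nat_or_neg
  · obtain ⟨c, hc⟩ := exists_harmonic_nat ℓ m
    exact ⟨c, 1, m, by simp, by simp, hc⟩
  · obtain ⟨c, hc⟩ := exists_harmonic_neg ℓ m
    exact ⟨c, -1, m, by simp, by simp, hc⟩

lemma contDiffOn_harmonic (ℓ : ℕ) (k : ℤ) : ContDiffOn ℝ (⊤ : ℕ∞) (harmonic ℓ k) {0}ᶜ := by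
  obtain ⟨c, ε, m, -, -, h⟩ := exists_harmonic ℓ k
  rw [h]
  exact contDiffOn_const.mul (contDiffOn_axial ε m m _)

lemma harmonic_smul (ℓ : ℕ) (k : ℤ) (x : Space) {r : ℝ} (hr : 0 < r) :
    harmonic ℓ k (r • x) = harmonic ℓ k x := by
  obtain ⟨c, ε, m, -, -, h⟩ := exists_harmonic ℓ k
  simp only [h, axial_smul ε m _ x hr]

lemma star_harmonic (ℓ : ℕ) (k : ℤ) (x : Space) : star (harmonic ℓ k x) = harmonic ℓ (-k) x := by
  rcases lt_trichotomy k 0 with hk | rfl | hk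
  · rw [harmonic, harmonic, if_neg (by omega), if_pos (by omega), Int.natAbs_neg, star_star]
  · simp [harmonic, harmonicNat]
  · rw [harmonic, harmonic, if_pos hk.le, if_neg (by omega), Int.natAbs_neg]

lemma fderiv_const_mul_axial (c : ℂ) (ε : ℝ) (a n : ℕ) (p : Polynomial ℝ) {x : Space}
    (hx : x ≠ 0) (v : Space) :
    fderiv ℝ (fun y => c * axial ε a n p y) x v = c * fderiv ℝ (axial ε a n p) x v := by
  rw [fderiv_const_mul (differentiableAt_axial ε a n p hx)]
  simp

lemma harmonic_euler (ℓ : ℕ) (k : ℤ) {x : Space} (hx : x ≠ 0) :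
    ∑ j, (x j : ℂ) * fderiv ℝ (harmonic ℓ k) x (basisVec j) = 0 := by
  obtain ⟨c, ε, m, -, -, h⟩ := exists_harmonic ℓ k
  simp only [h, fderiv_const_mul_axial c ε m m _ hx, mul_left_comm _ c, ← Finset.mul_sum,
    axial_euler ε m m _ hx]
  simp

lemma harmonic_rotation (ℓ : ℕ) (k : ℤ) {x : Space} (hx : x ≠ 0) :
    (x 0 : ℂ) * fderiv ℝ (harmonic ℓ k) x (basisVec 1) -
      x 1 * fderiv ℝ (harmonic ℓ k) x (basisVec 0) = I * k * harmonic ℓ k x := by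
  obtain ⟨c, ε, m, hε, hk, h⟩ := exists_harmonic ℓ k
  rw [h]
  simp only [fderiv_const_mul_axial c ε m m _ hx]
  have := axial_rotation hε m m (Polynomial.derivative^[m] (legendre ℓ)) hx
  rw [hk] at this
  linear_combination c * this

/-- The spherical harmonics of degree `ℓ` are eigenfunctions of the angular Laplacian. -/
lemma laplacian_harmonic (ℓ : ℕ) (k : ℤ) {x : Space} (hx : x ≠ 0) :
    ∑ j, fderiv ℝ (fun y => fderiv ℝ (harmonic ℓ k) y (basisVec j)) x (basisVec j) =
      -(ℓ * (ℓ + 1) : ℂ) * ((‖x‖⁻¹ : ℝ) : ℂ) ^ 2 * harmonic ℓ k x := by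
  obtain ⟨c, ε, m, hε, -, h⟩ := exists_harmonic ℓ k
  rw [h]
  have hj : ∀ j, fderiv ℝ (fun y => fderiv ℝ (fun x => c * axial ε m m
      (Polynomial.derivative^[m] (legendre ℓ)) x) y (basisVec j)) x (basisVec j) =
      c * fderiv ℝ (fun y => fderiv ℝ (axial ε m m
        (Polynomial.derivative^[m] (legendre ℓ))) y (basisVec j)) x (basisVec j) := by
    intro j
    have heq : (fun y => fderiv ℝ (fun x => c * axial ε m m
        (Polynomial.derivative^[m] (legendre ℓ)) x) y (basisVec j)) =ᶠ[nhds x] fun y =>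
        c * fderiv ℝ (axial ε m m (Polynomial.derivative^[m] (legendre ℓ))) y (basisVec j) := by
      filter_upwards [isOpen_compl_singleton.mem_nhds hx] with y hy
      exact fderiv_const_mul_axial c ε m m _ hy _
    have hd : DifferentiableAt ℝ (fun y => fderiv ℝ (axial ε m m
        (Polynomial.derivative^[m] (legendre ℓ))) y (basisVec j)) x := by
      have h1 := (contDiffOn_axial ε m m (Polynomial.derivative^[m] (legendre ℓ))).contDiffAt
        (isOpen_compl_singleton.mem_nhds hx)
      have h2 : DifferentiableAt ℝ (fderiv ℝ (axial ε m m
          (Polynomial.derivative^[m] (legendre ℓ)))) x :=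
        (h1.fderiv_right (m := 1) (by norm_cast)).differentiableAt (by simp)
      exact h2.clm_apply (differentiableAt_const _)
    rw [heq.fderiv_eq, fderiv_const_mul hd]
    simp
  simp only [hj, ← Finset.mul_sum, laplacian_axial hε ℓ m hx]
  ring

/-- The ℓ-th derivative of P_ℓ is constant, so the lowest harmonic is a multiple of (x₁ -
ix₂)^ℓ|x|^{-ℓ}. Both ∂₁ - i∂₂ and ∂₃ annihilate the power, and only |x|^{-ℓ} is differentiated. -/
lemma fderiv_harmonic_lowest (ℓ : ℕ) {x : Space} (hx : x ≠ 0) :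
    fderiv ℝ (harmonic ℓ (-ℓ)) x (basisVec 0) - I * fderiv ℝ (harmonic ℓ (-ℓ)) x (basisVec 1) =
      -(ℓ * ((‖x‖⁻¹ : ℝ) : ℂ) ^ 2) * ((x 0 : ℂ) - I * x 1) * harmonic ℓ (-ℓ) x ∧
    fderiv ℝ (harmonic ℓ (-ℓ)) x (basisVec 2) =
      -(ℓ * ((‖x‖⁻¹ : ℝ) : ℂ) ^ 2) * x 2 * harmonic ℓ (-ℓ) x := by
  obtain ⟨c, h⟩ := exists_harmonic_neg ℓ ℓ
  rw [h]
  simp only [fderiv_const_mul_axial c (-1) ℓ ℓ _ hx, fderiv_axial (-1) ℓ ℓ _ hx,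
    derivative_iterate_legendre_self]
  constructor
  · simp [axialDir, axial]
    linear_combination (c * (ℓ * ((((x 0 : ℂ) + -(I * x 1)) ^ (ℓ - 1) * ((‖x‖ : ℂ) ^ ℓ)⁻¹ *
      (Polynomial.eval (x 2 * ‖x‖⁻¹) (Polynomial.derivative^[ℓ] (legendre ℓ)) : ℝ))))) * I_sq
  · simp [axialDir, axial]
    ring

end

/-! ### Algebra of the Dirac operator and the radial matrix α_r -/

section

lemma alphaR_smul (x : Space) (c : ℂ) (z : Spinor) : alphaR x (c • z) = c • alphaR x z := by
  simp only [alphaR, map_smul, Finset.smul_sum, smul_smul]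
  exact Finset.sum_congr rfl fun j _ => by congr 1; ring

lemma alphaR_neg (x : Space) (z : Spinor) : alphaR x (-z) = -alphaR x z := by
  simpa using alphaR_smul x (-1) z

lemma norm_smul_alphaR {x : Space} (hx : x ≠ 0) (z : Spinor) :
    (‖x‖ : ℂ) • alphaR x z = (-I) • ∑ j, (x j : ℂ) • alpha j z := by
  have hx0 : (‖x‖ : ℂ) ≠ 0 := by exact_mod_cast norm_ne_zero_iff.mpr hx
  simp only [alphaR, Finset.smul_sum, smul_smul]
  refine Finset.sum_congr rfl fun j _ => ?_
  congr 1
  push_cast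
  field_simp

/-- By the Clifford relations (α·x)² = |x|², and the two factors -i supply the sign. -/
lemma alphaR_alphaR {x : Space} (hx : x ≠ 0) (z : Spinor) : alphaR x (alphaR x z) = -z := by
  have hx0 : (‖x‖ : ℂ) ≠ 0 := by exact_mod_cast norm_ne_zero_iff.mpr hx
  have h : ∑ k, alpha k (∑ j, alpha j (((x k : ℂ) * x j) • z)) = ((‖x‖ : ℂ) ^ 2) • z := by
    rw [sum_alpha_alpha _ fun j k => by rw [mul_comm], ← Finset.sum_smul, sum_coord_sq]
  have h2 : ((‖x‖ : ℂ) ^ 2) • alphaR x (alphaR x z) = -(((‖x‖ : ℂ) ^ 2) • z) := by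
    rw [sq, mul_smul, ← alphaR_smul, norm_smul_alphaR hx, norm_smul_alphaR hx, ← sq, ← h]
    simp only [map_smul, map_sum, Finset.smul_sum, smul_smul, ← Finset.sum_neg_distrib]
    refine Finset.sum_congr rfl fun k _ => Finset.sum_congr rfl fun j _ => ?_
    rw [← neg_smul]
    congr 1
    linear_combination ((x k : ℂ) * x j) * I_sq
  refine smul_right_injective _ (pow_ne_zero 2 hx0) ?_
  simpa using h2

/-- The Clifford relations contract the symmetric second derivative to its trace. -/
lemma diracOp_diracOp {F : Space → Spinor} {x : Space} (hF : ContDiffAt ℝ 2 F x) :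
    diracOp (diracOp F) x =
      -∑ j, fderiv ℝ (fun y => fderiv ℝ F y (basisVec j)) x (basisVec j) := by
  have hd : ∀ j, DifferentiableAt ℝ (fun y => fderiv ℝ F y (basisVec j)) x := fun j =>
    ((hF.fderiv_right (m := 1) (by norm_num)).differentiableAt one_ne_zero).clm_apply
      (differentiableAt_const _)
  have h1 : ∀ k, fderiv ℝ (diracOp F) x (basisVec k) = (-I) • ∑ j, alpha j
      (fderiv ℝ (fun y => fderiv ℝ F y (basisVec j)) x (basisVec k)) := by
    intro k
    have h2 : ∀ j, HasFDerivAt (fun y => alpha j (fderiv ℝ F y (basisVec j))) _ x := fun j =>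
      ((alpha j).restrictScalars ℝ).hasFDerivAt.comp x (hd j).hasFDerivAt
    have h3 : HasFDerivAt (diracOp F) _ x := (HasFDerivAt.fun_sum fun j (_ : j ∈ Finset.univ) => h2 j).const_smul (-I)
    rw [h3.fderiv]
    simp
  rw [diracOp]
  simp only [h1, map_smul, ← Finset.smul_sum]
  rw [smul_smul, sum_alpha_alpha _ fun j k => fderiv_fderiv_comm hF _ _]
  simp

lemma hasFDerivAt_sum_coord_smul_alpha {F : Space → Spinor} {x : Space}
    (hF : DifferentiableAt ℝ F x) :
    HasFDerivAt (fun y => ∑ j, (y j : ℂ) • alpha j (F y))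
      (∑ j, (x j • (((alpha j).restrictScalars ℝ) ∘L fderiv ℝ F x) +
        (EuclideanSpace.proj (𝕜 := ℝ) j).smulRight (alpha j (F x)))) x := by
  simp only [Complex.coe_smul]
  exact HasFDerivAt.fun_sum fun j _ => (EuclideanSpace.proj (𝕜 := ℝ) j).hasFDerivAt.smul
    (((alpha j).restrictScalars ℝ).hasFDerivAt.comp x hF.hasFDerivAt)

/-- Exchanging α_kα_j for 2δ_{jk} - α_jα_k leaves twice the derivative in the direction x and the
product (α·x)(α·∇), which is -|x| α_r D₀. -/
lemma sum_alpha_fderiv_eq {F : Space → Spinor} {x : Space} (hx : x ≠ 0) :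
    ∑ k, alpha k (∑ j, (x j : ℂ) • alpha j (fderiv ℝ F x (basisVec k))) =
      (2 : ℂ) • fderiv ℝ F x x + (‖x‖ : ℂ) • alphaR x (diracOp F x) := by
  have hxs : fderiv ℝ F x x = ∑ k, (x k : ℂ) • fderiv ℝ F x (basisVec k) := by
    have h := congrArg (fderiv ℝ F x) ((EuclideanSpace.basisFun (Fin 3) ℝ).sum_repr x)
    rw [← h]
    simp
  rw [norm_smul_alphaR hx, diracOp, hxs]
  simp only [map_smul, map_sum, Finset.smul_sum, smul_smul]
  rw [Finset.sum_comm (s := Finset.univ (α := Fin 3)) (f := fun j k => (-I * ((x j : ℂ) * -I)) •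
    alpha j (alpha k (fderiv ℝ F x (basisVec k))))]
  rw [← Finset.sum_add_distrib]
  refine Finset.sum_congr rfl fun k _ => ?_
  have : (2 * (x k : ℂ)) • fderiv ℝ F x (basisVec k) =
      ∑ j, (x j : ℂ) • (if j = k then (2 : ℂ) • fderiv ℝ F x (basisVec k) else 0) := by
    simp [smul_smul, mul_comm]
  rw [this, ← Finset.sum_add_distrib]
  refine Finset.sum_congr rfl fun j _ => ?_
  rw [← alpha_comp_alpha, smul_add, add_assoc, add_comm]
  have hI : -I * (x j * -I) = -(x j : ℂ) := by linear_combination (x j : ℂ) * I_sq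
  rw [hI]
  module

lemma sum_alpha_self (z : Spinor) : ∑ k, alpha k (alpha k z) = (3 : ℂ) • z := by
  have h := fun k => alpha_comp_alpha k k z
  simp only [if_true, ← two_smul ℂ] at h
  have h' := fun k => smul_right_injective _ (two_ne_zero (α := ℂ)) (h k)
  simp only [h', Fin.sum_univ_three]
  module

lemma diracOp_sum_coord {F : Space → Spinor} {x : Space} (hx : x ≠ 0)
    (hF : DifferentiableAt ℝ F x) :
    diracOp (fun y => (-I) • ∑ j, (y j : ℂ) • alpha j (F y)) x =
      -((3 : ℂ) • F x + (2 : ℂ) • fderiv ℝ F x x + (‖x‖ : ℂ) • alphaR x (diracOp F x)) := by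
  have hGk : ∀ k, fderiv ℝ (fun y => (-I) • ∑ j, (y j : ℂ) • alpha j (F y)) x (basisVec k) =
      (-I) • (alpha k (F x) + ∑ j, (x j : ℂ) • alpha j (fderiv ℝ F x (basisVec k))) := by
    intro k
    have h : HasFDerivAt (fun y => (-I) • ∑ j, (y j : ℂ) • alpha j (F y)) _ x :=
      (hasFDerivAt_sum_coord_smul_alpha hF).const_smul (-I)
    have h1 : ∑ j, basisVec k j • alpha j (F x) = alpha k (F x) := by
      simp
    rw [h.fderiv, smul_apply, sum_apply, add_comm (alpha k (F x)), ← h1,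
      ← Finset.sum_add_distrib]
    simp only [Complex.coe_smul]
    rfl
  rw [diracOp]
  simp only [hGk, map_smul, map_add, ← Finset.smul_sum, Finset.sum_add_distrib]
  rw [sum_alpha_fderiv_eq hx, sum_alpha_self, smul_smul, ← add_assoc]
  simp
  abel

/-- The formula for -iα·x F is divided by |x|. The derivative of 1/|x| brings in α_r² = -1 and
lowers the coefficient 3 (from α_k² = 1 in three dimensions) to 2. -/
lemma diracOp_alphaR {F : Space → Spinor} {x : Space} (hx : x ≠ 0)
    (hF : DifferentiableAt ℝ F x) :
    diracOp (fun y => alphaR y (F y)) x = (-(2 * ‖x‖⁻¹ : ℂ)) • (F x + fderiv ℝ F x x) -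
      alphaR x (diracOp F x) := by
  have hx0 : (‖x‖ : ℂ) ≠ 0 := by exact_mod_cast norm_ne_zero_iff.mpr hx
  have hχ : HasDerivAt (fun r : ℝ => (r : ℂ)⁻¹) (-((‖x‖ : ℂ) ^ 2)⁻¹) ‖x‖ := by
    have h : HasDerivAt (fun r : ℝ => (r : ℂ)⁻¹) _ ‖x‖ :=
      ((hasDerivAt_id ‖x‖).ofReal_comp).inv hx0
    refine h.congr_deriv ?_
    simp [neg_div]
  have heq : (fun y => alphaR y (F y)) =ᶠ[nhds x] fun y => ((‖y‖ : ℝ) : ℂ)⁻¹ •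
      ((-I) • ∑ j, (y j : ℂ) • alpha j (F y)) := by
    filter_upwards [isOpen_compl_singleton.mem_nhds hx] with y hy
    have hy0 : (‖y‖ : ℂ) ≠ 0 := by exact_mod_cast norm_ne_zero_iff.mpr hy
    rw [← norm_smul_alphaR hy, inv_smul_smul₀ hy0]
  have hcongr : diracOp (fun y => alphaR y (F y)) x =
      diracOp (fun y => ((‖y‖ : ℝ) : ℂ)⁻¹ • ((-I) • ∑ j, (y j : ℂ) • alpha j (F y))) x := by
    simp only [diracOp, heq.fderiv_eq]
  rw [hcongr, diracOp_radial_smul (F := fun y => (-I) • ∑ j, (y j : ℂ) • alpha j (F y)) hx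
    hχ.differentiableAt ((hasFDerivAt_sum_coord_smul_alpha hF).const_smul (-I)).differentiableAt,
    hχ.deriv, diracOp_sum_coord hx hF, ← norm_smul_alphaR hx, alphaR_smul, alphaR_alphaR hx]
  have e1 : -((‖x‖ : ℂ) ^ 2)⁻¹ * ‖x‖ = -(‖x‖ : ℂ)⁻¹ := by field_simp
  simp only [smul_neg, smul_add, smul_smul, neg_smul, inv_mul_cancel₀ hx0, one_smul, e1]
  push_cast
  module

/-- Euler's identity for homogeneous functions. -/
lemma fderiv_homogeneous {E : Type*} [NormedAddCommGroup E] [NormedSpace ℝ E] {F : Space → E}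
    {x : Space} (hF : DifferentiableAt ℝ F x) {φ : ℝ → ℝ} {φ' : ℝ} (hφ : HasDerivAt φ φ' 1)
    (h : ∀ r : ℝ, 0 < r → F (r • x) = φ r • F x) : fderiv ℝ F x x = φ' • F x := by
  refine (hasDerivAt_line hF x).unique ?_
  have h1 : HasDerivAt (fun s : ℝ => φ (1 + s)) φ' 0 := by
    refine HasDerivAt.comp_const_add (1 : ℝ) 0 ?_
    simpa using hφ
  refine (h1.smul_const (F x)).congr_of_eventuallyEq ?_
  filter_upwards [lt_mem_nhds (show (-1 : ℝ) < 0 by norm_num)] with s hs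
  rw [← h (1 + s) (by linarith), add_smul, one_smul]

lemma contDiffOn_diracOp {F : Space → Spinor} (hF : ContDiffOn ℝ (⊤ : ℕ∞) F {0}ᶜ) :
    ContDiffOn ℝ (⊤ : ℕ∞) (diracOp F) {0}ᶜ := by
  refine ContDiffOn.const_smul (-I) (ContDiffOn.sum fun j _ => ?_)
  exact ((alpha j).restrictScalars ℝ).contDiff.comp_contDiffOn
    ((hF.fderiv_of_isOpen isOpen_compl_singleton (m := (⊤ : ℕ∞)) (by simp)).clm_apply
      contDiffOn_const)

lemma contDiffOn_alphaR {F : Space → Spinor} (hF : ContDiffOn ℝ (⊤ : ℕ∞) F {0}ᶜ) :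
    ContDiffOn ℝ (⊤ : ℕ∞) (fun x => alphaR x (F x)) {0}ᶜ := by
  refine ContDiffOn.const_smul (-I) (ContDiffOn.sum fun j _ => ?_)
  simp only [Complex.coe_smul]
  exact ((contDiff_coord j).contDiffOn.div norm_contDiffOn fun x hx =>
    norm_ne_zero_iff.mpr hx).smul (((alpha j).restrictScalars ℝ).contDiff.comp_contDiffOn hF)

lemma diracOp_homogeneous {F : Space → Spinor} (h : ∀ x (r : ℝ), 0 < r → F (r • x) = F x)
    (x : Space) {r : ℝ} (hr : 0 < r) : diracOp F (r • x) = r⁻¹ • diracOp F x := by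
  have h1 : fderiv ℝ F x = r • fderiv ℝ F (r • x) := by
    rw [← fderiv_comp_smul]
    congr 1
    exact funext fun y => (h y r hr).symm
  rw [diracOp, diracOp, h1]
  have h2 : ∀ j, alpha j ((r • fderiv ℝ F (r • x)) (basisVec j)) =
      r • alpha j (fderiv ℝ F (r • x) (basisVec j)) := fun j =>
    ((alpha j).restrictScalars ℝ).map_smul r _
  simp only [h2, ← Finset.smul_sum]
  rw [smul_comm (-I), inv_smul_smul₀ hr.ne']

lemma alphaR_pos_smul (x : Space) {r : ℝ} (hr : 0 < r) (z : Spinor) :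
    alphaR (r • x) z = alphaR x z := by
  have : ∀ j, (r • x) j / ‖r • x‖ = x j / ‖x‖ := fun j => by
    rw [norm_smul, Real.norm_eq_abs, abs_of_pos hr, PiLp.smul_apply, smul_eq_mul,
      mul_div_mul_left _ _ hr.ne']
  simp only [alphaR, this]

end

/-! ### Families stable under the Dirac operator -/

section

/-- The radial part of the Dirac operator on the families `diracFamily`. -/
def radialMatrix : Fin 4 → Fin 4 → ℂ := ![![0, -1, 0, 0], ![1, 0, 0, 0], ![0, 0, 0, -1], ![0, 0, 1, 0]]

/-- The tangential part of the Dirac operator on the families `diracFamily`. -/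
def tangentialMatrix (ϰ : ℂ) : Fin 4 → Fin 4 → ℂ :=
  ![![0, 0, 0, -1], ![2, 0, -1, 0], ![0, -ϰ, 0, -1], ![-ϰ, 0, 1, 0]]

/-- The family generated from `F` by the radial and the tangential Dirac operator. -/
def diracFamily (F : Space → Spinor) : Fin 4 → Space → Spinor :=
  ![F, fun x => -alphaR x (F x), fun x => -((‖x‖ : ℂ) • alphaR x (diracOp F x)),
    fun x => -((‖x‖ : ℂ) • diracOp F x)]

section

variable {F : Space → Spinor} {ϰ : ℂ}

lemma differentiableAt_of_smooth {G : Space → Spinor} (hG : ContDiffOn ℝ (⊤ : ℕ∞) G {0}ᶜ)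
    {x : Space} (hx : x ≠ 0) : DifferentiableAt ℝ G x :=
  (hG.contDiffAt (isOpen_compl_singleton.mem_nhds hx)).differentiableAt (by simp)

lemma diracOp_neg (G : Space → Spinor) (x : Space) : diracOp (fun y => -G y) x = -diracOp G x := by
  simp [diracOp, fderiv_fun_neg]

lemma diracOp_norm_smul {G : Space → Spinor} {x : Space} (hx : x ≠ 0)
    (hG : DifferentiableAt ℝ G x) :
    diracOp (fun y => (‖y‖ : ℂ) • G y) x = (‖x‖ : ℂ) • diracOp G x + alphaR x (G x) := by
  have h : HasDerivAt (fun r : ℝ => (r : ℂ)) ((1 : ℝ) : ℂ) ‖x‖ := (hasDerivAt_id ‖x‖).ofReal_comp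
  have := diracOp_radial_smul hx h.differentiableAt hG
  rwa [h.deriv, Complex.ofReal_one, one_smul] at this

lemma diracOp_alphaR_of_homogeneous (hF : ContDiffOn ℝ (⊤ : ℕ∞) F {0}ᶜ)
    (hh : ∀ x (r : ℝ), 0 < r → F (r • x) = F x) {x : Space} (hx : x ≠ 0) :
    diracOp (fun y => alphaR y (F y)) x = (-(2 * ‖x‖⁻¹ : ℂ)) • F x - alphaR x (diracOp F x) := by
  rw [diracOp_alphaR hx (differentiableAt_of_smooth hF hx),
    fderiv_homogeneous (differentiableAt_of_smooth hF hx) (φ := fun _ => 1)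
      (hasDerivAt_const _ _) (fun r hr => by rw [hh x r hr, one_smul]), zero_smul, add_zero]

lemma diracOp_diracOp_of_eigen (hF : ContDiffOn ℝ (⊤ : ℕ∞) F {0}ᶜ)
    {x : Space} (hx : x ≠ 0)
    (hΔ : ∑ j, fderiv ℝ (fun y => fderiv ℝ F y (basisVec j)) x (basisVec j) =
      -(ϰ * (‖x‖⁻¹ : ℂ) ^ 2) • F x) :
    diracOp (diracOp F) x = (ϰ * (‖x‖⁻¹ : ℂ) ^ 2) • F x := by
  rw [diracOp_diracOp ((hF.contDiffAt (isOpen_compl_singleton.mem_nhds hx)).of_le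
    (by norm_cast)), hΔ, neg_smul, neg_neg]

/-- D₀F is homogeneous of degree -1, so it cancels against its derivative in the direction x; only
-α_r D₀²F survives. -/
lemma diracOp_alphaR_diracOp (hF : ContDiffOn ℝ (⊤ : ℕ∞) F {0}ᶜ)
    (hh : ∀ x (r : ℝ), 0 < r → F (r • x) = F x) {x : Space} (hx : x ≠ 0)
    (hΔ : ∑ j, fderiv ℝ (fun y => fderiv ℝ F y (basisVec j)) x (basisVec j) =
      -(ϰ * (‖x‖⁻¹ : ℂ) ^ 2) • F x) :
    diracOp (fun y => alphaR y (diracOp F y)) x = -(ϰ * (‖x‖⁻¹ : ℂ) ^ 2) • alphaR x (F x) := by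
  have hd := differentiableAt_of_smooth (contDiffOn_diracOp hF) hx
  have h1 : HasDerivAt (fun r : ℝ => r⁻¹) (-1) 1 := by
    simpa using hasDerivAt_inv (one_ne_zero (α := ℝ))
  rw [diracOp_alphaR hx hd, fderiv_homogeneous hd h1 fun r hr => diracOp_homogeneous hh x hr,
    diracOp_diracOp_of_eigen hF hx hΔ, alphaR_smul, neg_one_smul, add_neg_cancel, smul_zero,
    zero_sub, neg_smul]

lemma diracFamily_radial (k : Fin 4) {x : Space} (hx : x ≠ 0) :
    alphaR x (diracFamily F k x) = ∑ j, radialMatrix k j • diracFamily F j x := by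
  fin_cases k <;>
    simp [-Complex.coe_smul, Fin.sum_univ_four, diracFamily, radialMatrix, alphaR_neg, alphaR_smul, alphaR_alphaR hx]

/-- The factors |x| restore degree zero to D₀F and α_r D₀F. Differentiating those factors gives the
entries ±1 in the last two rows, and the eigenvalue equation gives the entries -ϰ. -/
lemma diracFamily_tangential (hF : ContDiffOn ℝ (⊤ : ℕ∞) F {0}ᶜ)
    (hh : ∀ x (r : ℝ), 0 < r → F (r • x) = F x)
    (hΔ : ∀ x ≠ 0, ∑ j, fderiv ℝ (fun y => fderiv ℝ F y (basisVec j)) x (basisVec j) =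
      -(ϰ * (‖x‖⁻¹ : ℂ) ^ 2) • F x) (k : Fin 4) {x : Space} (hx : x ≠ 0) :
    diracOp (diracFamily F k) x =
      (‖x‖⁻¹ : ℂ) • ∑ j, tangentialMatrix ϰ k j • diracFamily F j x := by
  have hx0 : (‖x‖ : ℂ) ≠ 0 := by exact_mod_cast norm_ne_zero_iff.mpr hx
  have hd := differentiableAt_of_smooth (contDiffOn_diracOp hF) hx
  have hd' := differentiableAt_of_smooth (contDiffOn_alphaR (contDiffOn_diracOp hF)) hx
  have e1 : (‖x‖ : ℂ)⁻¹ * ‖x‖ = 1 := inv_mul_cancel₀ hx0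
  have e2 : (‖x‖ : ℂ) * (ϰ * ((‖x‖ : ℂ) ^ 2)⁻¹) = ϰ * (‖x‖ : ℂ)⁻¹ := by field_simp
  fin_cases k
  · simp [-Complex.coe_smul, Fin.sum_univ_four, diracFamily, tangentialMatrix, smul_smul, e1]
  · have h := diracOp_alphaR_of_homogeneous hF hh hx
    simp [-Complex.coe_smul, Fin.sum_univ_four, diracFamily, tangentialMatrix, smul_smul, diracOp_neg, h, e1,
      mul_comm]
    abel
  · have h := diracOp_alphaR_diracOp hF hh hx (hΔ x hx)
    simp [-Complex.coe_smul, Fin.sum_univ_four, diracFamily, tangentialMatrix, smul_smul, diracOp_neg, h, e1,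
      diracOp_norm_smul hx hd', alphaR_alphaR hx, e2]
    module
  · have h := diracOp_diracOp_of_eigen hF hx (hΔ x hx)
    simp [-Complex.coe_smul, Fin.sum_univ_four, diracFamily, tangentialMatrix, smul_smul, diracOp_neg, h, e1,
      diracOp_norm_smul hx hd, e2]
    module

lemma contDiffOn_norm_smul {G : Space → Spinor} (hG : ContDiffOn ℝ (⊤ : ℕ∞) G {0}ᶜ) :
    ContDiffOn ℝ (⊤ : ℕ∞) (fun x => -((‖x‖ : ℂ) • G x)) {0}ᶜ := by
  simp only [Complex.coe_smul]
  exact (norm_contDiffOn.smul hG).neg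

lemma isAngular_diracFamily (hF : ContDiffOn ℝ (⊤ : ℕ∞) F {0}ᶜ)
    (hh : ∀ x (r : ℝ), 0 < r → F (r • x) = F x)
    (hΔ : ∀ x ≠ 0, ∑ j, fderiv ℝ (fun y => fderiv ℝ F y (basisVec j)) x (basisVec j) =
      -(ϰ * (‖x‖⁻¹ : ℂ) ^ 2) • F x) : IsAngular (diracFamily F) where
  smooth k := by
    fin_cases k
    · exact hF
    · exact (contDiffOn_alphaR hF).neg
    · exact contDiffOn_norm_smul (contDiffOn_alphaR (contDiffOn_diracOp hF))
    · exact contDiffOn_norm_smul (contDiffOn_diracOp hF)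
  homog k x r hr := by
    have e : (r : ℂ) * ‖x‖ * (r : ℂ)⁻¹ = ‖x‖ := by
      have : (r : ℂ) ≠ 0 := by exact_mod_cast hr.ne'
      field_simp
    have e' : diracOp F (r • x) = (r⁻¹ : ℂ) • diracOp F x := by
      rw [diracOp_homogeneous hh x hr, ← Complex.coe_smul, Complex.ofReal_inv]
    fin_cases k <;>
      simp [-Complex.coe_smul, diracFamily, hh x r hr, alphaR_pos_smul x hr, norm_smul, abs_of_pos hr, e',
        smul_smul,
        alphaR_smul, e]
  radial k := ⟨radialMatrix k, fun _ hx => diracFamily_radial k hx⟩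
  tangential k := ⟨tangentialMatrix ϰ k, fun _ hx => diracFamily_tangential hF hh hΔ k hx⟩

/-- If `F` is an eigenfunction of `α_r` times the tangential Dirac operator, two functions
suffice. -/
lemma isAngular_pair (hF : ContDiffOn ℝ (⊤ : ℕ∞) F {0}ᶜ)
    (hh : ∀ x (r : ℝ), 0 < r → F (r • x) = F x) (c : ℂ)
    (hD : ∀ x ≠ 0, diracOp F x = -(c * (‖x‖⁻¹ : ℂ)) • alphaR x (F x)) :
    IsAngular ![F, fun x => -alphaR x (F x)] where
  smooth k := by
    fin_cases k
    · exact hF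
    · exact (contDiffOn_alphaR hF).neg
  homog k x r hr := by
    fin_cases k <;> simp [hh x r hr, alphaR_pos_smul x hr]
  radial k := by
    refine ⟨(![![0, -1], ![1, 0]] : Fin 2 → Fin 2 → ℂ) k, fun x hx => ?_⟩
    fin_cases k <;> simp [alphaR_neg, alphaR_alphaR hx]
  tangential k := by
    refine ⟨(![![0, c], ![2 + c, 0]] : Fin 2 → Fin 2 → ℂ) k, fun x hx => ?_⟩
    fin_cases k
    · simp [hD x hx, smul_smul, mul_comm]
    · have h := diracOp_alphaR_of_homogeneous hF hh hx
      simp [diracOp_neg, h, hD x hx, alphaR_smul, alphaR_neg, alphaR_alphaR hx, smul_smul]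
      module

end

lemma isAngular_sumElim {κ ι : Type} [Fintype κ] [Fintype ι] {b : κ → Space → Spinor}
    {c : ι → Space → Spinor} (hb : IsAngular b) (hc : IsAngular c) :
    IsAngular (Sum.elim b c) where
  smooth := by
    rintro (k | k)
    · exact hb.smooth k
    · exact hc.smooth k
  homog := by
    rintro (k | k)
    · exact hb.homog k
    · exact hc.homog k
  radial := by
    rintro (k | k)
    · obtain ⟨a, ha⟩ := hb.radial k
      exact ⟨Sum.elim a 0, fun x hx => by simpa using ha x hx⟩
    · obtain ⟨a, ha⟩ := hc.radial k
      exact ⟨Sum.elim 0 a, fun x hx => by simpa using ha x hx⟩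
  tangential := by
    rintro (k | k)
    · obtain ⟨a, ha⟩ := hb.tangential k
      exact ⟨Sum.elim a 0, fun x hx => by simpa using ha x hx⟩
    · obtain ⟨a, ha⟩ := hc.tangential k
      exact ⟨Sum.elim 0 a, fun x hx => by simpa using ha x hx⟩

end

/-! ### The spaces 𝒳 and 𝒴 as angular spaces -/

section

lemma alpha_block (j : Fin 3) (a b : Fin 2 → ℂ) :
    alpha j (block a b) = block ((pauli j).mulVec b) ((pauli j).mulVec a) := by
  simp only [alpha, block, Matrix.toEuclideanCLM_toLp]
  rw [Matrix.fromBlocks_mulVec]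
  simp

lemma beta_block (a b : Fin 2 → ℂ) : beta (block a b) = block a (-b) := by
  simp only [beta, block, Matrix.toEuclideanCLM_toLp]
  rw [Matrix.fromBlocks_mulVec]
  simp [Matrix.neg_mulVec]

lemma block_zero : block 0 0 = 0 := by
  simpa using (smul_block 0 0 0).symm

lemma sum_block {ι : Type*} (s : Finset ι) (a b : ι → Fin 2 → ℂ) :
    ∑ i ∈ s, block (a i) (b i) = block (∑ i ∈ s, a i) (∑ i ∈ s, b i) := by
  classical
  induction s using Finset.induction_on with
  | empty => simp [block_zero]
  | insert i s hi ih => rw [Finset.sum_insert hi, Finset.sum_insert hi, Finset.sum_insert hi, ih,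
      block_add]

lemma block_injective {a b a' b' : Fin 2 → ℂ} (h : block a b = block a' b') : a = a' ∧ b = b' := by
  constructor
  · funext i
    simpa [block] using congrArg (fun z : Spinor => z (Sum.inl i)) h
  · funext i
    simpa [block] using congrArg (fun z : Spinor => z (Sum.inr i)) h

lemma inner_block (a b a' b' : Fin 2 → ℂ) :
    inner ℂ (block a b) (block a' b') = star a ⬝ᵥ a' + star b ⬝ᵥ b' := by
  simp [block, PiLp.inner_apply, Fintype.sum_sum_type, dotProduct, mul_comm]

lemma alphaR_block (x : Space) (a b : Fin 2 → ℂ) :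
    alphaR x (block a b) =
      block ((-I) • (sigmaR x).mulVec b) ((-I) • (sigmaR x).mulVec a) := by
  have h : ∀ c : Fin 2 → ℂ, ∑ j, ((x j / ‖x‖ : ℝ) : ℂ) • (pauli j).mulVec c =
      (sigmaR x).mulVec c := by
    intro c
    rw [sigmaR, sigmaDot, Matrix.sum_mulVec]
    refine Finset.sum_congr rfl fun j _ => ?_
    rw [Matrix.smul_mulVec, PiLp.smul_apply, smul_eq_mul, div_eq_inv_mul]
  simp only [alphaR, alpha_block, smul_block, sum_block, h]

lemma sigmaR_mulVec_sigmaR {x : Space} (hx : x ≠ 0) (a : Fin 2 → ℂ) :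
    (sigmaR x).mulVec ((sigmaR x).mulVec a) = a := by
  have h := alphaR_alphaR hx (block a 0)
  rw [alphaR_block, alphaR_block] at h
  have h2 : -block a 0 = block (-a) 0 := by simpa using smul_block (-1) a 0
  rw [h2] at h
  have h3 := (block_injective h).1
  rw [Matrix.mulVec_smul, smul_smul, neg_mul_neg, I_mul_I, neg_one_smul] at h3
  exact neg_injective h3

lemma sigmaDot_isHermitian (n : Space) : (sigmaDot n).IsHermitian := by
  ext i j
  fin_cases i <;> fin_cases j <;> simp [sigmaDot, Fin.sum_univ_three, pauli]

/-- A Hermitian involution is unitary; thus σ_r drops out of the pairing of the lower blocks of φ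
and ρ. -/
lemma star_sigmaR_dotProduct {x : Space} (hx : x ≠ 0) (a b : Fin 2 → ℂ) :
    star ((sigmaR x).mulVec a) ⬝ᵥ (sigmaR x).mulVec b = star a ⬝ᵥ b := by
  have h : (sigmaR x).conjTranspose = sigmaR x := sigmaDot_isHermitian (‖x‖⁻¹ • x)
  rw [Matrix.star_mulVec, ← Matrix.dotProduct_mulVec, h]
  exact congrArg _ (sigmaR_mulVec_sigmaR hx b)

/-- The spinor-valued function with a scalar function in one upper component. -/
def upperField (h : Space → ℂ) (i : Fin 2) (x : Space) : Spinor := block (h x • e i) 0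

lemma upperField_eq (h : Space → ℂ) (i : Fin 2) (x : Space) :
    upperField h i x = h x • block (e i) 0 := by
  rw [upperField, smul_block, smul_zero]

lemma fderiv_smul_const_apply {E : Type*} [NormedAddCommGroup E] [NormedSpace ℝ E]
    [NormedSpace ℂ E] [IsScalarTower ℝ ℂ E] {h : Space → ℂ} {x : Space}
    (hh : DifferentiableAt ℝ h x) (c : E) (v : Space) :
    fderiv ℝ (fun y => h y • c) x v = fderiv ℝ h x v • c := by
  rw [fderiv_smul_const hh]
  rfl

lemma differentiableAt_harmonic (ℓ : ℕ) (k : ℤ) {x : Space} (hx : x ≠ 0) :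
    DifferentiableAt ℝ (harmonic ℓ k) x :=
  ((contDiffOn_harmonic ℓ k).contDiffAt (isOpen_compl_singleton.mem_nhds hx)).differentiableAt
    (by simp)

lemma Sig_harmonicVec (ℓ : ℕ) (k : ℤ) (i : Fin 2) {x : Space} (hx : x ≠ 0) :
    Sig (harmonicVec ℓ k i) x =
      ∑ j, fderiv ℝ (harmonic ℓ k) x (basisVec j) • (pauli j).mulVec (e i) := by
  rw [Sig]
  refine Finset.sum_congr rfl fun j _ => ?_
  have h : fderiv ℝ (harmonicVec ℓ k i) x (basisVec j) = _ :=
    fderiv_smul_const_apply (differentiableAt_harmonic ℓ k hx) (e i) (basisVec j)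
  rw [h, Matrix.mulVec_smul]

lemma diracOp_upperField (ℓ : ℕ) (k : ℤ) (i : Fin 2) {x : Space} (hx : x ≠ 0) :
    diracOp (upperField (harmonic ℓ k) i) x = block 0 ((-I) • Sig (harmonicVec ℓ k i) x) := by
  have h : ∀ j, fderiv ℝ (upperField (harmonic ℓ k) i) x (basisVec j) =
      fderiv ℝ (harmonic ℓ k) x (basisVec j) • block (e i) 0 := fun j => by
    rw [funext (upperField_eq (harmonic ℓ k) i)]
    exact fderiv_smul_const_apply (differentiableAt_harmonic ℓ k hx) _ _
  simp only [diracOp, h, alpha_block, smul_block, sum_block, Sig_harmonicVec ℓ k i hx,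
    Matrix.mulVec_smul, Matrix.mulVec_zero, smul_zero, Finset.sum_const_zero]

lemma contDiffOn_upperField (ℓ : ℕ) (k : ℤ) (i : Fin 2) :
    ContDiffOn ℝ (⊤ : ℕ∞) (upperField (harmonic ℓ k) i) {0}ᶜ := by
  rw [funext (upperField_eq (harmonic ℓ k) i)]
  exact (contDiffOn_harmonic ℓ k).smul contDiffOn_const

lemma upperField_smul (ℓ : ℕ) (k : ℤ) (i : Fin 2) (x : Space) (r : ℝ) (hr : 0 < r) :
    upperField (harmonic ℓ k) i (r • x) = upperField (harmonic ℓ k) i x := by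
  rw [upperField, upperField, harmonic_smul ℓ k x hr]

lemma laplacian_upperField (ℓ : ℕ) (k : ℤ) (i : Fin 2) (x : Space) (hx : x ≠ 0) :
    ∑ j, fderiv ℝ (fun y => fderiv ℝ (upperField (harmonic ℓ k) i) y (basisVec j)) x (basisVec j) =
      -((ℓ * (ℓ + 1) : ℂ) * (‖x‖⁻¹ : ℂ) ^ 2) • upperField (harmonic ℓ k) i x := by
  have hj : ∀ j, fderiv ℝ (fun y => fderiv ℝ (upperField (harmonic ℓ k) i) y (basisVec j)) x
      (basisVec j) = fderiv ℝ (fun y => fderiv ℝ (harmonic ℓ k) y (basisVec j)) x (basisVec j) •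
        block (e i) 0 := by
    intro j
    have heq : (fun y => fderiv ℝ (upperField (harmonic ℓ k) i) y (basisVec j)) =ᶠ[nhds x] fun y =>
        fderiv ℝ (harmonic ℓ k) y (basisVec j) • block (e i) 0 := by
      filter_upwards [isOpen_compl_singleton.mem_nhds hx] with y hy
      rw [funext (upperField_eq (harmonic ℓ k) i)]
      exact fderiv_smul_const_apply (differentiableAt_harmonic ℓ k hy) _ _
    have hd : DifferentiableAt ℝ (fun y => fderiv ℝ (harmonic ℓ k) y (basisVec j)) x := by
      have h1 := (contDiffOn_harmonic ℓ k).contDiffAt (isOpen_compl_singleton.mem_nhds hx)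
      have h2 : DifferentiableAt ℝ (fderiv ℝ (harmonic ℓ k)) x :=
        (h1.fderiv_right (m := 1) (by norm_cast)).differentiableAt (by simp)
      exact h2.clm_apply (differentiableAt_const _)
    rw [heq.fderiv_eq, fderiv_smul_const_apply hd]
  simp only [hj, ← Finset.sum_smul, laplacian_harmonic ℓ k hx, upperField_eq, smul_smul]
  congr 1
  push_cast
  ring

/-- On h e₂ the operator Σ has the components (∂₁ - i∂₂)h and -∂₃h, exactly the combinations
computed in `fderiv_harmonic_lowest`. -/
lemma Sig_harmonicVec_lowest (ℓ : ℕ) {x : Space} (hx : x ≠ 0) :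
    Sig (harmonicVec ℓ (-ℓ) 1) x =
      -((ℓ : ℂ) * (‖x‖⁻¹ : ℂ)) • (sigmaR x).mulVec (harmonicVec ℓ (-ℓ) 1 x) := by
  obtain ⟨h1, h2⟩ := fderiv_harmonic_lowest ℓ hx
  rw [Sig_harmonicVec ℓ (-ℓ) 1 hx]
  funext i
  fin_cases i
  · simp [Fin.sum_univ_three, pauli, e, sigmaR, sigmaDot, harmonicVec] at h1 ⊢
    linear_combination h1
  · simp [Fin.sum_univ_three, pauli, e, sigmaR, sigmaDot, harmonicVec] at h2 ⊢
    linear_combination (-1 : ℂ) * h2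

lemma diracOp_upperField_lowest (ℓ : ℕ) (x : Space) (hx : x ≠ 0) :
    diracOp (upperField (harmonic ℓ (-ℓ)) 1) x =
      -((ℓ : ℂ) * (‖x‖⁻¹ : ℂ)) • alphaR x (upperField (harmonic ℓ (-ℓ)) 1 x) := by
  rw [diracOp_upperField ℓ (-ℓ) 1 hx, upperField, alphaR_block, Sig_harmonicVec_lowest ℓ hx,
    smul_block, harmonicVec, Matrix.mulVec_zero, smul_zero, smul_zero, smul_comm]

/-- The first component of `σ_r Σ h e₁`. -/
lemma sigmaR_Sig_harmonicVec_zero (ℓ : ℕ) (k : ℤ) {x : Space} (hx : x ≠ 0) :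
    (sigmaR x).mulVec (Sig (harmonicVec ℓ k 0) x) 0 = -(k * (‖x‖⁻¹ : ℂ)) * harmonic ℓ k x := by
  -- The first component is ∂_r h + (i/r)(x₁∂₂ - x₂∂₁)h. The radial derivative vanishes and the
  -- rotation has eigenvalue ik.
  have h1 := harmonic_euler ℓ k hx
  have h2 := harmonic_rotation ℓ k hx
  rw [Sig_harmonicVec ℓ k 0 hx]
  simp [Fin.sum_univ_three, pauli, e, sigmaR, sigmaDot, Matrix.mulVec, dotProduct, Fin.sum_univ_two]
    at h1 ⊢
  linear_combination (‖x‖⁻¹ : ℂ) * h1 + (‖x‖⁻¹ : ℂ) * I * h2 +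
    (‖x‖⁻¹ : ℂ) * (k * harmonic ℓ k x - x 1 * fderiv ℝ (harmonic ℓ k) x (basisVec 1)) * I_sq

/-- The basis fields of the spaces `𝒳`. -/
abbrev familyX (ℓ : ℕ) (k : ℤ) : Fin 4 → Space → Spinor := diracFamily (upperField (harmonic ℓ k) 0)

/-- The basis fields of the spaces `𝒴`. -/
abbrev familyY (ℓ : ℕ) : Fin 2 → Space → Spinor :=
  ![upperField (harmonic ℓ (-ℓ)) 1, fun x => -alphaR x (upperField (harmonic ℓ (-ℓ)) 1 x)]

lemma isAngular_familyX (ℓ : ℕ) (k : ℤ) : IsAngular (familyX ℓ k) :=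
  isAngular_diracFamily (contDiffOn_upperField ℓ k 0) (upperField_smul ℓ k 0)
    (laplacian_upperField ℓ k 0)

lemma isAngular_familyY (ℓ : ℕ) : IsAngular (familyY ℓ) :=
  isAngular_pair (contDiffOn_upperField ℓ (-ℓ) 1) (upperField_smul ℓ (-ℓ) 1) ℓ
    (diracOp_upperField_lowest ℓ)

/-- Σh has degree -1 whereas the last two basis fields contain an extra factor |x|; hence B and Q
are divided by r. -/
lemma fieldX_eq_radialField (ℓ : ℕ) (k : ℤ) (Ψ : ℝ → Fin 4 → ℂ) {x : Space} (hx : x ≠ 0) :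
    fieldX ℓ k Ψ x = radialField (familyX ℓ k)
      (fun r => ![Ψ r 0, Ψ r 1, Ψ r 2 * (r⁻¹ : ℂ), Ψ r 3 * (r⁻¹ : ℂ)]) x := by
  have hx0 : (‖x‖ : ℂ) ≠ 0 := by exact_mod_cast norm_ne_zero_iff.mpr hx
  have hneg : ∀ a b, -block a b = block (-a) (-b) := fun a b => by
    simpa using smul_block (-1) a b
  simp only [fieldX, radialField, Fin.sum_univ_four, diracFamily, Matrix.cons_val,
    diracOp_upperField ℓ k 0 hx, Matrix.mulVec_add, Matrix.mulVec_smul, sigmaR_mulVec_sigmaR hx]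
  simp only [upperField, alphaR_block, smul_block, block_add, hneg, Matrix.mulVec_zero, smul_zero,
    neg_zero, add_zero, zero_add, Matrix.mulVec_smul, smul_smul, smul_neg, harmonicVec]
  have e2 : ∀ z : ℂ, z * (‖x‖ : ℂ)⁻¹ * (‖x‖ : ℂ) = z := fun z => by field_simp
  congr 1
  · match_scalars <;> field_simp
    simp
  · have e3 := e2 (Ψ ‖x‖ 3)
    simp only [mul_neg, smul_smul, smul_add, ← mul_assoc, e3]
    module

lemma fieldY_eq_radialField (ℓ : ℕ) (Θ : ℝ → Fin 2 → ℂ) (x : Space) :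
    fieldY ℓ Θ x = radialField (familyY ℓ) Θ x := by
  have hneg : ∀ a b, -block a b = block (-a) (-b) := fun a b => by
    simpa using smul_block (-1) a b
  simp only [fieldY, radialField, Fin.sum_univ_two, Matrix.cons_val]
  simp only [upperField, alphaR_block, smul_block, block_add, hneg, Matrix.mulVec_zero, smul_zero,
    neg_zero, add_zero, zero_add, Matrix.mulVec_smul, smul_smul, smul_neg, harmonicVec]
  congr 1
  module

lemma ae_ne_zero : ∀ᵐ x : Space, x ≠ 0 := by simp [ae_iff]

lemma measurable_vec_two {c : ℝ → Fin 2 → ℂ} (h0 : Measurable fun r => c r 0)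
    (h1 : Measurable fun r => c r 1) : Measurable c :=
  measurable_pi_lambda _ fun k => by fin_cases k <;> assumption

lemma measurable_vec_four {c : ℝ → Fin 4 → ℂ} (h0 : Measurable fun r => c r 0)
    (h1 : Measurable fun r => c r 1) (h2 : Measurable fun r => c r 2)
    (h3 : Measurable fun r => c r 3) : Measurable c :=
  measurable_pi_lambda _ fun k => by fin_cases k <;> assumption

lemma measurable_toCoeff {Ψ : ℝ → Fin 4 → ℂ} (hΨ : Measurable Ψ) : Measurable
    (fun r => ![Ψ r 0, Ψ r 1, Ψ r 2 * (r⁻¹ : ℂ), Ψ r 3 * (r⁻¹ : ℂ)] : ℝ → Fin 4 → ℂ) := by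
  have h := fun k => measurable_pi_iff.mp hΨ k
  have hr : Measurable fun r : ℝ => (r⁻¹ : ℂ) := Complex.measurable_ofReal.inv
  exact measurable_vec_four (h 0) (h 1) ((h 2).mul hr) ((h 3).mul hr)

lemma measurable_ofCoeff {c : ℝ → Fin 4 → ℂ} (hc : Measurable c) : Measurable
    (fun r => ![c r 0, c r 1, c r 2 * (r : ℂ), c r 3 * (r : ℂ)] : ℝ → Fin 4 → ℂ) := by
  have h := fun k => measurable_pi_iff.mp hc k
  exact measurable_vec_four (h 0) (h 1) ((h 2).mul Complex.measurable_ofReal)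
    ((h 3).mul Complex.measurable_ofReal)

lemma radialField_eq_fieldX (ℓ : ℕ) (k : ℤ) (c : ℝ → Fin 4 → ℂ) {x : Space} (hx : x ≠ 0) :
    radialField (familyX ℓ k) c x =
      fieldX ℓ k (fun r => ![c r 0, c r 1, c r 2 * (r : ℂ), c r 3 * (r : ℂ)]) x := by
  have hx0 : (‖x‖ : ℂ) ≠ 0 := by exact_mod_cast norm_ne_zero_iff.mpr hx
  rw [fieldX_eq_radialField ℓ k _ hx]
  refine Finset.sum_congr rfl fun j _ => ?_
  congr 1
  fin_cases j <;> simp <;> field_simp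

lemma X0_eq (ℓ : ℕ) : X0 ℓ = angularSpace (familyX ℓ 0) := by
  refine le_antisymm ?_ ?_
  · rintro f ⟨Ψ, hΨ, hf⟩
    refine ⟨_, measurable_toCoeff hΨ, ?_⟩
    filter_upwards [hf, ae_ne_zero] with x h hx
    rw [h, fieldX_eq_radialField ℓ 0 Ψ hx]
  · rintro f ⟨c, hc, hf⟩
    refine ⟨_, measurable_ofCoeff hc, ?_⟩
    filter_upwards [hf, ae_ne_zero] with x h hx
    rw [h, radialField_eq_fieldX ℓ 0 c hx]

lemma radialField_sumElim {κ ι : Type} [Fintype κ] [Fintype ι] (b : κ → Space → Spinor)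
    (b' : ι → Space → Spinor) (c : ℝ → κ ⊕ ι → ℂ) (x : Space) :
    radialField (Sum.elim b b') c x = radialField b (fun r k => c r (Sum.inl k)) x +
      radialField b' (fun r k => c r (Sum.inr k)) x := by
  simp [radialField, Fintype.sum_sum_type]

lemma X_eq (ℓ m : ℕ) :
    X ℓ m = angularSpace (Sum.elim (familyX ℓ m) (familyX ℓ (-m))) := by
  refine le_antisymm ?_ ?_
  · rintro f ⟨Ψp, Ψm, hp, hm, hf⟩
    refine ⟨fun r => Sum.elim ![Ψp r 0, Ψp r 1, Ψp r 2 * (r⁻¹ : ℂ), Ψp r 3 * (r⁻¹ : ℂ)]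
      ![Ψm r 0, Ψm r 1, Ψm r 2 * (r⁻¹ : ℂ), Ψm r 3 * (r⁻¹ : ℂ)], measurable_pi_lambda _ ?_, ?_⟩
    · rintro (k | k)
      · exact measurable_pi_iff.mp (measurable_toCoeff hp) k
      · exact measurable_pi_iff.mp (measurable_toCoeff hm) k
    · filter_upwards [hf, ae_ne_zero] with x h hx
      rw [h, radialField_sumElim, fieldX_eq_radialField ℓ m Ψp hx,
        fieldX_eq_radialField ℓ (-m) Ψm hx]
      rfl
  · rintro f ⟨c, hc, hf⟩
    have h := fun k => measurable_pi_iff.mp hc k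
    refine ⟨_, _, measurable_ofCoeff (measurable_pi_lambda _ fun k => h (Sum.inl k)),
      measurable_ofCoeff (measurable_pi_lambda _ fun k => h (Sum.inr k)), ?_⟩
    filter_upwards [hf, ae_ne_zero] with x h hx
    rw [h, radialField_sumElim, radialField_eq_fieldX ℓ m _ hx, radialField_eq_fieldX ℓ (-m) _ hx]

lemma Y_eq (ℓ : ℕ) : Y ℓ = angularSpace (familyY ℓ) := by
  ext f
  refine exists_congr fun Θ => and_congr_right fun _ => ?_
  rw [show fieldY ℓ Θ = radialField (familyY ℓ) Θ from funext (fieldY_eq_radialField ℓ Θ)]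

end

/-! ### The Dirac operator and the potentials on the coefficients; invariance -/

section

lemma coeFn_mulOp {𝕜 : Type} [RCLike 𝕜] [NormedSpace 𝕜 Spinor] (M : Space → Spinor →L[𝕜] Spinor)
    (hM : AEStronglyMeasurable M volume) (hb : ∃ C : ℝ, ∀ᵐ x, ‖M x‖ ≤ C) (f : L2) :
    mulOp M hM hb f =ᵐ[volume] fun x => M x (f x) := by
  have hmem : MemLp (fun x => M x (f x)) 2 volume := by
    obtain ⟨C, hC⟩ := hb
    refine (Lp.memLp f).of_le_mul (c := C) ?_ ?_
    · have hc : Continuous fun p : (Spinor →L[𝕜] Spinor) × Spinor => p.1 p.2 := by fun_prop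
      exact hc.comp_aestronglyMeasurable (hM.prodMk (Lp.aestronglyMeasurable f))
    · filter_upwards [hC] with x hx
      exact (M x).le_of_opNorm_le hx _
  exact hmem.coeFn_toLp

lemma fieldX_congr {ℓ : ℕ} {k : ℤ} {Ψ Φ : ℝ → Fin 4 → ℂ} {x : Space} (h : Ψ ‖x‖ = Φ ‖x‖) :
    fieldX ℓ k Ψ x = fieldX ℓ k Φ x := by
  simp only [fieldX, h]

/-- The free Dirac operator in radial coordinates. -/
def diracRadial (ℓ : ℕ) (Ψ : ℝ → Fin 4 → ℂ) (r : ℝ) : Fin 4 → ℂ :=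
  ![deriv (fun s => Ψ s 1) r + 2 / r * Ψ r 1 - (ℓ * (ℓ + 1)) / r ^ 2 * Ψ r 3,
    -deriv (fun s => Ψ s 0) r - (ℓ * (ℓ + 1)) / r ^ 2 * Ψ r 2,
    -Ψ r 1 + deriv (fun s => Ψ s 3) r,
    -Ψ r 0 - deriv (fun s => Ψ s 2) r]

lemma hasDerivAt_mul_inv {f : ℝ → ℂ} {r : ℝ} (hr : r ≠ 0) (hf : DifferentiableAt ℝ f r) :
    HasDerivAt (fun s => f s * (s⁻¹ : ℂ)) (deriv f r * (r⁻¹ : ℂ) - f r * ((r : ℂ)⁻¹) ^ 2) r := by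
  have hr' : (r : ℂ) ≠ 0 := by exact_mod_cast hr
  have h : HasDerivAt (fun s : ℝ => (s⁻¹ : ℂ)) _ r := ((hasDerivAt_id r).ofReal_comp).inv hr'
  refine (hf.hasDerivAt.mul h).congr_deriv ?_
  simp
  field_simp
  ring

/-- The matrices of `diracFamily` act on the rescaled coefficients (A, P, B/r, Q/r); scaling back by
r cancels the diagonal terms of the last two rows against the derivatives of 1/r. -/
lemma diracOp_fieldX (ℓ : ℕ) (k : ℤ) {Ψ : ℝ → Fin 4 → ℂ} {x : Space} (hx : x ≠ 0)
    (hΨ : ∀ i, DifferentiableAt ℝ (fun r => Ψ r i) ‖x‖) :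
    diracOp (fieldX ℓ k Ψ) x = fieldX ℓ k (diracRadial ℓ Ψ) x := by
  have hr : ‖x‖ ≠ 0 := norm_ne_zero_iff.mpr hx
  have hr' : (‖x‖ : ℂ) ≠ 0 := by exact_mod_cast hr
  set c : ℝ → Fin 4 → ℂ := fun r => ![Ψ r 0, Ψ r 1, Ψ r 2 * (r⁻¹ : ℂ), Ψ r 3 * (r⁻¹ : ℂ)] with hc
  have heq : fieldX ℓ k Ψ =ᶠ[nhds x] radialField (familyX ℓ k) c := by
    filter_upwards [isOpen_compl_singleton.mem_nhds hx] with y hy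
    exact fieldX_eq_radialField ℓ k Ψ hy
  have h2 := hasDerivAt_mul_inv hr (hΨ 2)
  have h3 := hasDerivAt_mul_inv hr (hΨ 3)
  have hcd : ∀ i, DifferentiableAt ℝ (fun r => c r i) ‖x‖ := by
    intro i
    fin_cases i
    · exact hΨ 0
    · exact hΨ 1
    · exact h2.differentiableAt
    · exact h3.differentiableAt
  have hD : diracOp (fieldX ℓ k Ψ) x = diracOp (radialField (familyX ℓ k) c) x := by
    simp only [diracOp, heq.fderiv_eq]
  rw [hD, (isAngular_familyX ℓ k).diracOp_radialField (fun i y hy => diracFamily_radial i hy)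
    (fun i y hy => diracFamily_tangential (contDiffOn_upperField ℓ k 0) (upperField_smul ℓ k 0)
      (laplacian_upperField ℓ k 0) i hy) hx hcd, radialField_eq_fieldX ℓ k _ hx]
  refine fieldX_congr (funext fun i => ?_)
  have e2 : deriv (fun r => c r 2) ‖x‖ = _ := h2.deriv
  have e3 : deriv (fun r => c r 3) ‖x‖ = _ := h3.deriv
  fin_cases i <;>
    simp [Fin.sum_univ_four, radialMatrix, tangentialMatrix, diracRadial, e2, e3] <;>
    simp [hc] <;> field_simp <;> ring

lemma contDiffOn_radialField {κ : Type} [Fintype κ] {b : κ → Space → Spinor} (hb : IsAngular b)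
    {c : ℝ → κ → ℂ} (hc : ∀ k, ContDiffOn ℝ 1 (fun r => c r k) (Ioi 0)) :
    ContDiffOn ℝ 1 (radialField b c) {0}ᶜ := by
  have hn : ContDiffOn ℝ 1 (fun x : Space => ‖x‖) {0}ᶜ :=
    norm_contDiffOn.of_le (by exact_mod_cast le_top)
  refine ContDiffOn.sum fun k _ => ?_
  exact ((hc k).comp hn fun x hx => norm_pos_iff.mpr hx).smul
    ((hb.smooth k).of_le (by exact_mod_cast le_top))

lemma contDiffOn_fieldX (ℓ : ℕ) (k : ℤ) {Ψ : ℝ → Fin 4 → ℂ} (hΨ : ContDiffOn ℝ 1 Ψ (Ioi 0)) :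
    ContDiffOn ℝ 1 (fieldX ℓ k Ψ) {0}ᶜ := by
  have h := fun i => contDiffOn_pi.mp hΨ i
  have hi : ContDiffOn ℝ 1 (fun r : ℝ => (r⁻¹ : ℂ)) (Ioi 0) :=
    Complex.ofRealCLM.contDiff.contDiffOn.inv fun r (hr : 0 < r) =>
      Complex.ofReal_ne_zero.mpr hr.ne'
  refine (contDiffOn_radialField (isAngular_familyX ℓ k)
    (c := fun r => ![Ψ r 0, Ψ r 1, Ψ r 2 * (r⁻¹ : ℂ), Ψ r 3 * (r⁻¹ : ℂ)]) ?_).congr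
    fun x hx => fieldX_eq_radialField ℓ k Ψ hx
  intro i
  fin_cases i
  · exact h 0
  · exact h 1
  · exact (h 2).mul hi
  · exact (h 3).mul hi

lemma differentiableAt_coeff {Ψ : ℝ → Fin 4 → ℂ} (hΨ : ContDiffOn ℝ 1 Ψ (Ioi 0)) {x : Space}
    (hx : x ≠ 0) (i : Fin 4) : DifferentiableAt ℝ (fun r => Ψ r i) ‖x‖ :=
  (((contDiffOn_pi.mp hΨ i).contDiffAt (Ioi_mem_nhds (norm_pos_iff.mpr hx)))).differentiableAt
    (by simp)

lemma beta_fieldX (ℓ : ℕ) (k : ℤ) (Ψ : ℝ → Fin 4 → ℂ) (x : Space) :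
    beta (fieldX ℓ k Ψ x) = fieldX ℓ k (fun r => ![Ψ r 0, -Ψ r 1, Ψ r 2, -Ψ r 3]) x := by
  simp only [fieldX, beta_block, Matrix.cons_val]
  congr 1
  rw [← smul_neg, ← Matrix.mulVec_neg]
  congr 2
  module

lemma beta_fieldY (ℓ : ℕ) (Θ : ℝ → Fin 2 → ℂ) (x : Space) :
    beta (fieldY ℓ Θ x) = fieldY ℓ (fun r => ![Θ r 0, -Θ r 1]) x := by
  simp only [fieldY, beta_block, Matrix.cons_val]
  congr 1
  rw [← smul_neg, ← Matrix.mulVec_neg]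
  congr 2
  module

namespace SolitaryWave

variable {S : Model} {ω : ℝ} (w : SolitaryWave S ω)

lemma potential_fieldX (ℓ : ℕ) (k : ℤ) (Ψ : ℝ → Fin 4 → ℂ) (x : Space) :
    w.potential x (fieldX ℓ k Ψ x) = fieldX ℓ k (fun r => ((S.g (w.tau r) : ℝ) : ℂ) •
      ![Ψ r 0, -Ψ r 1, Ψ r 2, -Ψ r 3]) x := by
  rw [potential, smul_apply, beta_fieldX, ← fieldX_smul]
  exact fieldX_congr rfl

lemma _root_.Soler.fieldY_congr {ℓ : ℕ} {Ψ Φ : ℝ → Fin 2 → ℂ} {x : Space} (h : Ψ ‖x‖ = Φ ‖x‖) :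
    fieldY ℓ Ψ x = fieldY ℓ Φ x := by
  simp only [fieldY, h]

lemma potential_fieldY (ℓ : ℕ) (Θ : ℝ → Fin 2 → ℂ) (x : Space) :
    w.potential x (fieldY ℓ Θ x) = fieldY ℓ (fun r => ((S.g (w.tau r) : ℝ) : ℂ) •
      ![Θ r 0, -Θ r 1]) x := by
  rw [potential, smul_apply, beta_fieldY, ← fieldY_smul]
  exact fieldY_congr rfl

lemma phi_eq (x : Space) : w.phi x = block ((w.v ‖x‖ : ℂ) • e 0)
    ((I * (w.u ‖x‖ : ℂ)) • (sigmaR x).mulVec (e 0)) := rfl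

lemma inner_phi_beta {x : Space} (hx : x ≠ 0) (a b : Fin 2 → ℂ) :
    inner ℂ (w.phi x) (beta (block a (I • (sigmaR x).mulVec b))) =
      w.v ‖x‖ * a 0 - w.u ‖x‖ * b 0 := by
  rw [phi_eq, beta_block, inner_block, star_smul, star_smul, smul_dotProduct, dotProduct_neg,
    smul_dotProduct, dotProduct_smul, star_sigmaR_dotProduct hx]
  have h : ∀ c : Fin 2 → ℂ, star (e 0) ⬝ᵥ c = c 0 := fun c => by
    simp [e, dotProduct, Fin.sum_univ_two]
  simp only [h, smul_eq_mul, star_mul, RCLike.star_def, conj_ofReal, conj_I]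
  linear_combination (w.u ‖x‖ : ℂ) * b 0 * I_sq

/-- Writing 2 Re z as z + conj z splits the map into a complex-linear and an antilinear part. -/
lemma rePotential_block {x : Space} (hx : x ≠ 0) (a b : Fin 2 → ℂ) :
    w.rePotential x (block a (I • (sigmaR x).mulVec b)) =
      ((deriv S.g (w.tau ‖x‖) : ℝ) : ℂ) • ((w.v ‖x‖ * a 0 - w.u ‖x‖ * b 0) +
        star (w.v ‖x‖ * a 0 - w.u ‖x‖ * b 0)) •
        block ((w.v ‖x‖ : ℂ) • e 0) (I • (sigmaR x).mulVec (-(w.u ‖x‖ : ℂ) • e 0)) := by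
  rw [rePotential_apply, w.inner_phi_beta hx, ← Complex.coe_smul, smul_smul, phi_eq, beta_block,
    RCLike.star_def, Complex.add_conj]
  congr 1
  · push_cast
    ring
  · rw [Matrix.mulVec_smul]
    congr 1
    module

/-- W has rank at most one: it is g' times the projector-like product of (v, -u) with itself. -/
lemma radialWBlock_eq (c : ℝ) (Ψ : ℝ → Fin 4 → ℂ) (r : ℝ) :
    w.radialWBlock c Ψ r = (((deriv S.g (w.tau r) : ℝ) : ℂ) *
      (w.v r * (Ψ r 0 + c / r * Ψ r 2) - w.u r * (Ψ r 1 + c / r * Ψ r 3))) •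
        ![(w.v r : ℂ), -w.u r, 0, 0] := by
  funext i
  fin_cases i <;> simp [radialWBlock, radialW] <;> ring

lemma fieldX_source (ℓ : ℕ) (k : ℤ) {Ψ : ℝ → Fin 4 → ℂ} {x : Space} {z v u : ℂ}
    (h : Ψ ‖x‖ = z • ![v, -u, 0, 0]) : fieldX ℓ k Ψ x =
      (z * harmonic ℓ k x) • block (v • e 0) (I • (sigmaR x).mulVec (-u • e 0)) := by
  simp only [fieldX, h, Pi.smul_apply, Matrix.cons_val, smul_eq_mul, mul_zero, zero_smul,
    add_zero, smul_block, harmonicVec, Matrix.mulVec_smul]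
  congr 1 <;> module

/-- The pairing of φ with βρ is a radial function times h_{ℓ,k}, the term σ_rΣh entering with the
factor -k/r. The linear part stays in the sector k; the antilinear part contains the conjugate
harmonic h_{ℓ,-k} and goes to the sector -k. -/
lemma rePotential_fieldX (ℓ : ℕ) (k : ℤ) (Ψ : ℝ → Fin 4 → ℂ) {x : Space} (hx : x ≠ 0) :
    w.rePotential x (fieldX ℓ k Ψ x) = fieldX ℓ k (w.radialWBlock (-k) Ψ) x +
      fieldX ℓ (-k) (conjVec (w.radialWBlock (-k) Ψ)) x := by
  have h1 := w.radialWBlock_eq (-k) Ψ ‖x‖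
  have h2 : conjVec (w.radialWBlock (-k) Ψ) ‖x‖ = star (((deriv S.g (w.tau ‖x‖) : ℝ) : ℂ) *
      (w.v ‖x‖ * (Ψ ‖x‖ 0 + (-k : ℝ) / ‖x‖ * Ψ ‖x‖ 2) -
        w.u ‖x‖ * (Ψ ‖x‖ 1 + (-k : ℝ) / ‖x‖ * Ψ ‖x‖ 3))) •
        ![(w.v ‖x‖ : ℂ), -w.u ‖x‖, 0, 0] := by
    funext i
    rw [conjVec, h1]
    fin_cases i <;> simp
  rw [fieldX_source ℓ k h1, fieldX_source ℓ (-k) h2, ← add_smul, fieldX, w.rePotential_block hx,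
    smul_smul]
  congr 1
  rw [← star_harmonic, ← star_mul']
  have h3 : w.v ‖x‖ * (Ψ ‖x‖ 0 • harmonicVec ℓ k 0 x + Ψ ‖x‖ 2 •
      (sigmaR x).mulVec (Sig (harmonicVec ℓ k 0) x)) 0 - w.u ‖x‖ * (Ψ ‖x‖ 1 • harmonicVec ℓ k 0 x +
        Ψ ‖x‖ 3 • (sigmaR x).mulVec (Sig (harmonicVec ℓ k 0) x)) 0 =
      (w.v ‖x‖ * (Ψ ‖x‖ 0 + (-k : ℝ) / ‖x‖ * Ψ ‖x‖ 2) -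
        w.u ‖x‖ * (Ψ ‖x‖ 1 + (-k : ℝ) / ‖x‖ * Ψ ‖x‖ 3)) * harmonic ℓ k x := by
    rw [Pi.add_apply, Pi.add_apply, Pi.smul_apply, Pi.smul_apply, Pi.smul_apply, Pi.smul_apply,
      sigmaR_Sig_harmonicVec_zero ℓ k hx, harmonicVec, Pi.smul_apply, e, Pi.single_eq_same]
    simp only [smul_eq_mul]
    push_cast
    ring
  rw [h3]
  simp only [RCLike.star_def, map_mul, conj_ofReal]
  ring

/-- Once σ_r is removed, φ is built on e₁ and the field on e₂, so their pairing vanishes pointwise.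
-/
lemma rePotential_fieldY (ℓ : ℕ) (Θ : ℝ → Fin 2 → ℂ) {x : Space} (hx : x ≠ 0) :
    w.rePotential x (fieldY ℓ Θ x) = 0 := by
  rw [fieldY, w.rePotential_block hx]
  simp [harmonicVec, e]

lemma coeFn_lin0 (ρ : w.lin0.domain) (ρ' : H1) (h : (ρ : L2) = ρ') :
    w.lin0 ρ =ᵐ[volume] fun x => D0 ρ' x + w.potential x ((ρ' : L2) x) - (ω : ℂ) • (ρ' : L2) x := by
  obtain rfl : ρ = ρ' := Subtype.ext h
  have h0 : w.lin0 ρ = D0 ρ + mulOp w.potential w.potential_aux.1 w.potential_aux.2 (ρ : L2) -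
    (ω : ℂ) • (ρ : L2) := rfl
  rw [h0]
  filter_upwards [Lp.coeFn_sub (D0 ρ + mulOp w.potential w.potential_aux.1 w.potential_aux.2
      (ρ : L2)) ((ω : ℂ) • (ρ : L2)), Lp.coeFn_add (D0 ρ) (mulOp w.potential w.potential_aux.1
      w.potential_aux.2 (ρ : L2)), Lp.coeFn_smul (ω : ℂ) (ρ : L2),
    coeFn_mulOp w.potential w.potential_aux.1 w.potential_aux.2 (ρ : L2)] with x h1 h2 h3 h4
  rw [h1, Pi.sub_apply, h2, Pi.add_apply, h3, Pi.smul_apply, h4]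

lemma lin_apply (ρ : w.lin.domain) (ρ' : w.lin0.domain) (h : (ρ : L2) = ρ') :
    w.lin ρ = w.lin0 ρ' + mulOp w.rePotential w.rePotential_aux.1 w.rePotential_aux.2 (ρ' : L2) := by
  obtain rfl : ρ = ρ' := Subtype.ext h
  rfl

lemma coeFn_lin (ρ : w.lin.domain) (ρ' : H1) (h : (ρ : L2) = ρ') :
    w.lin ρ =ᵐ[volume] fun x => D0 ρ' x + w.potential x ((ρ' : L2) x) - (ω : ℂ) • (ρ' : L2) x +
      w.rePotential x ((ρ' : L2) x) := by
  rw [w.lin_apply ρ ρ' h]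
  filter_upwards [w.coeFn_lin0 ρ' ρ' rfl, Lp.coeFn_add (w.lin0 ρ') (mulOp w.rePotential
      w.rePotential_aux.1 w.rePotential_aux.2 (ρ' : L2)),
    coeFn_mulOp w.rePotential w.rePotential_aux.1 w.rePotential_aux.2 (ρ' : L2)] with x h1 h2 h3
  rw [h2, Pi.add_apply, h1, h3]

lemma continuousOn_v : ContinuousOn w.v (Ioi 0) := fun r hr =>
  (w.differentiableAt_v r hr).continuousAt.continuousWithinAt

lemma continuousOn_u : ContinuousOn w.u (Ioi 0) := fun r hr =>
  (w.differentiableAt_u r hr).continuousAt.continuousWithinAt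

lemma continuousOn_tau : ContinuousOn w.tau (Ioi 0) :=
  (w.continuousOn_v.pow 2).sub (w.continuousOn_u.pow 2)

end SolitaryWave

/-- The profiles are arbitrary for r ≤ 0, whereas coefficients must be measurable on all of ℝ; only
r > 0 matters for the fields. -/
lemma exists_measurable_eqOn {f : ℝ → ℝ} (hf : ContinuousOn f (Ioi 0)) :
    ∃ f' : ℝ → ℂ, Measurable f' ∧ ∀ r, 0 < r → f' r = f r := by
  refine ⟨fun r => ((Ioi (0 : ℝ)).piecewise f 0 r : ℝ), Complex.measurable_ofReal.comp
    (hf.measurable_piecewise continuousOn_const measurableSet_Ioi), fun r hr => ?_⟩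
  simp only
  rw [Set.piecewise_eq_of_mem _ _ _ (show r ∈ Ioi 0 from hr)]

namespace SolitaryWave

variable {S : Model} {ω : ℝ} (w : SolitaryWave S ω)

lemma exists_measurable_radialWBlock (c : ℝ) {Ψ : ℝ → Fin 4 → ℂ} (hΨ : Measurable Ψ) :
    ∃ Φ : ℝ → Fin 4 → ℂ, Measurable Φ ∧ ∀ r, 0 < r → Φ r = w.radialWBlock c Ψ r := by
  obtain ⟨v, hv, hv'⟩ := exists_measurable_eqOn w.continuousOn_v
  obtain ⟨u, hu, hu'⟩ := exists_measurable_eqOn w.continuousOn_u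
  obtain ⟨γ, hγ, hγ'⟩ := exists_measurable_eqOn (S.continuous_deriv_g.comp_continuousOn
    w.continuousOn_tau)
  have h := fun k => measurable_pi_iff.mp hΨ k
  have hr : Measurable fun r : ℝ => (c / r : ℂ) :=
    measurable_const.div Complex.measurable_ofReal
  have hz : Measurable fun r : ℝ => γ r * (v r * (Ψ r 0 + c / r * Ψ r 2) -
      u r * (Ψ r 1 + c / r * Ψ r 3)) :=
    hγ.mul ((hv.mul ((h 0).add (hr.mul (h 2)))).sub (hu.mul ((h 1).add (hr.mul (h 3)))))
  refine ⟨fun r => (γ r * (v r * (Ψ r 0 + c / r * Ψ r 2) -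
      u r * (Ψ r 1 + c / r * Ψ r 3))) • ![v r, -u r, 0, 0],
    measurable_vec_four (hz.mul hv) (hz.mul hu.neg) (hz.mul measurable_const)
      (hz.mul measurable_const), fun r hr => ?_⟩
  beta_reduce
  rw [w.radialWBlock_eq, hv' r hr, hu' r hr, hγ' r hr]
  rfl

lemma exists_measurable_potential {Ψ : ℝ → Fin 4 → ℂ} (hΨ : Measurable Ψ) :
    ∃ Φ : ℝ → Fin 4 → ℂ, Measurable Φ ∧ ∀ r, 0 < r → Φ r = ((S.g (w.tau r) : ℝ) : ℂ) •
      ![Ψ r 0, -Ψ r 1, Ψ r 2, -Ψ r 3] := by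
  obtain ⟨γ, hγ, hγ'⟩ := exists_measurable_eqOn (S.continuous_g.comp_continuousOn
    w.continuousOn_tau)
  have h := fun k => measurable_pi_iff.mp hΨ k
  refine ⟨fun r => γ r • ![Ψ r 0, -Ψ r 1, Ψ r 2, -Ψ r 3], measurable_vec_four (hγ.mul (h 0))
    (hγ.mul (h 1).neg) (hγ.mul (h 2)) (hγ.mul (h 3).neg), fun r hr => ?_⟩
  beta_reduce
  rw [hγ' r hr]
  rfl

lemma conjVec_congr {Ψ Φ : ℝ → Fin 4 → ℂ} {r : ℝ} (h : Ψ r = Φ r) :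
    conjVec Ψ r = conjVec Φ r := by
  funext i
  rw [conjVec, conjVec, h]

lemma measurable_conjVec {Ψ : ℝ → Fin 4 → ℂ} (hΨ : Measurable Ψ) : Measurable (conjVec Ψ) :=
  measurable_pi_lambda _ fun k => continuous_star.measurable.comp (measurable_pi_iff.mp hΨ k)

lemma mulOp_potential_mem_Y (ℓ : ℕ) {f : L2} (hf : f ∈ Y ℓ) :
    mulOp w.potential w.potential_aux.1 w.potential_aux.2 f ∈ Y ℓ := by
  obtain ⟨Θ, hΘ, hf⟩ := hf
  obtain ⟨γ, hγ, hγ'⟩ := exists_measurable_eqOn (S.continuous_g.comp_continuousOn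
    w.continuousOn_tau)
  have h := fun k => measurable_pi_iff.mp hΘ k
  refine ⟨fun r => γ r • ![Θ r 0, -Θ r 1], measurable_vec_two (hγ.mul (h 0))
    (hγ.mul (h 1).neg), ?_⟩
  filter_upwards [coeFn_mulOp w.potential w.potential_aux.1 w.potential_aux.2 f, hf, ae_ne_zero]
    with x h1 h2 hx
  rw [h1, h2, w.potential_fieldY]
  refine fieldY_congr ?_
  rw [hγ' _ (norm_pos_iff.mpr hx)]
  rfl

lemma mulOp_rePotential_Y (ℓ : ℕ) {f : L2} (hf : f ∈ Y ℓ) :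
    mulOp w.rePotential w.rePotential_aux.1 w.rePotential_aux.2 f = 0 := by
  obtain ⟨Θ, -, hf⟩ := hf
  refine Lp.ext ?_
  filter_upwards [coeFn_mulOp w.rePotential w.rePotential_aux.1 w.rePotential_aux.2 f, hf,
    ae_ne_zero, Lp.coeFn_zero Spinor 2 (volume : Measure Space)] with x h1 h2 hx h0
  rw [h1, h2, w.rePotential_fieldY ℓ Θ hx, h0, Pi.zero_apply]

lemma mulOp_potential_mem_X0 (ℓ : ℕ) {f : L2} (hf : f ∈ X0 ℓ) :
    mulOp w.potential w.potential_aux.1 w.potential_aux.2 f ∈ X0 ℓ := by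
  obtain ⟨Ψ, hΨ, hf⟩ := hf
  obtain ⟨Φ, hΦ, hΦ'⟩ := w.exists_measurable_potential hΨ
  refine ⟨Φ, hΦ, ?_⟩
  filter_upwards [coeFn_mulOp w.potential w.potential_aux.1 w.potential_aux.2 f, hf, ae_ne_zero]
    with x h1 h2 hx
  rw [h1, h2, w.potential_fieldX]
  exact (fieldX_congr (hΦ' _ (norm_pos_iff.mpr hx))).symm

lemma mulOp_potential_mem_X (ℓ m : ℕ) {f : L2} (hf : f ∈ X ℓ m) :
    mulOp w.potential w.potential_aux.1 w.potential_aux.2 f ∈ X ℓ m := by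
  obtain ⟨Ψp, Ψm, hp, hm, hf⟩ := hf
  obtain ⟨Φp, hΦp, hΦp'⟩ := w.exists_measurable_potential hp
  obtain ⟨Φm, hΦm, hΦm'⟩ := w.exists_measurable_potential hm
  refine ⟨Φp, Φm, hΦp, hΦm, ?_⟩
  filter_upwards [coeFn_mulOp w.potential w.potential_aux.1 w.potential_aux.2 f, hf, ae_ne_zero]
    with x h1 h2 hx
  rw [h1, h2, map_add, w.potential_fieldX, w.potential_fieldX]
  exact congrArg₂ _ (fieldX_congr (hΦp' _ (norm_pos_iff.mpr hx))).symm
    (fieldX_congr (hΦm' _ (norm_pos_iff.mpr hx))).symm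

lemma mulOp_rePotential_mem_X0 (ℓ : ℕ) {f : L2} (hf : f ∈ X0 ℓ) :
    mulOp w.rePotential w.rePotential_aux.1 w.rePotential_aux.2 f ∈ X0 ℓ := by
  obtain ⟨Ψ, hΨ, hf⟩ := hf
  obtain ⟨Φ, hΦ, hΦ'⟩ := w.exists_measurable_radialWBlock (-(0 : ℤ)) hΨ
  refine ⟨Φ + conjVec Φ, hΦ.add (measurable_conjVec hΦ), ?_⟩
  filter_upwards [coeFn_mulOp w.rePotential w.rePotential_aux.1 w.rePotential_aux.2 f, hf,
    ae_ne_zero] with x h1 h2 hx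
  have h := hΦ' _ (norm_pos_iff.mpr hx)
  rw [h1, h2, w.rePotential_fieldX ℓ 0 Ψ hx, fieldX_add, neg_zero]
  exact congrArg₂ _ (fieldX_congr h).symm (fieldX_congr (conjVec_congr h.symm))

lemma mulOp_rePotential_mem_X (ℓ m : ℕ) {f : L2} (hf : f ∈ X ℓ m) :
    mulOp w.rePotential w.rePotential_aux.1 w.rePotential_aux.2 f ∈ X ℓ m := by
  obtain ⟨Ψp, Ψm, hp, hm, hf⟩ := hf
  obtain ⟨Φp, hΦp, hΦp'⟩ := w.exists_measurable_radialWBlock (-((m : ℤ) : ℝ)) hp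
  obtain ⟨Φm, hΦm, hΦm'⟩ := w.exists_measurable_radialWBlock (-((-m : ℤ) : ℝ)) hm
  -- Each sector receives its own linear part and the antilinear part of the opposite sector.
  refine ⟨Φp + conjVec Φm, conjVec Φp + Φm, hΦp.add (measurable_conjVec hΦm),
    (measurable_conjVec hΦp).add hΦm, ?_⟩
  filter_upwards [coeFn_mulOp w.rePotential w.rePotential_aux.1 w.rePotential_aux.2 f, hf,
    ae_ne_zero] with x h1 h2 hx
  have h3 := hΦp' _ (norm_pos_iff.mpr hx)
  have h4 := hΦm' _ (norm_pos_iff.mpr hx)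
  rw [h1, h2, map_add, w.rePotential_fieldX ℓ m Ψp hx, w.rePotential_fieldX ℓ (-m) Ψm hx,
    fieldX_add, fieldX_add, neg_neg, fieldX_congr h3, fieldX_congr h4,
    fieldX_congr (Ψ := conjVec Φp) (Φ := conjVec (w.radialWBlock (-((m : ℤ) : ℝ)) Ψp))
      (conjVec_congr h3),
    fieldX_congr (Ψ := conjVec Φm) (Φ := conjVec (w.radialWBlock (-((-m : ℤ) : ℝ)) Ψm))
      (conjVec_congr h4)]
  abel

lemma lin_eq (ρ : w.lin.domain) (ρ' : H1) (h : (ρ : L2) = ρ') :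
    w.lin ρ = D0 ρ' + mulOp w.potential w.potential_aux.1 w.potential_aux.2 (ρ' : L2) -
      (ω : ℂ) • (ρ' : L2) +
      mulOp w.rePotential w.rePotential_aux.1 w.rePotential_aux.2 (ρ' : L2) := by
  obtain rfl : ρ = ρ' := Subtype.ext h
  rfl

lemma isInvariant_of {M : Submodule ℂ L2} (h1 : ∀ f : H1, (f : L2) ∈ M → D0 f ∈ M)
    (h2 : ∀ f ∈ M, mulOp w.potential w.potential_aux.1 w.potential_aux.2 f ∈ M)
    (h3 : ∀ f ∈ M, mulOp w.rePotential w.rePotential_aux.1 w.rePotential_aux.2 f ∈ M) :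
    IsInvariant w.lin M := by
  intro ρ hρ
  have h := add_mem (sub_mem (add_mem (h1 ⟨ρ, ρ.2⟩ hρ) (h2 _ hρ))
    (M.smul_mem (ω : ℂ) hρ)) (h3 _ hρ)
  exact (congrArg (· ∈ M) (w.lin_eq ρ ⟨ρ, ρ.2⟩ rfl)).mpr h

theorem isInvariant_X0 (ℓ : ℕ) : IsInvariant w.lin (X0 ℓ) := by
  refine w.isInvariant_of (fun f hf => ?_) (fun f hf => w.mulOp_potential_mem_X0 ℓ hf)
    (fun f hf => w.mulOp_rePotential_mem_X0 ℓ hf)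
  rw [X0_eq] at hf ⊢
  exact (isAngular_familyX ℓ 0).D0_mem _ hf

theorem isInvariant_X (ℓ m : ℕ) : IsInvariant w.lin (X ℓ m) := by
  refine w.isInvariant_of (fun f hf => ?_) (fun f hf => w.mulOp_potential_mem_X ℓ m hf)
    (fun f hf => w.mulOp_rePotential_mem_X ℓ m hf)
  rw [X_eq] at hf ⊢
  exact (isAngular_sumElim (isAngular_familyX ℓ m) (isAngular_familyX ℓ (-m))).D0_mem _ hf

lemma D0_mem_Y (ℓ : ℕ) (f : H1) (hf : (f : L2) ∈ Y ℓ) : D0 f ∈ Y ℓ := by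
  rw [Y_eq] at hf ⊢
  exact (isAngular_familyY ℓ).D0_mem f hf

theorem isInvariant_Y (ℓ : ℕ) : IsInvariant w.lin (Y ℓ) := by
  refine w.isInvariant_of (D0_mem_Y ℓ) (fun f hf => w.mulOp_potential_mem_Y ℓ hf)
    fun f hf => ?_
  rw [w.mulOp_rePotential_Y ℓ hf]
  exact zero_mem _

end SolitaryWave

end

/-! ### Self-adjointness of ℒ₀ and the spectrum on 𝒴 -/

section

section SelfAdjoint

variable {H : Type*} [NormedAddCommGroup H] [InnerProductSpace ℂ H] {D : Submodule ℂ H}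
  {A : D →ₗ[ℂ] H}

/-- Since ⟨x, Ax⟩ is real, the imaginary part of ⟨x, (A - z)x⟩ is -Im z ‖x‖²; Cauchy–Schwarz
concludes. -/
lemma im_mul_norm_le_of_symmetric (hA : ∀ x y : D, inner ℂ (A x) (y : H) = inner ℂ (x : H) (A y))
    (z : ℂ) (x : D) : |z.im| * ‖(x : H)‖ ≤ ‖A x - z • (x : H)‖ := by
  have h1 : (inner ℂ (x : H) (A x)).im = 0 := by
    have h := congrArg Complex.im (inner_conj_symm (𝕜 := ℂ) (x : H) (A x))
    rw [hA x x, Complex.conj_im] at h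
    linarith
  have h2 : (inner ℂ (x : H) (A x - z • (x : H))).im = -(z.im * ‖(x : H)‖ ^ 2) := by
    have h3 : inner ℂ (x : H) (x : H) = ((‖(x : H)‖ ^ 2 : ℝ) : ℂ) := by
      rw [inner_self_eq_norm_sq_to_K]
      norm_cast
    rw [inner_sub_right, inner_smul_right, Complex.sub_im, h1, h3, Complex.im_mul_ofReal, zero_sub]
  have h4 : |z.im| * ‖(x : H)‖ ^ 2 ≤ ‖(x : H)‖ * ‖A x - z • (x : H)‖ := by
    calc |z.im| * ‖(x : H)‖ ^ 2 = |(inner ℂ (x : H) (A x - z • (x : H))).im| := by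
          rw [h2, abs_neg, abs_mul, abs_of_nonneg (sq_nonneg ‖(x : H)‖)]
      _ ≤ ‖inner ℂ (x : H) (A x - z • (x : H))‖ := Complex.abs_im_le_norm _
      _ ≤ _ := norm_inner_le_norm _ _
  rcases (norm_nonneg (x : H)).eq_or_lt with h | h
  · rw [← h, mul_zero]
    exact norm_nonneg _
  · refine le_of_mul_le_mul_left ?_ h
    nlinarith

variable [CompleteSpace H]

/-- The resolvent equation of a self-adjoint operator is solvable off the real axis. -/
lemma exists_resolvent_of_selfAdjoint
    (hA : ∀ x y : D, inner ℂ (A x) (y : H) = inner ℂ (x : H) (A y))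
    (hmax : ∀ x g : H, (∀ y : D, inner ℂ (A y) x = inner ℂ (y : H) g) →
      ∃ hx : x ∈ D, A ⟨x, hx⟩ = g) {z : ℂ} (hz : z.im ≠ 0) (y : H) :
    ∃ x : D, A x - z • (x : H) = y := by
  set B : D →ₗ[ℂ] H := A - z • D.subtype with hB
  have hBx : ∀ x : D, B x = A x - z • (x : H) := fun x => rfl
  have hz0 : 0 < |z.im| := abs_pos.mpr hz
  -- The lower bound makes preimages of a convergent sequence Cauchy. Their limit satisfies the
  -- equation weakly, and maximality puts it into the domain.
  have hclosed : IsClosed (LinearMap.range B : Set H) := by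
    refine isClosed_of_closure_subset fun y hy => ?_
    obtain ⟨u, hu, huy⟩ := mem_closure_iff_seq_limit.mp hy
    choose x hx using hu
    have hcau : CauchySeq fun n => (x n : H) := by
      rw [Metric.cauchySeq_iff']
      intro ε hε
      obtain ⟨N, hN⟩ := Metric.cauchySeq_iff'.mp huy.cauchySeq (|z.im| * ε) (by positivity)
      refine ⟨N, fun n hn => ?_⟩
      have h1 := hN n hn
      have h2 := im_mul_norm_le_of_symmetric hA z (x n - x N)
      rw [← hBx, map_sub, hx, hx, Submodule.coe_sub, ← dist_eq_norm, ← dist_eq_norm] at h2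
      exact lt_of_mul_lt_mul_left (h2.trans_lt h1) hz0.le
    obtain ⟨x₀, hx₀⟩ := cauchySeq_tendsto_of_complete hcau
    obtain ⟨hxD, hA0⟩ := hmax x₀ (y + z • x₀) fun t => by
      have h1 : Filter.Tendsto (fun n => inner ℂ (A t) (x n : H)) Filter.atTop
          (nhds (inner ℂ (A t) x₀)) := tendsto_const_nhds.inner hx₀
      have h2 : Filter.Tendsto (fun n => inner ℂ (t : H) (u n + z • (x n : H))) Filter.atTop
          (nhds (inner ℂ (t : H) (y + z • x₀))) :=
        tendsto_const_nhds.inner (huy.add (hx₀.const_smul z))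
      refine tendsto_nhds_unique h1 (h2.congr fun n => ?_)
      rw [hA, ← hx n, hBx, sub_add_cancel]
    exact ⟨⟨x₀, hxD⟩, by rw [hBx, hA0, add_sub_cancel_right]⟩
  -- A vector orthogonal to the range satisfies Ax = conj(z) x by maximality, so the lower bound at
  -- conj z makes it zero.
  have hperp : (LinearMap.range B)ᗮ = ⊥ := by
    rw [Submodule.eq_bot_iff]
    intro x hx
    have h1 : ∀ t : D, inner ℂ (A t) x = inner ℂ (t : H) (star z • x) := fun t => by
      have h := (Submodule.mem_orthogonal _ x).mp hx (B t) ⟨t, rfl⟩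
      rw [hBx, inner_sub_left, inner_smul_left, sub_eq_zero] at h
      rw [h, inner_smul_right]
      rfl
    obtain ⟨hxD, hAx⟩ := hmax x _ h1
    have h2 := im_mul_norm_le_of_symmetric hA (star z) ⟨x, hxD⟩
    rw [hAx, sub_self, norm_zero] at h2
    have h3 : 0 < |(star z).im| := by simpa using hz
    exact norm_le_zero_iff.mp (nonpos_of_mul_nonpos_right h2 h3)
  have hrange : LinearMap.range B = ⊤ := by
    have : CompleteSpace (LinearMap.range B) := hclosed.completeSpace_coe
    exact Submodule.orthogonal_eq_bot_iff.mp hperp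
  have hy : y ∈ LinearMap.range B := hrange ▸ Submodule.mem_top
  exact hy

/-- Symmetry says that the adjoint extends A; maximality says that the domain of the adjoint is no
larger. -/
lemma isSelfAdjoint_of_maximal {A : H →ₗ.[ℂ] H} (hd : Dense (A.domain : Set H))
    (hA : ∀ x y : A.domain, inner ℂ (A x) (y : H) = inner ℂ (x : H) (A y))
    (hmax : ∀ x g : H, (∀ y : A.domain, inner ℂ (A y) x = inner ℂ (y : H) g) →
      ∃ hx : x ∈ A.domain, A ⟨x, hx⟩ = g) : IsSelfAdjoint A := by
  rw [LinearPMap.isSelfAdjoint_def]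
  have hle : A ≤ A.adjoint := LinearPMap.IsFormalAdjoint.le_adjoint hd fun x y => hA x y
  refine (LinearPMap.eq_of_le_of_domain_eq hle (le_antisymm hle.1 fun x hx => ?_)).symm
  obtain ⟨h, -⟩ := hmax x (A.adjoint ⟨x, hx⟩) fun y => by
    have h := LinearPMap.adjoint_isFormalAdjoint hd ⟨x, hx⟩ y
    rw [← inner_conj_symm, ← inner_conj_symm (y : H)]
    exact congrArg _ h.symm
  exact h

end SelfAdjoint

/-- A point is not in the spectrum if the resolvent equation is solvable with a bound. -/
lemma notMem_spec {H : Type*} [NormedAddCommGroup H] [NormedSpace ℂ H] (T : H →ₗ.[ℂ] H) {z : ℂ}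
    {c : ℝ} (hc : 0 < c) (hbound : ∀ x : T.domain, c * ‖(x : H)‖ ≤ ‖T x - z • (x : H)‖)
    (hsurj : ∀ y : H, ∃ x : T.domain, T x - z • (x : H) = y) : z ∉ spec T := by
  set B : T.domain →ₗ[ℂ] H := T.toFun - z • T.domain.subtype with hB
  have hBx : ∀ x : T.domain, B x = T x - z • (x : H) := fun x => rfl
  have hinj : Function.Injective B := by
    refine (injective_iff_map_eq_zero B).mpr fun x hx => ?_
    have h := hbound x
    rw [← hBx, hx, norm_zero] at h
    exact Subtype.ext (norm_le_zero_iff.mp (nonpos_of_mul_nonpos_right h hc))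
  set eq := LinearEquiv.ofBijective B ⟨hinj, hsurj⟩
  have heq : ∀ y, B (eq.symm y) = y := fun y => eq.apply_symm_apply y
  have hnot : ¬ z ∈ spec T ↔ ∃ R : H →L[ℂ] H,
    (∀ y : H, ∃ hy : R y ∈ T.domain, T ⟨R y, hy⟩ - z • R y = y) ∧
    ∀ x : T.domain, R (T x - z • (x : H)) = x := not_not
  rw [hnot]
  refine ⟨LinearMap.mkContinuous (T.domain.subtype ∘ₗ eq.symm.toLinearMap) c⁻¹ fun y => ?_,
    fun y => ⟨(eq.symm y).2, heq y⟩, fun x => ?_⟩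
  · have h := hbound (eq.symm y)
    rw [← hBx, heq] at h
    rw [inv_mul_eq_div, le_div_iff₀' hc]
    exact h
  · exact congrArg Subtype.val (eq.symm_apply_apply x)

/-- The identity -iT - z = -i(T - iz) transfers the resolvent equation, and -i is a unitary factor.
-/
lemma notMem_spec_neg_I_smul {H : Type*} [NormedAddCommGroup H] [NormedSpace ℂ H]
    (T : H →ₗ.[ℂ] H) {z : ℂ} {c : ℝ} (hc : 0 < c)
    (hbound : ∀ x : T.domain, c * ‖(x : H)‖ ≤ ‖T x - (I * z) • (x : H)‖)
    (hsurj : ∀ y : H, ∃ x : T.domain, T x - (I * z) • (x : H) = y) : z ∉ spec ((-I) • T) := by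
  have hT : ∀ x : T.domain, ((-I) • T) x - z • (x : H) = (-I) • (T x - (I * z) • (x : H)) :=
    fun x => by
      rw [LinearPMap.smul_apply, smul_sub, smul_smul, ← mul_assoc, neg_mul, I_mul_I, neg_neg,
        one_mul]
  refine notMem_spec ((-I) • T) hc (fun x => ?_) fun y => ?_
  · rw [hT, norm_smul, norm_neg, norm_I, one_mul]
    exact hbound x
  · obtain ⟨x, hx⟩ := hsurj (I • y)
    refine ⟨x, ?_⟩
    rw [hT, hx, smul_smul, neg_mul, I_mul_I, neg_neg, one_smul]

section Restriction

variable {H : Type*} [NormedAddCommGroup H] [InnerProductSpace ℂ H] {D M : Submodule ℂ H}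
  {A : D →ₗ[ℂ] H}

/-- The restriction of an operator to an invariant subspace. -/
def restrictPMap (A : D →ₗ[ℂ] H) (hM : ∀ x : D, (x : H) ∈ M → A x ∈ M) : M →ₗ.[ℂ] M where
  domain := D.comap M.subtype
  toFun := LinearMap.codRestrict M (A ∘ₗ LinearMap.restrict M.subtype
      (p := D.comap M.subtype) (q := D) fun _ h => h) fun y => hM _ y.1.2

lemma coe_restrictPMap (hM : ∀ x : D, (x : H) ∈ M → A x ∈ M) (y : M) (hy : (y : H) ∈ D) :
    (restrictPMap A hM ⟨y, hy⟩ : H) = A ⟨y, hy⟩ := rfl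

/-- For Re z ≠ 0 the point iz is off the real axis, so (A - iz)f = y is solvable in the whole space.
When y lies in M the projection of f solves the same equation inside M, since the projection
commutes with A; the lower bound is inherited by the restriction. -/
theorem spec_restrictPMap [CompleteSpace H] [M.HasOrthogonalProjection]
    (hA : ∀ x y : D, inner ℂ (A x) (y : H) = inner ℂ (x : H) (A y))
    (hmax : ∀ x g : H, (∀ y : D, inner ℂ (A y) x = inner ℂ (y : H) g) →
      ∃ hx : x ∈ D, A ⟨x, hx⟩ = g)
    (hP : ∀ x : D, ∃ h : M.starProjection (x : H) ∈ D,
      A ⟨_, h⟩ = M.starProjection (A x)) (hM : ∀ x : D, (x : H) ∈ M → A x ∈ M) :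
    spec ((-I) • restrictPMap A hM) ⊆ {z : ℂ | z.re = 0} := by
  intro z hz
  by_contra hre
  have him : (I * z).im = z.re := by simp
  have hpos : 0 < |(I * z).im| := by
    rw [him]
    exact abs_pos.mpr hre
  refine notMem_spec_neg_I_smul (restrictPMap A hM) hpos (fun x => ?_) (fun y => ?_) hz
  · exact im_mul_norm_le_of_symmetric hA (I * z) ⟨((x : M) : H), x.2⟩
  · obtain ⟨f, hf⟩ := exists_resolvent_of_selfAdjoint hA hmax (abs_pos.mp hpos) (y : H)
    obtain ⟨hPD, hPf⟩ := hP f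
    refine ⟨⟨⟨_, M.starProjection_apply_mem (f : H)⟩, hPD⟩, Subtype.ext ?_⟩
    rw [Submodule.coe_sub, coe_restrictPMap, Submodule.coe_smul, hPf, ← map_smul, ← map_sub, hf]
    exact Submodule.starProjection_eq_self_iff.mpr y.2

end Restriction

lemma beta_isSelfAdjoint (x y : Spinor) : inner ℂ (beta x) y = inner ℂ x (beta y) := by
  have h : (Matrix.fromBlocks 1 0 0 (-1) : Matrix (Fin 2 ⊕ Fin 2) (Fin 2 ⊕ Fin 2) ℂ).IsHermitian := by
    rw [Matrix.IsHermitian, Matrix.fromBlocks_conjTranspose]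
    simp
  rw [beta, ← ContinuousLinearMap.adjoint_inner_right, ← ContinuousLinearMap.star_eq_adjoint,
    ← map_star, Matrix.star_eq_conjTranspose, h.eq]

namespace SolitaryWave

variable {S : Model} {ω : ℝ} (w : SolitaryWave S ω)

lemma inner_mulOp_potential (f g : L2) :
    inner ℂ (mulOp w.potential w.potential_aux.1 w.potential_aux.2 f) g =
      inner ℂ f (mulOp w.potential w.potential_aux.1 w.potential_aux.2 g) := by
  rw [L2.inner_def, L2.inner_def]
  refine integral_congr_ae ?_
  filter_upwards [coeFn_mulOp w.potential w.potential_aux.1 w.potential_aux.2 f,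
    coeFn_mulOp w.potential w.potential_aux.1 w.potential_aux.2 g] with x hf hg
  rw [hf, hg, potential, smul_apply, smul_apply, inner_smul_left, inner_smul_right,
    beta_isSelfAdjoint, conj_ofReal]

lemma linMap_apply (f : H1) : w.linMap f = D0 f +
    mulOp w.potential w.potential_aux.1 w.potential_aux.2 (f : L2) - (ω : ℂ) • (f : L2) := rfl

lemma linMap_symmetric (f g : H1) : inner ℂ (w.linMap f) (g : L2) = inner ℂ (f : L2) (w.linMap g) := by
  rw [linMap_apply, linMap_apply, inner_sub_left, inner_add_left, inner_sub_right, inner_add_right,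
    D0_symmetric, w.inner_mulOp_potential, inner_smul_left, inner_smul_right, conj_ofReal]

/-- The bounded symmetric terms gβ and ω are moved to the right-hand side, which leaves the weak
equation for D₀ alone. -/
lemma linMap_maximal (x g : L2)
    (h : ∀ y : H1, inner ℂ (w.linMap y) x = inner ℂ (y : L2) g) :
    ∃ hx : x ∈ H1, w.linMap ⟨x, hx⟩ = g := by
  obtain ⟨hx, hD⟩ := mem_H1_of_inner_test (f := x)
    (g := g - mulOp w.potential w.potential_aux.1 w.potential_aux.2 x + (ω : ℂ) • x) fun η hη => by
      have h1 := h hη.toH1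
      rw [linMap_apply, inner_sub_left, inner_add_left, w.inner_mulOp_potential, inner_smul_left,
        conj_ofReal] at h1
      rw [inner_add_right, inner_sub_right, inner_smul_right, ← h1]
      ring
  exact ⟨hx, by rw [linMap_apply, hD]; abel⟩

theorem isSelfAdjoint_lin0 : IsSelfAdjoint w.lin0 :=
  isSelfAdjoint_of_maximal (A := w.lin0) dense_H1 w.linMap_symmetric w.linMap_maximal

theorem lin_eq_lin0 (ℓ : ℕ) (ρ : w.lin.domain) (ρ' : w.lin0.domain) (h : (ρ : L2) ∈ Y ℓ)
    (h' : (ρ : L2) = ρ') : w.lin ρ = w.lin0 ρ' := by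
  rw [w.lin_apply ρ ρ' h', w.mulOp_rePotential_Y ℓ (h' ▸ h), add_zero]

lemma linMap_mem_Y (ℓ : ℕ) (f : H1) (hf : (f : L2) ∈ Y ℓ) : w.linMap f ∈ Y ℓ :=
  sub_mem (add_mem (D0_mem_Y ℓ f hf) (w.mulOp_potential_mem_Y ℓ hf))
    ((Y ℓ).smul_mem (ω : ℂ) hf)

/-- The restriction of `ℒ₀` to `𝒴_ℓ`. -/
def linY (ℓ : ℕ) : Y ℓ →ₗ.[ℂ] Y ℓ := restrictPMap w.linMap (w.linMap_mem_Y ℓ)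

lemma isRestriction_linY (ℓ : ℕ) : IsRestriction w.lin (Y ℓ) (w.linY ℓ) := by
  refine ⟨fun y => Iff.rfl, fun y ρ h => ?_⟩
  have h1 := w.lin_eq_lin0 ℓ ρ ⟨ρ, ρ.2⟩ (h ▸ y.1.2) rfl
  obtain ⟨r, hr⟩ := ρ
  obtain rfl : r = ((y : Y ℓ) : L2) := h
  exact h1.symm

lemma _root_.Soler.hasOrthogonalProjection_Y (ℓ : ℕ) : (Y ℓ).HasOrthogonalProjection := by
  rw [Y_eq]
  exact (isAngular_familyY ℓ).hasOrthogonalProjection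

lemma _root_.Soler.starProjection_Y_mem_H1 (ℓ : ℕ) [inst : (Y ℓ).HasOrthogonalProjection] (f : H1) :
    ∃ h : (Y ℓ).starProjection (f : L2) ∈ H1, D0 ⟨_, h⟩ = (Y ℓ).starProjection (D0 f) := by
  revert inst
  rw [Y_eq]
  intro inst
  exact (isAngular_familyY ℓ).starProjection_mem_H1 f

/-- A symmetric operator that preserves a subspace preserves its orthogonal complement, hence
commutes with the projection. -/
lemma starProjection_mulOp_potential (ℓ : ℕ) [(Y ℓ).HasOrthogonalProjection] (f : L2) :
    (Y ℓ).starProjection (mulOp w.potential w.potential_aux.1 w.potential_aux.2 f) =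
      mulOp w.potential w.potential_aux.1 w.potential_aux.2 ((Y ℓ).starProjection f) := by
  refine Submodule.eq_starProjection_of_mem_of_inner_eq_zero
    (w.mulOp_potential_mem_Y ℓ (Submodule.starProjection_apply_mem _ _)) fun y hy => ?_
  rw [← map_sub, w.inner_mulOp_potential]
  exact Submodule.starProjection_inner_eq_zero _ _ (w.mulOp_potential_mem_Y ℓ hy)

lemma _root_.Soler.map_add_sub_smul {H : Type*} [NormedAddCommGroup H] [NormedSpace ℂ H]
    (P : H →L[ℂ] H) (a b d : H) (c : ℂ) : P (a + b - c • d) = P a + P b - c • P d := by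
  rw [map_sub, map_add, map_smul]

lemma starProjection_linMap (ℓ : ℕ) [(Y ℓ).HasOrthogonalProjection] (f : H1) :
    ∃ h : (Y ℓ).starProjection (f : L2) ∈ H1,
      w.linMap ⟨_, h⟩ = (Y ℓ).starProjection (w.linMap f) := by
  obtain ⟨h, hD⟩ := starProjection_Y_mem_H1 ℓ f
  refine ⟨h, ?_⟩
  have h1 := map_add_sub_smul (Y ℓ).starProjection (D0 f)
    (mulOp w.potential w.potential_aux.1 w.potential_aux.2 (f : L2)) (f : L2) (ω : ℂ)
  rw [← hD, w.starProjection_mulOp_potential] at h1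
  exact h1.symm

theorem spec_linY (ℓ : ℕ) : spec ((-I) • w.linY ℓ) ⊆ {z : ℂ | z.re = 0} := by
  have := hasOrthogonalProjection_Y ℓ
  exact spec_restrictPMap w.linMap_symmetric w.linMap_maximal (w.starProjection_linMap ℓ)
    (w.linMap_mem_Y ℓ)

end SolitaryWave

end

/-! ### Radial reduction of the linearized operator -/

section

lemma fieldX_smul_sum (ℓ : ℕ) (k : ℤ) (c a : ℂ) (Ψ₁ Ψ₂ Ψ₃ Ψ₄ Ψ₅ : ℝ → Fin 4 → ℂ) (x : Space) :
    fieldX ℓ k (c • (Ψ₁ + Ψ₂ - a • Ψ₃ + (Ψ₄ + Ψ₅))) x =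
      c • (fieldX ℓ k Ψ₁ x + fieldX ℓ k Ψ₂ x - a • fieldX ℓ k Ψ₃ x +
        (fieldX ℓ k Ψ₄ x + fieldX ℓ k Ψ₅ x)) := by
  rw [sub_eq_add_neg (Ψ₁ + Ψ₂), ← neg_smul]
  simp only [fieldX_smul, fieldX_add]
  rw [neg_smul, ← sub_eq_add_neg]

namespace SolitaryWave

variable {S : Model} {ω : ℝ} (w : SolitaryWave S ω)

lemma radialL0_eq (ℓ : ℕ) (Ψ : ℝ → Fin 4 → ℂ) (r : ℝ) :
    w.radialL0 ℓ Ψ r = diracRadial ℓ Ψ r +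
      ((S.g (w.tau r) : ℝ) : ℂ) • ![Ψ r 0, -Ψ r 1, Ψ r 2, -Ψ r 3] - (ω : ℂ) • Ψ r := by
  funext i
  fin_cases i <;> simp [radialL0, diracRadial] <;> ring

lemma conjVec_radialWBlock (c : ℝ) (Ψ : ℝ → Fin 4 → ℂ) (r : ℝ) :
    conjVec (w.radialWBlock c Ψ) r = w.radialWBlock c (conjVec Ψ) r := by
  funext i
  rw [conjVec, radialWBlock_eq, radialWBlock_eq]
  fin_cases i <;> simp [conjVec]

/-- All coefficients of the radial operator are real, so it commutes with conjugation. -/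
lemma conjVec_radialL0 (ℓ : ℕ) (Ψ : ℝ → Fin 4 → ℂ) (r : ℝ) :
    conjVec (w.radialL0 ℓ Ψ) r = w.radialL0 ℓ (conjVec Ψ) r := by
  have h : ∀ i, deriv (fun s => conjVec Ψ s i) r = star (deriv (fun s => Ψ s i) r) := fun i =>
    deriv.star
  funext i
  fin_cases i <;> simp [conjVec, radialL0] at h ⊢ <;> simp [h]

lemma conjVec_conjVec (Ψ : ℝ → Fin 4 → ℂ) : conjVec (conjVec Ψ) = Ψ := by
  funext r i
  simp [conjVec]

/-- At order zero the terms ±k/r disappear and the two W blocks coincide. Conjugation then exchanges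
them, while conjugating -i accounts for the opposite sign of the second row. -/
lemma radialA_zero_snd (ℓ : ℕ) (Ψ : ℝ → Fin 4 → ℂ) (r : ℝ) :
    (w.radialA ℓ 0 (Ψ, conjVec Ψ)).2 r = conjVec (w.radialA ℓ 0 (Ψ, conjVec Ψ)).1 r := by
  have h : ∀ (Φ : ℝ → Fin 4 → ℂ), conjVec (fun r => (-I) • Φ r) r = I • conjVec Φ r := fun Φ => by
    funext i
    simp [conjVec]
  have hadd : ∀ Φ Φ' : ℝ → Fin 4 → ℂ, conjVec (fun r => Φ r + Φ' r) r =
      conjVec Φ r + conjVec Φ' r := fun Φ Φ' => by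
    funext i
    simp [conjVec]
  simp only [radialA]
  rw [h, hadd, hadd]
  simp only [Nat.cast_zero, neg_zero]
  have e : ∀ Φ, conjVec (w.radialWBlock 0 Φ) r = w.radialWBlock 0 (conjVec Φ) r :=
    fun Φ => w.conjVec_radialWBlock 0 Φ r
  have e' : conjVec (fun r => w.radialL0 ℓ Ψ r) r = w.radialL0 ℓ (conjVec Ψ) r :=
    w.conjVec_radialL0 ℓ Ψ r
  rw [e', e, e, conjVec_conjVec]
  module

lemma radialA_fst (ℓ m : ℕ) (Ψ Φ : ℝ → Fin 4 → ℂ) (r : ℝ) :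
    (w.radialA ℓ m (Ψ, conjVec Φ)).1 r = ((-I) • (diracRadial ℓ Ψ +
      (fun r => ((S.g (w.tau r) : ℝ) : ℂ) • ![Ψ r 0, -Ψ r 1, Ψ r 2, -Ψ r 3]) - (ω : ℂ) • Ψ +
      (w.radialWBlock (-m) Ψ + conjVec (w.radialWBlock m Φ)))) r := by
  simp only [radialA, radialL0_eq, ← conjVec_radialWBlock, Pi.smul_apply, Pi.add_apply,
    Pi.sub_apply]
  module

/-- The second row acts on the conjugate of the coefficients of order -m. Undoing the conjugation
turns -i·(-1) back into -i, so that both sectors carry the same operator -iℒ. -/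
lemma conjVec_radialA_snd (ℓ m : ℕ) (Ψ Φ : ℝ → Fin 4 → ℂ) (r : ℝ) :
    conjVec (w.radialA ℓ m (Ψ, conjVec Φ)).2 r = ((-I) • (diracRadial ℓ Φ +
      (fun r => ((S.g (w.tau r) : ℝ) : ℂ) • ![Φ r 0, -Φ r 1, Φ r 2, -Φ r 3]) - (ω : ℂ) • Φ +
      (conjVec (w.radialWBlock (-m) Ψ) + w.radialWBlock m Φ))) r := by
  have h0 := w.radialL0_eq ℓ Φ r
  have h1 : conjVec (w.radialL0 ℓ (conjVec Φ)) r = w.radialL0 ℓ Φ r := by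
    rw [conjVec_radialL0, conjVec_conjVec]
  have h2 : conjVec (w.radialWBlock m (conjVec Φ)) r = w.radialWBlock m Φ r := by
    rw [conjVec_radialWBlock, conjVec_conjVec]
  have h3 : conjVec (w.radialA ℓ m (Ψ, conjVec Φ)).2 r =
      (-I) • (conjVec (w.radialL0 ℓ (conjVec Φ)) r + conjVec (w.radialWBlock (-m) Ψ) r +
        conjVec (w.radialWBlock m (conjVec Φ)) r) := by
    funext i
    simp [radialA, conjVec]
    ring
  rw [h3, h1, h2, h0]
  simp only [Pi.smul_apply, Pi.add_apply, Pi.sub_apply]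
  module

lemma diracOp_add {F G : Space → Spinor} {x : Space} (hF : DifferentiableAt ℝ F x)
    (hG : DifferentiableAt ℝ G x) :
    diracOp (fun y => F y + G y) x = diracOp F x + diracOp G x := by
  simp only [diracOp, fderiv_fun_add hF hG, add_apply, map_add, Finset.sum_add_distrib, smul_add]

theorem lin_fieldX_zero (ℓ : ℕ) (Ψ : ℝ → Fin 4 → ℂ) (ρ : w.lin.domain)
    (hΨ : ContDiffOn ℝ 1 Ψ (Ioi 0)) (hρ : (ρ : L2) =ᵐ[volume] fieldX ℓ 0 Ψ) :
    ((-I) • w.lin ρ : L2) =ᵐ[volume] fieldX ℓ 0 (w.radialA ℓ 0 (Ψ, conjVec Ψ)).1 := by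
  have hD := D0_ae_eq_diracOp ⟨ρ, ρ.2⟩ (contDiffOn_fieldX ℓ 0 hΨ) hρ
  have hL := w.coeFn_lin ρ ⟨ρ, ρ.2⟩ rfl
  filter_upwards [Lp.coeFn_smul (-I) (w.lin ρ), hD, hL, hρ, ae_ne_zero] with x h1 h2 h3 h4 hx
  -- For k = 0 the sectors k and -k coincide, and the linear and antilinear halves add up in one
  -- space.
  have h5 : ∀ r, w.radialWBlock (-((0 : ℕ) : ℝ)) Ψ r = w.radialWBlock (-((0 : ℤ) : ℝ)) Ψ r :=
    fun r => by simp
  have h6 : ∀ r, w.radialWBlock ((0 : ℕ) : ℝ) Ψ r = w.radialWBlock (-((0 : ℤ) : ℝ)) Ψ r :=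
    fun r => by simp
  rw [h1, Pi.smul_apply, h3, h2]
  simp only [h4]
  rw [diracOp_fieldX ℓ 0 hx (differentiableAt_coeff hΨ hx), w.potential_fieldX,
    w.rePotential_fieldX ℓ 0 Ψ hx, neg_zero, fieldX_congr (w.radialA_fst ℓ 0 Ψ Ψ ‖x‖),
    fieldX_smul_sum, funext h5, funext h6]

theorem lin_fieldX_add (ℓ m : ℕ) (Ψp Ψm : ℝ → Fin 4 → ℂ) (ρ : w.lin.domain)
    (hp : ContDiffOn ℝ 1 Ψp (Ioi 0)) (hm : ContDiffOn ℝ 1 Ψm (Ioi 0))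
    (hρ : (ρ : L2) =ᵐ[volume] fun x => fieldX ℓ m Ψp x + fieldX ℓ (-m) Ψm x) :
    ((-I) • w.lin ρ : L2) =ᵐ[volume] fun x => fieldX ℓ m (w.radialA ℓ m (Ψp, conjVec Ψm)).1 x +
      fieldX ℓ (-m) (conjVec (w.radialA ℓ m (Ψp, conjVec Ψm)).2) x := by
  have hFp := contDiffOn_fieldX ℓ m hp
  have hFm := contDiffOn_fieldX ℓ (-m) hm
  have hD := D0_ae_eq_diracOp ⟨ρ, ρ.2⟩ (hFp.add hFm) hρ
  have hL := w.coeFn_lin ρ ⟨ρ, ρ.2⟩ rfl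
  filter_upwards [Lp.coeFn_smul (-I) (w.lin ρ), hD, hL, hρ, ae_ne_zero] with x h1 h2 h3 h4 hx
  have hd : ∀ {F : Space → Spinor}, ContDiffOn ℝ 1 F {0}ᶜ → DifferentiableAt ℝ F x := fun hF =>
    (hF.contDiffAt (isOpen_compl_singleton.mem_nhds hx)).differentiableAt one_ne_zero
  have h2' : D0 ⟨ρ, ρ.2⟩ x = diracOp (fun x => fieldX ℓ m Ψp x + fieldX ℓ (-m) Ψm x) x := h2
  rw [h1, Pi.smul_apply, h3, h2', diracOp_add (hd hFp) (hd hFm)]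
  simp only [h4]
  rw [diracOp_fieldX ℓ m hx (differentiableAt_coeff hp hx),
    diracOp_fieldX ℓ (-m) hx (differentiableAt_coeff hm hx), map_add, map_add,
    w.potential_fieldX, w.potential_fieldX, w.rePotential_fieldX ℓ m Ψp hx,
    w.rePotential_fieldX ℓ (-m) Ψm hx, neg_neg, fieldX_congr (w.radialA_fst ℓ m Ψp Ψm ‖x‖),
    fieldX_congr (w.conjVec_radialA_snd ℓ m Ψp Ψm ‖x‖), fieldX_smul_sum, fieldX_smul_sum]
  -- After the casts agree, the two sides differ only in the order in which the own and the crossed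
  -- W terms of the two sectors are collected.
  simp only [Int.cast_neg, Int.cast_natCast, neg_neg]
  module

end SolitaryWave

end

end Soler

end

theorem mainTheorem2 (S : Soler.Model) (ω : ℝ) (w : Soler.SolitaryWave S ω) :
    -- invariance of the subspaces
    (∀ ℓ : ℕ, Soler.IsInvariant w.lin (Soler.X0 ℓ)) ∧
    (∀ ℓ m : ℕ, 1 ≤ m → m ≤ ℓ → Soler.IsInvariant w.lin (Soler.X ℓ m)) ∧
    (∀ ℓ : ℕ, Soler.IsInvariant w.lin (Soler.Y ℓ)) ∧
    -- on `𝒴_ℓ`, the linearization coincides with the self-adjoint operator `ℒ₀`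
    IsSelfAdjoint w.lin0 ∧
    (∀ (ℓ : ℕ) (ρ : w.lin.domain) (ρ' : w.lin0.domain),
      (ρ : Soler.L2) ∈ Soler.Y ℓ → (ρ : Soler.L2) = ρ' → w.lin ρ = w.lin0 ρ') ∧
    -- hence its restriction to `𝒴_ℓ` is a complex-linear operator, and the spectrum of
    -- `-i` times this restriction is purely imaginary
    (∀ ℓ : ℕ, ∃ T : Soler.Y ℓ →ₗ.[ℂ] Soler.Y ℓ,
      Soler.IsRestriction w.lin (Soler.Y ℓ) T ∧
      Soler.spec ((-Complex.I) • T) ⊆ {z : ℂ | z.re = 0}) ∧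
    -- action in the radial coordinates: on `𝒳_{ℓ,0}` ...
    (∀ (ℓ : ℕ) (Ψ : ℝ → Fin 4 → ℂ) (ρ : w.lin.domain),
      ContDiffOn ℝ 1 Ψ (Set.Ioi 0) →
      (ρ : Soler.L2) =ᵐ[MeasureTheory.volume] Soler.fieldX ℓ 0 Ψ →
      ((-Complex.I) • w.lin ρ : Soler.L2) =ᵐ[MeasureTheory.volume]
        Soler.fieldX ℓ 0 (w.radialA ℓ 0 (Ψ, Soler.conjVec Ψ)).1 ∧
      ∀ r : ℝ, 0 < r → (w.radialA ℓ 0 (Ψ, Soler.conjVec Ψ)).2 r =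
        Soler.conjVec (w.radialA ℓ 0 (Ψ, Soler.conjVec Ψ)).1 r) ∧
    -- ... and on `𝒳_{ℓ,m}`
    (∀ (ℓ m : ℕ) (Ψp Ψm : ℝ → Fin 4 → ℂ) (ρ : w.lin.domain), 1 ≤ m → m ≤ ℓ →
      ContDiffOn ℝ 1 Ψp (Set.Ioi 0) → ContDiffOn ℝ 1 Ψm (Set.Ioi 0) →
      (ρ : Soler.L2) =ᵐ[MeasureTheory.volume]
        (fun x => Soler.fieldX ℓ m Ψp x + Soler.fieldX ℓ (-m) Ψm x) →
      ((-Complex.I) • w.lin ρ : Soler.L2) =ᵐ[MeasureTheory.volume]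
        fun x => Soler.fieldX ℓ m (w.radialA ℓ m (Ψp, Soler.conjVec Ψm)).1 x +
          Soler.fieldX ℓ (-m) (Soler.conjVec (w.radialA ℓ m (Ψp, Soler.conjVec Ψm)).2) x) := by
  refine ⟨fun ℓ => w.isInvariant_X0 ℓ, fun ℓ m _ _ => w.isInvariant_X ℓ m,
    fun ℓ => w.isInvariant_Y ℓ, w.isSelfAdjoint_lin0, w.lin_eq_lin0,
    fun ℓ => ⟨w.linY ℓ, w.isRestriction_linY ℓ, w.spec_linY ℓ⟩, fun ℓ Ψ ρ hΨ hρ => ?_,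
    fun ℓ m Ψp Ψm ρ _ _ hp hm hρ => w.lin_fieldX_add ℓ m Ψp Ψm ρ hp hm hρ⟩
  exact ⟨w.lin_fieldX_zero ℓ Ψ ρ hΨ hρ, fun r _ => w.radialA_zero_snd ℓ Ψ r⟩
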